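/- Let $m,n$ be square-free integers such that $L=\mathbb{Q}(\sqrt m,\sqrt n)$ is a biquadratic (degree $4$) extension of $\mathbb{Q}$. Put $d=\gcd(m,n)>0$ and $k=mn/d^2$, fix square roots $\sqrt m,\sqrt n\in L$, and let $\sqrt k=\sqrt m\sqrt n/d$. Let $G=\mathrm{Gal}(L/\mathbb{Q})=\{1,\sigma,\tau,\sigma\tau\}$, where $\sigma(\sqrt m)=-\sqrt m$, $\sigma(\sqrt n)=\sqrt n$, $\tau(\sqrt m)=\sqrt m$, $\tau(\sqrt n)=-\sqrt n$, and let $\lambda:G\to\mathrm{Perm}(G)$ be the left regular representation. Define the subgroups $N_1=\langle\lambda(\tau),(1,\sigma\tau,\tau,\sigma)\rangle$, $N_2=\langle\lambda(\sigma),(1,\sigma\tau,\sigma,\tau)\rangle$, $N_3=\langle\lambda(\sigma\tau),(1,\tau,\sigma\tau,\sigma)\rangle$ of $\mathrm{Perm}(G)$, and let $H_i=L[N_i]^G$, where $G$ acts on $L$ as Galois group and on $N_i$ by conjugation through $\lambda$; it acts on $L$ by $(\sum_\eta c_\eta\eta)\cdot x=\sum_\eta c_\eta\,\eta^{-1}(1_G)(x)$.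 Let $\mathfrak A_{H_i}=\{h\in H_i : h\cdot\mathcal O_L\subseteq\mathcal O_L\}$ be the associated order of the ring of integers $\mathcal O_L$ in $H_i$. A free generator of $\mathcal O_L$ over $\mathfrak A_{H_i}$ is an element $\beta\in\mathcal O_L$ such that $h\mapsto h\cdot\beta$ is a bijection $\mathfrak A_{H_i}\to\mathcal O_L$. The regular subgroups of $\mathrm{Perm}(G)$ that are normalized by $\lambda(G)$ and different from $\lambda(G)$ are exactly $N_1,N_2,N_3$; they are distinct and cyclic of order $4$. (So $H_1,H_2,H_3$ are the three non-classical Hopf–Galois structures on $L/\mathbb{Q}$, by the Greither–Pareigis correspondence, and they are of type $C_4$.) Moreover: 1. Let $m\equiv3$ and $n\equiv2\pmod 4$, and let $\gamma_1=1$, $\gamma_2=\sqrt m$, $\gamma_3=\sqrt n$, $\gamma_4=\frac{\sqrt n+\sqrt k}{2}$. Then $\mathcal O_L$ is a free $\mathfrak A_{H_i}$-module if and only if there are $x,y\in\mathbb{Z}$ with - $x^2+my^2=\pm4d$, if $i=1$; - $x^2+ny^2=\pm2d$, if $i=2$; - $x^2+ky^2=\pm2\frac nd$, if $i=3$. For every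 such pair $(x,y)$ a free generator is, respectively, $\gamma_1+\gamma_2+\frac{x-dy}{2d}\gamma_3+y\gamma_4$; $\gamma_1+\frac{x}{2d}\gamma_2+\frac{1-y}{2}\gamma_3+y\gamma_4$; $\gamma_1+\frac y2\gamma_2+\frac{xd-n}{2n}\gamma_3+\gamma_4$. 2. Let $m\equiv1$ and $n\not\equiv1\pmod 4$, and let $\gamma_1=1$, $\gamma_2=\frac{1+\sqrt m}2$, $\gamma_3=\sqrt n$, $\gamma_4=\frac{\sqrt n+\sqrt k}{2}$. Then $\mathcal O_L$ is $\mathfrak A_{H_1}$-free if and only if there are $x,y\in\mathbb{Z}$ with $x^2+my^2=\pm2d$, and for every such pair a free generator is $\gamma_1-\gamma_2+\frac{x-dy}{2d}\gamma_3+y\gamma_4$. Moreover, $\mathcal O_L$ is neither $\mathfrak A_{H_2}$-free nor $\mathfrak A_{H_3}$-free. 3. Let $m\equiv n\equiv1\pmod 4$, and let $\gamma_1=1$, $\gamma_2=\frac{1+\sqrt m}2$, $\gamma_3=\frac{1+\sqrt n}2$, $\gamma_4=\frac{1+\sqrt m}2\cdot\frac{1+\sqrt k}2$. Then $\mathcal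 O_L$ is $\mathfrak A_{H_i}$-free if and only if there are $x,y\in\mathbb{Z}$ with - $x^2+my^2=\pm2d$, if $i=1$; - $x^2+ny^2=\pm2d$, if $i=2$; - $x^2+ky^2=\pm2\frac nd$, if $i=3$. For every such pair $(x,y)$ a free generator is, respectively, - $\frac12\left(\frac{my-x}{2d}-\epsilon\right)\gamma_1+\frac{1-y}2\gamma_2+\frac{x-my}{2d}\gamma_3+y\gamma_4$ with $\epsilon=\frac{x-my}{2d}\bmod 2\in\{0,1\}$; - $\frac14\left(\frac{my-x}{d}-\epsilon\right)\gamma_1+\frac{x-yd}{2d}\gamma_2+\frac{d-my}{2d}\gamma_3+y\gamma_4$ with $\epsilon=\frac{my-x}d\bmod 4\in\{0,1,2,3\}$; - $\frac14\left(\frac{k-x}{n/d}-y+\epsilon\right)\gamma_1+\frac{y-1}2\gamma_2+\frac{x-k}{2n/d}\gamma_3+\gamma_4$ with $\epsilon=\left(\left(\frac{k-x}{n/d}-y\right)\bmod 4\right)-2$ (residue in $\{0,1,2,3\}$). -/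

import Mathlib

open NumberField

noncomputable section

namespace HopfGalois

section GreitherPareigis

variable (K L : Type*) [Field K] [Field L] [Algebra K L]

/-- The left regular representation `λ : G → Perm G` of the group `G = Gal(L/K)`,
`λ(g)(x) = g x`. -/
def leftReg : Gal(L/K) →* Equiv.Perm Gal(L/K) :=
  MulAction.toPermHom Gal(L/K) Gal(L/K)

variable {K L}

/-- `N` is a regular subgroup of `Perm G` (it acts simply transitively on `G`) which is normalized
by `λ(G)`. By the theorem of Greither and Pareigis these subgroups correspond bijectively to the
Hopf-Galois structures on the Galois extension `L/K`, the structure that belongs to `N` being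
the algebra `L[N]^G` (`hopfAlg N`) with the action `rep N`; its type is the isomorphism
class of `N`, and if `G` is abelian the classical structure belongs to `N = λ(G)`. -/
def IsGreitherPareigis (N : Subgroup (Equiv.Perm Gal(L/K))) : Prop :=
  (∀ a b : Gal(L/K), ∃! f : Equiv.Perm Gal(L/K), f ∈ N ∧ f a = b) ∧
    ∀ g : Gal(L/K), ∀ f ∈ N, leftReg K L g * f * (leftReg K L g)⁻¹ ∈ N

/-- The action of `g ∈ G` on the group algebra `L[Perm G]`: by `g` on the coefficients and by
conjugation with `λ(g)` on the permutations. -/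
def galAct (g : Gal(L/K)) :
    MonoidAlgebra L (Equiv.Perm Gal(L/K)) →ₐ[K] MonoidAlgebra L (Equiv.Perm Gal(L/K)) :=
  (MonoidAlgebra.mapDomainAlgHom K L (MulAut.conj (leftReg K L g)).toMonoidHom).comp
    (MonoidAlgebra.mapAlgHom _ (g : L →ₐ[K] L))

/-- The `K`-algebra `L[N]^G`, inside `L[Perm G]`. -/
def hopfAlg (N : Subgroup (Equiv.Perm Gal(L/K))) :
    Subalgebra K (MonoidAlgebra L (Equiv.Perm Gal(L/K))) :=
  (MonoidAlgebra.mapDomainAlgHom K L N.subtype).range ⊓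
    ⨅ g : Gal(L/K), AlgHom.equalizer (galAct g) (AlgHom.id K _)

/-- The operation `(∑ c_η η) · x = ∑ c_η (η⁻¹(1_G))(x)` of `∑ c_η η ∈ L[Perm G]` on `x ∈ L`. -/
def act (h : MonoidAlgebra L (Equiv.Perm Gal(L/K))) : Module.End K L :=
  h.coeff.sum fun η c => c • ((η⁻¹ 1 : Gal(L/K)) : L →ₐ[K] L).toLinearMap

theorem act_single (η : Equiv.Perm Gal(L/K)) (c : L) :
    act (MonoidAlgebra.single η c) =
      c • ((η⁻¹ 1 : Gal(L/K)) : L →ₐ[K] L).toLinearMap := by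
  simp [act]

theorem act_zero : act (0 : MonoidAlgebra L (Equiv.Perm Gal(L/K))) = 0 := by
  simp [act]

theorem act_add (x y : MonoidAlgebra L (Equiv.Perm Gal(L/K))) :
    act (x + y) = act x + act y := by
  classical
  simp only [act, MonoidAlgebra.coeff_add]
  exact Finsupp.sum_add_index' (fun _ => zero_smul _ _) (fun _ _ _ => add_smul _ _ _)

theorem act_smul (r : K) (x : MonoidAlgebra L (Equiv.Perm Gal(L/K))) :
    act (r • x) = r • act x := by
  induction x using MonoidAlgebra.induction_linear with
  | zero => simp [act_zero]
  | add x y hx hy => rw [smul_add, act_add, hx, hy, act_add, smul_add]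
  | single η c =>
    rw [MonoidAlgebra.smul_single, act_single, act_single, smul_assoc]

theorem act_one : act (1 : MonoidAlgebra L (Equiv.Perm Gal(L/K))) = 1 := by
  rw [MonoidAlgebra.one_def, act_single]
  ext x
  simp

theorem act_single_mul (η : Equiv.Perm Gal(L/K)) (c : L)
    (z : MonoidAlgebra L (Equiv.Perm Gal(L/K))) :
    act (MonoidAlgebra.single η c * galAct (η⁻¹ 1) z) =
      act (MonoidAlgebra.single η c) * act z := by
  induction z using MonoidAlgebra.induction_linear with
  | zero => simp [act_zero]
  | add x y hx hy => rw [map_add, mul_add, act_add, hx, hy, act_add, mul_add]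
  | single θ b =>
    have h1 : galAct (η⁻¹ 1) (MonoidAlgebra.single θ b) =
        MonoidAlgebra.single (leftReg K L (η⁻¹ 1) * θ * (leftReg K L (η⁻¹ 1))⁻¹)
          ((η⁻¹ 1 : Gal(L/K)) b) := by
      simp [galAct]
    have h2 : (η * (leftReg K L (η⁻¹ 1) * θ * (leftReg K L (η⁻¹ 1))⁻¹))⁻¹ 1 =
        η⁻¹ 1 * θ⁻¹ 1 := by
      simp only [mul_inv_rev, inv_inv, Equiv.Perm.mul_apply, ← map_inv]
      simp [leftReg]
    rw [h1, MonoidAlgebra.single_mul_single, act_single, h2, act_single, act_single]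
    ext x
    simp [mul_assoc]

theorem act_mul (x y : MonoidAlgebra L (Equiv.Perm Gal(L/K)))
    (hy : ∀ g : Gal(L/K), galAct g y = y) : act (x * y) = act x * act y := by
  induction x using MonoidAlgebra.induction_linear with
  | zero => simp [act_zero]
  | add u v hu hv => rw [add_mul, act_add, hu, hv, act_add, add_mul]
  | single η c => rw [← act_single_mul, hy]

/-- The action of `L[N]^G` on `L`, as a representation `L[N]^G → End_K(L)`. -/
def rep (N : Subgroup (Equiv.Perm Gal(L/K))) : hopfAlg N →ₐ[K] Module.End K L :=
  AlgHom.ofLinearMap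
    { toFun := fun h => act h.1
      map_add' := fun x y => act_add x.1 y.1
      map_smul' := fun r x => act_smul r x.1 }
    act_one
    (fun x y => act_mul x.1 y.1 fun g => by
      have h := (Algebra.mem_iInf.mp y.2.2) g
      exact h)

open Classical in
/-- The subgroup `N_{T,1} = ⟨μ, η⟩` of `Perm G` for `T = ⟨τ⟩`, where `μ = λ(τ)` and `η` is the
4-cycle `(1, στ, τ, σ)`, for an elementary abelian group `G = ⟨σ, τ⟩` of order 4. -/
def subgroupN (σ τ : Gal(L/K)) : Subgroup (Equiv.Perm Gal(L/K)) :=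
  Subgroup.closure {leftReg K L τ, List.formPerm [1, σ * τ, τ, σ]}

end GreitherPareigis

section AssociatedOrder

variable {L : Type*} [Field L] [NumberField L] {H : Type*} [Ring H] [Algebra ℚ H]

/-- The associated order `{h ∈ H | h · 𝓞 L ⊆ 𝓞 L}` of `𝓞 L` in a `ℚ`-algebra `H` that acts on `L`
through `ρ : H → End_ℚ(L)`. -/
def associatedOrder (ρ : H →ₐ[ℚ] Module.End ℚ L) : Subring H where
  carrier := {h | ∀ x : 𝓞 L, IsIntegral ℤ (ρ h (x : L))}
  mul_mem' := by
    intro a b ha hb x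
    rw [map_mul]
    exact ha ⟨_, hb x⟩
  one_mem' := by
    intro x
    rw [map_one]
    exact x.2
  add_mem' := by
    intro a b ha hb x
    rw [map_add]
    exact (ha x).add (hb x)
  zero_mem' := by
    intro x
    rw [map_zero]
    exact isIntegral_zero
  neg_mem' := by
    intro a ha x
    rw [map_neg]
    exact (ha x).neg

instance (ρ : H →ₐ[ℚ] Module.End ℚ L) : Module (associatedOrder ρ) (𝓞 L) where
  smul h x := ⟨ρ h.1 (x : L), h.2 x⟩
  one_smul x := by
    apply RingOfIntegers.ext
    change ρ 1 (x : L) = x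
    rw [map_one]; rfl
  mul_smul a b x := by
    apply RingOfIntegers.ext
    change ρ (a.1 * b.1) (x : L) = ρ a.1 (ρ b.1 (x : L))
    rw [map_mul]; rfl
  smul_zero a := by
    apply RingOfIntegers.ext
    change ρ a.1 ((0 : 𝓞 L) : L) = ((0 : 𝓞 L) : L)
    simp
  smul_add a x y := by
    apply RingOfIntegers.ext
    change ρ a.1 ((x + y : 𝓞 L) : L) = ρ a.1 (x : L) + ρ a.1 (y : L)
    simp
  add_smul a b x := by
    apply RingOfIntegers.ext
    change ρ (a.1 + b.1) (x : L) = ρ a.1 (x : L) + ρ b.1 (x : L)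
    simp
  zero_smul x := by
    apply RingOfIntegers.ext
    change ρ 0 (x : L) = ((0 : 𝓞 L) : L)
    simp

/-- `𝓞 L` is free as a module over its associated order in `L[N]^G`. -/
def IsFree (N : Subgroup (Equiv.Perm Gal(L/ℚ))) : Prop :=
  Module.Free (associatedOrder (rep N)) (𝓞 L)

/-- `b` lies in `𝓞 L` and is a free generator of `𝓞 L` over its associated order in `L[N]^G`:
every element of `𝓞 L` is `a · b` for exactly one `a` in the associated order. -/
def IsFreeGenerator (N : Subgroup (Equiv.Perm Gal(L/ℚ))) (b : L) : Prop :=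
  ∃ β : 𝓞 L, (β : L) = b ∧ Function.Bijective fun a : associatedOrder (rep N) => a • β

/-- The integral basis `γ₁, γ₂, γ₃, γ₄` in the case `m ≡ 3`, `n ≡ 2` mod 4; here and below
`sm`, `sn`, `sk` are the square roots of `m`, `n`, `k`. -/
def basisA (sm sn sk : L) : Fin 4 → L := ![1, sm, sn, (sn + sk) / 2]

/-- The integral basis in the case `m ≡ 1`, `n ≢ 1` mod 4. -/
def basisB (sm sn sk : L) : Fin 4 → L := ![1, (1 + sm) / 2, sn, (sn + sk) / 2]

/-- The integral basis in the case `m ≡ n ≡ 1` mod 4. -/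
def basisC (sm sn sk : L) : Fin 4 → L :=
  ![1, (1 + sm) / 2, (1 + sn) / 2, ((1 + sm) / 2) * ((1 + sk) / 2)]

/-- The element `b₁γ₁ + b₂γ₂ + b₃γ₃ + b₄γ₄`. -/
def comb (γ : Fin 4 → L) (b : Fin 4 → ℚ) : L := ∑ j, b j • γ j

end AssociatedOrder

end HopfGalois

end

/-!
Let `a` be one of `m`, `n`, `k`, let `b`, `c` be the other two, and write `√a √b = g √c`,
`√a √c = g' √b`, so that `a = g g'` with coprime `g`, `g'`. Each of the three subgroups is generated
by a 4-cycle `η` whose square is the translation by the automorphism that fixes `√a`. The fixed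
elements of `L[N]` are the combinations of `1`, `η + η⁻¹`, `η²` and `√a (η - η⁻¹)` with rational
coefficients, and in the basis `1, √a, √b, √c` of `L` they act as the operators

`(v₀, v₁, v₂, v₃) ↦ (p v₀, q v₁, r v₂ - s g' v₃, r v₃ + s g v₂)`, with `p, q, r, s ∈ ℚ`

(`Frame.exists_params`, `Frame.exists_act_eq`). So the Hopf algebra is `ℚ × ℚ × ℚ[J]` with
`J² = -a`, and `L` is free of rank one over it; freeness of `𝓞 L` over its associated order means
that there is a generator (`Frame.isFree_iff`), and the question becomes one about the lattice of
the coordinates of `𝓞 L` (`Frame.isFreeGenerator_iff`, `IsLatticeGenerator`). The lattice is one of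
`latticeA`, `latticeB`, `latticeC`, according to the residues of `m` and `n` modulo 4.

If `v` generates the lattice, then the quotients of `√b` and `√c` by `v` belong to the order; their
determinants on the last two coordinates are `g / N` and `g' / N`, where `N = g v₂² + g' v₃²`. In
each case these determinants lie in a fixed `κ ℤ`, whence `κ Z N = 1` for an integer `Z`, because
`g` and `g'` are coprime (`IsLatticeGenerator.exists_mul_norm_eq_one`). Clearing the denominators of
`v₂`, `v₃` this reads `g X² + g' y² = ±2` or `±4`; other values are excluded by parity, and in the
two cases without freeness parity excludes every value. Conversely, a lattice vector with this norm
whose first two coordinates are nonzero and as small as possible is checked to be a generator: the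
operators that map it into the lattice satisfy explicit congruences, by which they map the whole
lattice into itself. Finally, as `g` is square-free, `x = g X` turns `g X² + g' y² = ±c` into
`x² + a y² = ±c g`.
-/

noncomputable section

namespace HopfGalois

/-! ### The Klein four-group and its regular subgroups -/

section Klein

/-- The elements `σ`, `τ` generate `G`, which is a Klein four-group `{1, σ, τ, στ}`. -/
structure IsKleinPair {G : Type*} [Group G] (σ τ : G) : Prop where
  sq_left : σ * σ = 1
  sq_right : τ * τ = 1
  left_ne : σ ≠ 1
  right_ne : τ ≠ 1
  ne : σ ≠ τ
  cover : ∀ g : G, g = 1 ∨ g = σ ∨ g = τ ∨ g = σ * τ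

namespace IsKleinPair

variable {G : Type*} [Group G] {σ τ : G}

theorem comm (h : IsKleinPair σ τ) : τ * σ = σ * τ := by
  rcases h.cover (τ * σ) with h1 | h1 | h1 | h1
  · exact absurd ((mul_left_inj σ).1 (h.sq_left.trans h1.symm)) h.ne
  · exact absurd (mul_eq_right.1 h1) h.right_ne
  · exact absurd (mul_eq_left.1 h1) h.left_ne
  · exact h1

theorem mul_ne_one (h : IsKleinPair σ τ) : σ * τ ≠ 1 := fun h1 =>
  h.ne ((mul_left_inj τ).1 (h1.trans h.sq_right.symm))

theorem mul_ne_left (h : IsKleinPair σ τ) : σ * τ ≠ σ := fun h1 => h.right_ne (mul_eq_left.1 h1)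

theorem mul_ne_right (h : IsKleinPair σ τ) : σ * τ ≠ τ := fun h1 => h.left_ne (mul_eq_right.1 h1)

theorem left_mul_mul (h : IsKleinPair σ τ) : σ * (σ * τ) = τ := by
  rw [← mul_assoc, h.sq_left, one_mul]

theorem right_mul_mul (h : IsKleinPair σ τ) : τ * (σ * τ) = σ := by
  rw [← h.comm, ← mul_assoc, h.sq_right, one_mul]

theorem swap (h : IsKleinPair σ τ) : IsKleinPair τ σ where
  sq_left := h.sq_right
  sq_right := h.sq_left
  left_ne := h.right_ne
  right_ne := h.left_ne
  ne := h.ne.symm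
  cover g := by
    rw [h.comm]
    rcases h.cover g with h1 | h1 | h1 | h1 <;> simp [h1]

theorem mul_right (h : IsKleinPair σ τ) : IsKleinPair σ (σ * τ) where
  sq_left := h.sq_left
  sq_right := by rw [mul_assoc, h.right_mul_mul, h.sq_left]
  left_ne := h.left_ne
  right_ne := h.mul_ne_one
  ne := h.mul_ne_left.symm
  cover g := by
    rw [h.left_mul_mul]
    rcases h.cover g with h1 | h1 | h1 | h1 <;> simp [h1]

/-- The enumeration `1, σ, τ, στ` of a Klein four-group. -/
def enum (h : IsKleinPair σ τ) : Fin 4 ≃ G :=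
  Equiv.ofBijective ![1, σ, τ, σ * τ] (by
    constructor
    · have h1 := h.left_ne
      have h2 := h.right_ne
      have h3 := h.ne
      have h4 := h.mul_ne_one
      have h5 := h.mul_ne_left
      have h6 := h.mul_ne_right
      intro i j hij
      fin_cases i <;> fin_cases j <;>
        simp_all [Matrix.cons_val_zero, Matrix.cons_val_one, eq_comm]
    · intro g
      rcases h.cover g with h1 | h1 | h1 | h1
      exacts [⟨0, h1.symm⟩, ⟨1, h1.symm⟩, ⟨2, h1.symm⟩, ⟨3, h1.symm⟩])

theorem enum_zero (h : IsKleinPair σ τ) : h.enum 0 = 1 := rfl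
theorem enum_one (h : IsKleinPair σ τ) : h.enum 1 = σ := rfl
theorem enum_two (h : IsKleinPair σ τ) : h.enum 2 = τ := rfl
theorem enum_three (h : IsKleinPair σ τ) : h.enum 3 = σ * τ := rfl

theorem card_eq (h : IsKleinPair σ τ) : Nat.card G = 4 := by
  rw [← Nat.card_congr h.enum, Nat.card_eq_fintype_card, Fintype.card_fin]

/-- Permutations of `{0, 1, 2, 3}` as permutations of the Klein four-group. -/
def permHom (h : IsKleinPair σ τ) : Equiv.Perm (Fin 4) ≃* Equiv.Perm G := h.enum.permCongrHom

theorem permHom_apply (h : IsKleinPair σ τ) (f : Equiv.Perm (Fin 4)) (i : Fin 4) :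
    h.permHom f (h.enum i) = h.enum (f i) := by
  simp [permHom, Equiv.permCongrHom]

theorem eq_permHom (h : IsKleinPair σ τ) {f : Equiv.Perm G} {p : Equiv.Perm (Fin 4)}
    (h0 : f 1 = h.enum (p 0)) (h1 : f σ = h.enum (p 1)) (h2 : f τ = h.enum (p 2))
    (h3 : f (σ * τ) = h.enum (p 3)) : f = h.permHom p := by
  ext g
  obtain ⟨i, rfl⟩ := h.enum.surjective g
  rw [permHom_apply]
  fin_cases i
  exacts [h0, h1, h2, h3]

end IsKleinPair

/-- The translations of the Klein four-group, on the indices of `IsKleinPair.enum`. -/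
def kleinPerm : Fin 4 → Equiv.Perm (Fin 4) :=
  ![1, ⟨![1, 0, 3, 2], ![1, 0, 3, 2], by decide, by decide⟩,
    ⟨![2, 3, 0, 1], ![2, 3, 0, 1], by decide, by decide⟩,
    ⟨![3, 2, 1, 0], ![3, 2, 1, 0], by decide, by decide⟩]

/-- The 4-cycles `(0 3 2 1)`, `(0 3 1 2)`, `(0 2 3 1)`, that is `(1, στ, τ, σ)`, `(1, στ, σ, τ)`,
`(1, τ, στ, σ)`. -/
def fourCycle : Fin 3 → Equiv.Perm (Fin 4) :=
  ![⟨![3, 0, 1, 2], ![1, 2, 3, 0], by decide, by decide⟩,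
    ⟨![3, 2, 0, 1], ![2, 3, 1, 0], by decide, by decide⟩,
    ⟨![2, 0, 3, 1], ![1, 3, 0, 2], by decide, by decide⟩]

theorem formPerm_four {α : Type*} [DecidableEq α] {a b c d : α} (hab : a ≠ b) (hac : a ≠ c)
    (had : a ≠ d) (hbc : b ≠ c) (hbd : b ≠ d) (hcd : c ≠ d) :
    List.formPerm [a, b, c, d] a = b ∧ List.formPerm [a, b, c, d] b = c ∧
      List.formPerm [a, b, c, d] c = d ∧ List.formPerm [a, b, c, d] d = a := by
  simp only [List.formPerm_cons_cons, List.formPerm_singleton, mul_one, Equiv.Perm.mul_apply]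
  refine ⟨?_, ?_, ?_, ?_⟩
  · rw [Equiv.swap_apply_of_ne_of_ne hac had, Equiv.swap_apply_of_ne_of_ne hab hac,
      Equiv.swap_apply_left]
  · rw [Equiv.swap_apply_of_ne_of_ne hbc hbd, Equiv.swap_apply_left,
      Equiv.swap_apply_of_ne_of_ne hac.symm hbc.symm]
  · rw [Equiv.swap_apply_left, Equiv.swap_apply_of_ne_of_ne hbd.symm hcd.symm,
      Equiv.swap_apply_of_ne_of_ne had.symm hbd.symm]
  · rw [Equiv.swap_apply_right, Equiv.swap_apply_right, Equiv.swap_apply_right]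

end Klein

section Regular

variable {K L : Type*} [Field K] [Field L] [Algebra K L] {σ τ : Gal(L/K)}

theorem leftReg_apply (g x : Gal(L/K)) : leftReg K L g x = g * x := rfl

theorem leftReg_enum (h : IsKleinPair σ τ) (i : Fin 4) :
    leftReg K L (h.enum i) = h.permHom (kleinPerm i) := by
  apply h.eq_permHom <;> rw [leftReg_apply] <;> fin_cases i <;>
    simp [kleinPerm, h.enum_zero, h.enum_one, h.enum_two, h.enum_three, h.sq_left, h.sq_right,
      h.comm, mul_assoc, h.left_mul_mul, h.right_mul_mul]

open Classical in
/-- The subgroup `subgroupN σ τ` is cyclic: the square of its 4-cycle is the translation by `τ`. -/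
theorem subgroupN_eq_zpowers (h : IsKleinPair σ τ) :
    subgroupN σ τ = Subgroup.zpowers (List.formPerm [1, σ * τ, τ, σ]) := by
  obtain ⟨h1, h2, h3, h4⟩ := formPerm_four h.mul_ne_one.symm h.right_ne.symm h.left_ne.symm
    h.mul_ne_right h.mul_ne_left h.ne.symm
  have hsq : leftReg K L τ = List.formPerm [1, σ * τ, τ, σ] ^ 2 := by
    ext1 g
    rw [leftReg_apply, sq, Equiv.Perm.mul_apply]
    rcases h.cover g with rfl | rfl | rfl | rfl
    · rw [h1, h2, mul_one]
    · rw [h4, h1, h.comm]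
    · rw [h3, h4, h.sq_right]
    · rw [h2, h3, h.right_mul_mul]
  apply le_antisymm
  · rw [subgroupN, Subgroup.closure_le]
    rintro x (rfl | rfl)
    · rw [hsq]
      exact Subgroup.pow_mem _ (Subgroup.mem_zpowers _) 2
    · exact Subgroup.mem_zpowers _
  · rw [Subgroup.zpowers_le]
    exact Subgroup.subset_closure (by simp)

open Classical in
theorem subgroupN_eq_fst (h : IsKleinPair σ τ) :
    subgroupN σ τ = Subgroup.zpowers (h.permHom (fourCycle 0)) := by
  obtain ⟨h1, h2, h3, h4⟩ := formPerm_four h.mul_ne_one.symm h.right_ne.symm h.left_ne.symm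
    h.mul_ne_right h.mul_ne_left h.ne.symm
  rw [subgroupN_eq_zpowers h]
  congr 1
  apply h.eq_permHom
  · exact h1
  · exact h4
  · exact h3
  · exact h2

open Classical in
theorem subgroupN_eq_snd (h : IsKleinPair σ τ) :
    subgroupN τ σ = Subgroup.zpowers (h.permHom (fourCycle 1)) := by
  obtain ⟨h1, h2, h3, h4⟩ := formPerm_four h.swap.mul_ne_one.symm h.left_ne.symm h.right_ne.symm
    h.swap.mul_ne_right h.swap.mul_ne_left h.ne
  rw [subgroupN_eq_zpowers h.swap]
  congr 1
  apply h.eq_permHom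
  · exact h1.trans h.comm
  · exact h3
  · exact h4
  · rw [← h.comm]
    exact h2

open Classical in
theorem subgroupN_eq_trd (h : IsKleinPair σ τ) :
    subgroupN σ (σ * τ) = Subgroup.zpowers (h.permHom (fourCycle 2)) := by
  have h' := h.mul_right
  obtain ⟨h1, h2, h3, h4⟩ := formPerm_four h'.mul_ne_one.symm h'.right_ne.symm h'.left_ne.symm
    h'.mul_ne_right h'.mul_ne_left h'.ne.symm
  rw [subgroupN_eq_zpowers h']
  congr 1
  apply h.eq_permHom
  · exact h1.trans h.left_mul_mul
  · exact h4
  · exact (congrArg _ h.left_mul_mul.symm).trans h2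
  · exact h3

theorem mem_zpowers_permHom (h : IsKleinPair σ τ) (i : Fin 3) (f : Equiv.Perm Gal(L/K)) :
    f ∈ Subgroup.zpowers (h.permHom (fourCycle i)) ↔
      ∃ j : Fin 4, f = h.permHom (fourCycle i ^ (j : ℕ)) := by
  constructor
  · rintro ⟨z, rfl⟩
    have h4 : fourCycle i ^ 4 = 1 := by revert i; decide
    refine ⟨⟨(z % 4).toNat, by omega⟩, ?_⟩
    simp only
    rw [← map_zpow, ← zpow_natCast, Int.toNat_of_nonneg (Int.emod_nonneg _ (by norm_num))]
    congr 1
    conv_lhs => rw [← Int.mul_ediv_add_emod z 4, zpow_add, zpow_mul]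
    rw [show fourCycle i ^ (4 : ℤ) = 1 from mod_cast h4, one_zpow, one_mul]
  · rintro ⟨j, rfl⟩
    rw [map_pow]
    exact Subgroup.pow_mem _ (Subgroup.mem_zpowers _) _

theorem isGreitherPareigis_zpowers (h : IsKleinPair σ τ) (i : Fin 3) :
    IsGreitherPareigis (Subgroup.zpowers (h.permHom (fourCycle i))) := by
  constructor
  · intro a b
    obtain ⟨a, rfl⟩ := h.enum.surjective a
    obtain ⟨b, rfl⟩ := h.enum.surjective b
    -- a finite check on the powers of the three 4-cycles
    obtain ⟨j, hj, hu⟩ : ∃ j : Fin 4, (fourCycle i ^ (j : ℕ)) a = b ∧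
        ∀ k : Fin 4, (fourCycle i ^ (k : ℕ)) a = b → k = j := by
      revert i a b; decide
    refine ⟨h.permHom (fourCycle i ^ (j : ℕ)), ⟨(mem_zpowers_permHom h i _).2 ⟨j, rfl⟩, ?_⟩, ?_⟩
    · rw [h.permHom_apply, hj]
    · rintro f ⟨hf, hfa⟩
      obtain ⟨k, rfl⟩ := (mem_zpowers_permHom h i _).1 hf
      rw [h.permHom_apply, h.enum.injective.eq_iff] at hfa
      rw [hu k hfa]
  · intro g f hf
    obtain ⟨g, rfl⟩ := h.enum.surjective g
    obtain ⟨j, rfl⟩ := (mem_zpowers_permHom h i _).1 hf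
    obtain ⟨k, hk⟩ : ∃ k : Fin 4,
        kleinPerm g * fourCycle i ^ (j : ℕ) * (kleinPerm g)⁻¹ = fourCycle i ^ (k : ℕ) := by
      clear hf
      revert i j g; decide
    rw [leftReg_enum h, ← map_inv, ← map_mul, ← map_mul, hk]
    exact (mem_zpowers_permHom h i _).2 ⟨k, rfl⟩

/-- A regular subgroup of `Perm G` has the order of `G`. -/
theorem IsGreitherPareigis.card_eq {N : Subgroup (Equiv.Perm Gal(L/K))}
    (hN : IsGreitherPareigis N) : Nat.card N = Nat.card Gal(L/K) := by
  refine Nat.card_congr (Equiv.ofBijective (fun f : N => (f : Equiv.Perm Gal(L/K)) 1) ⟨?_, ?_⟩)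
  · intro f f' hff
    exact Subtype.ext ((hN.1 1 ((f' : Equiv.Perm Gal(L/K)) 1)).unique ⟨f.2, hff⟩ ⟨f'.2, rfl⟩)
  · intro b
    obtain ⟨f, ⟨hf, hb⟩, -⟩ := hN.1 1 b
    exact ⟨⟨f, hf⟩, hb⟩

theorem card_range_leftReg (h : IsKleinPair σ τ) :
    Nat.card (leftReg K L).range = 4 := by
  rw [← h.card_eq]
  refine (Nat.card_congr (Equiv.ofBijective (leftReg K L).rangeRestrict
    ⟨?_, (leftReg K L).rangeRestrict_surjective⟩)).symm
  intro a b hab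
  have := congrArg (fun f : (leftReg K L).range => (f : Equiv.Perm Gal(L/K)) 1) hab
  simpa [leftReg_apply] using this

/-- A regular subgroup other than `λ(G)` contains an element outside `λ(G)`. Neither that element
nor its square has a fixed point, so it is a 4-cycle, and it generates the subgroup. -/
theorem IsGreitherPareigis.eq_zpowers (h : IsKleinPair σ τ) {N : Subgroup (Equiv.Perm Gal(L/K))}
    (hN : IsGreitherPareigis N) (hne : N ≠ (leftReg K L).range) :
    ∃ i, N = Subgroup.zpowers (h.permHom (fourCycle i)) := by
  have hcard : Nat.card N = 4 := hN.card_eq.trans h.card_eq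
  have : Finite Gal(L/K) := Finite.of_equiv _ h.enum
  have hfix : ∀ f ∈ N, ∀ a, f a = a → f = 1 := fun f hf a ha =>
    (hN.1 a a).unique ⟨hf, ha⟩ ⟨N.one_mem, rfl⟩
  obtain ⟨f, hf, hfr⟩ : ∃ f ∈ N, f ∉ (leftReg K L).range := by
    by_contra! hcon
    exact hne (Subgroup.eq_of_le_of_card_ge hcon
      (by rw [hcard, card_range_leftReg h]))
  obtain ⟨p, rfl⟩ := h.permHom.surjective f
  have hfix' : ∀ q : Equiv.Perm (Fin 4), h.permHom q ∈ N → ∀ a, q a = a → q = 1 := by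
    intro q hq a ha
    exact h.permHom.injective
      ((hfix _ hq (h.enum a) (by rw [h.permHom_apply, ha])).trans (map_one _).symm)
  have hk : ∀ j, p ≠ kleinPerm j := by
    rintro j rfl
    exact hfr ⟨_, leftReg_enum h j⟩
  have h1 := hfix' p hf
  have h2 := hfix' (p * p) (by rw [map_mul]; exact N.mul_mem hf hf)
  obtain ⟨i, hi⟩ : ∃ i, p = fourCycle i ∨ p = (fourCycle i)⁻¹ := by
    clear hf hfr
    revert p
    decide
  refine ⟨i, (Subgroup.eq_of_le_of_card_ge ?_ ?_).symm⟩
  · rw [Subgroup.zpowers_le]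
    rcases hi with rfl | rfl
    · exact hf
    · simpa using hf
  · rw [hcard, (isGreitherPareigis_zpowers h i).card_eq, h.card_eq]

theorem zpowers_fourCycle_injective (h : IsKleinPair σ τ) :
    Function.Injective fun i => Subgroup.zpowers (h.permHom (fourCycle i)) := by
  intro i i' hii
  have h1 : h.permHom (fourCycle i) ∈ Subgroup.zpowers (h.permHom (fourCycle i')) := by
    rw [← show _ = Subgroup.zpowers (h.permHom (fourCycle i')) from hii]
    exact Subgroup.mem_zpowers _
  obtain ⟨j, hj⟩ := (mem_zpowers_permHom h i' _).1 h1
  have h2 := h.permHom.injective hj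
  clear hii hj h1
  revert i i' j
  decide

/-- If `G` is a Klein four-group, the regular subgroups of `Perm G` normalized by `λ(G)`, other than
`λ(G)`, are the three cyclic groups of order 4 attached to the subgroups of order 2 of `G`. -/
theorem nonclassical_isGreitherPareigis (h : IsKleinPair σ τ) :
    {N | IsGreitherPareigis N ∧ N ≠ (leftReg K L).range} =
        {subgroupN σ τ, subgroupN τ σ, subgroupN σ (σ * τ)} ∧
      subgroupN σ τ ≠ subgroupN τ σ ∧ subgroupN σ τ ≠ subgroupN σ (σ * τ) ∧
      subgroupN τ σ ≠ subgroupN σ (σ * τ) ∧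
      ∀ N ∈ ({subgroupN σ τ, subgroupN τ σ, subgroupN σ (σ * τ)} :
        Set (Subgroup (Equiv.Perm Gal(L/K)))), IsCyclic N ∧ Nat.card N = 4 := by
  rw [subgroupN_eq_fst h, subgroupN_eq_snd h, subgroupN_eq_trd h]
  have hset : ∀ N : Subgroup (Equiv.Perm Gal(L/K)), N ∈
      ({Subgroup.zpowers (h.permHom (fourCycle 0)), Subgroup.zpowers (h.permHom (fourCycle 1)),
        Subgroup.zpowers (h.permHom (fourCycle 2))} : Set (Subgroup (Equiv.Perm Gal(L/K)))) ↔
      ∃ i, N = Subgroup.zpowers (h.permHom (fourCycle i)) := by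
    intro N
    simp [Fin.exists_fin_succ]
  have hinj := zpowers_fourCycle_injective h
  refine ⟨?_, hinj.ne (by decide), hinj.ne (by decide), hinj.ne (by decide), ?_⟩
  · ext N
    rw [hset]
    constructor
    · rintro ⟨hN, hne⟩
      exact hN.eq_zpowers h hne
    · rintro ⟨i, rfl⟩
      refine ⟨isGreitherPareigis_zpowers h i, fun hcon => ?_⟩
      have h1 : h.permHom (fourCycle i) ∈ (leftReg K L).range := by
        rw [← hcon]
        exact Subgroup.mem_zpowers _
      obtain ⟨g, hg⟩ := h1
      obtain ⟨j, rfl⟩ := h.enum.surjective g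
      rw [leftReg_enum h] at hg
      have h2 := h.permHom.injective hg
      clear hcon hg
      revert i j
      decide
  · intro N hN
    obtain ⟨i, rfl⟩ := (hset N).1 hN
    exact ⟨inferInstance, (isGreitherPareigis_zpowers h i).card_eq.trans h.card_eq⟩

end Regular

/-! ### The Hopf algebra of a cyclic regular subgroup -/

section CycElt

variable {K L : Type*} [Field K] [Field L] [Algebra K L] {σ τ : Gal(L/K)}

/-- The element `c₀ + c₁η + c₂η² + c₃η³` of `L[N]`, where `η` is the 4-cycle `(1, στ, τ, σ)`. -/
def cycElt (h : IsKleinPair σ τ) (c : Fin 4 → L) : MonoidAlgebra L (Equiv.Perm Gal(L/K)) :=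
  ∑ j : Fin 4, MonoidAlgebra.single (h.permHom (fourCycle 0 ^ (j : ℕ))) (c j)

/-- Conjugation by `λ(σ)` and by `λ(στ)` inverts `η`, and `λ(τ)` commutes with `η`. -/
def cycConj (i j : Fin 4) : Fin 4 := if i = 0 ∨ i = 2 then j else -j

theorem cycElt_coeff (h : IsKleinPair σ τ) (c : Fin 4 → L) (k : Fin 4) :
    (cycElt h c).coeff (h.permHom (fourCycle 0 ^ (k : ℕ))) = c k := by
  have hinj : ∀ j k : Fin 4, fourCycle 0 ^ (j : ℕ) = fourCycle 0 ^ (k : ℕ) → j = k := by decide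
  rw [cycElt, MonoidAlgebra.coeff_sum, Finsupp.finsetSum_apply, Finset.sum_eq_single k]
  · simp
  · intro j _ hjk
    rw [MonoidAlgebra.coeff_single, Finsupp.single_eq_of_ne]
    intro hcon
    exact hjk (hinj _ _ (h.permHom.injective hcon).symm)
  · simp

theorem cycElt_injective (h : IsKleinPair σ τ) : Function.Injective (cycElt (L := L) h) := by
  intro c c' hc
  ext k
  rw [← cycElt_coeff h c, hc, cycElt_coeff]

theorem act_cycElt (h : IsKleinPair σ τ) (c : Fin 4 → L) (x : L) :
    act (cycElt h c) x = c 0 * x + c 1 * σ x + c 2 * τ x + c 3 * σ (τ x) := by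
  have hinv : ∀ j : Fin 4, (fourCycle 0 ^ (j : ℕ))⁻¹ 0 = j := by decide
  have hval : ∀ j : Fin 4, (h.permHom (fourCycle 0 ^ (j : ℕ)))⁻¹ 1 = h.enum j := by
    intro j
    rw [← map_inv, ← h.enum_zero, h.permHom_apply, hinv]
  simp only [cycElt, Fin.sum_univ_four, act_add, act_single, hval, h.enum_zero, h.enum_one,
    h.enum_two, h.enum_three]
  rfl

theorem galAct_cycElt (h : IsKleinPair σ τ) (c : Fin 4 → L) (i : Fin 4) :
    galAct (h.enum i) (cycElt h c) = cycElt h fun j => h.enum i (c (cycConj i j)) := by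
  have hinvol : ∀ j, cycConj i (cycConj i j) = j := by revert i; decide
  have hconj : ∀ j : Fin 4, kleinPerm i * fourCycle 0 ^ (j : ℕ) * (kleinPerm i)⁻¹ =
      fourCycle 0 ^ (cycConj i j : ℕ) := by
    revert i; decide
  have hsingle : ∀ (θ : Equiv.Perm Gal(L/K)) (b : L),
      galAct (h.enum i) (MonoidAlgebra.single θ b) =
        MonoidAlgebra.single (leftReg K L (h.enum i) * θ * (leftReg K L (h.enum i))⁻¹)
          (h.enum i b) := by
    intro θ b
    simp [galAct]
  rw [cycElt, map_sum, cycElt]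
  refine Finset.sum_bij' (fun j _ => cycConj i j) (fun j _ => cycConj i j) (by simp) (by simp)
    (by simp [hinvol]) (by simp [hinvol]) ?_
  intro j _
  rw [hsingle, leftReg_enum h, ← map_inv, ← map_mul, ← map_mul, hconj, hinvol]

theorem cycElt_mem_hopfAlg_iff (h : IsKleinPair σ τ) (c : Fin 4 → L) :
    cycElt h c ∈ hopfAlg (subgroupN σ τ) ↔
      ∀ i j, h.enum i (c (cycConj i j)) = c j := by
  have hrange : cycElt h c ∈
      (MonoidAlgebra.mapDomainAlgHom K L (subgroupN σ τ).subtype).range := by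
    refine Subalgebra.sum_mem _ fun j _ => ?_
    have hj : h.permHom (fourCycle 0 ^ (j : ℕ)) ∈ subgroupN σ τ := by
      rw [subgroupN_eq_fst h]
      exact (mem_zpowers_permHom h 0 _).2 ⟨j, rfl⟩
    exact ⟨MonoidAlgebra.single ⟨_, hj⟩ (c j), by simp⟩
  constructor
  · intro hc i j
    have h1 : galAct (h.enum i) (cycElt h c) = cycElt h c := (Algebra.mem_iInf.mp hc.2) _
    rw [galAct_cycElt] at h1
    exact congrFun (cycElt_injective h h1) j
  · intro hc
    refine ⟨hrange, Algebra.mem_iInf.mpr fun g => ?_⟩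
    obtain ⟨i, rfl⟩ := h.enum.surjective g
    change galAct (h.enum i) (cycElt h c) = cycElt h c
    rw [galAct_cycElt]
    congr 1
    ext j
    exact hc i j

theorem exists_cycElt (h : IsKleinPair σ τ) {z : MonoidAlgebra L (Equiv.Perm Gal(L/K))}
    (hz : z ∈ hopfAlg (subgroupN σ τ)) : ∃ c, z = cycElt h c := by
  obtain ⟨y, rfl⟩ := hz.1
  clear hz
  induction y using MonoidAlgebra.induction_linear with
  | zero => exact ⟨0, by simp [cycElt]⟩
  | add y y' hy hy' =>
    obtain ⟨c, hc⟩ := hy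
    obtain ⟨c', hc'⟩ := hy'
    refine ⟨c + c', ?_⟩
    rw [map_add]
    refine (congrArg₂ (· + ·) hc hc').trans ?_
    simp [cycElt, Finset.sum_add_distrib]
  | single n b =>
    obtain ⟨j, hj⟩ := (mem_zpowers_permHom h 0 n).1 (subgroupN_eq_fst h ▸ n.2)
    refine ⟨Pi.single j b, ?_⟩
    rw [cycElt, Finset.sum_eq_single j]
    · simp [← hj]
    · intro k _ hk
      simp [hk]
    · simp

end CycElt

/-! ### The action in coordinates -/

section Frame

/-- A free module any two elements of which are linearly dependent has rank one. -/
theorem exists_bijective_smul_of_free {A M : Type*} [Ring A] [AddCommGroup M] [Module A M]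
    [Nontrivial M] [Module.Free A M]
    (hdep : ∀ x y : M, ∃ z z' : A, (z ≠ 0 ∨ z' ≠ 0) ∧ z • x = z' • y) :
    ∃ β : M, Function.Bijective fun z : A => z • β := by
  let B := Module.Free.chooseBasis A M
  have hcoord : ∀ (z : A) i j, B.repr (z • B i) j = Finsupp.single i z j := by
    intro z i j
    rw [map_smul, B.repr_self, Finsupp.smul_single, smul_eq_mul, mul_one]
  obtain ⟨i⟩ : Nonempty (Module.Free.ChooseBasisIndex A M) := B.index_nonempty
  have hsub : ∀ j, i = j := by
    intro j
    by_contra hij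
    obtain ⟨z, z', hne, hz⟩ := hdep (B i) (B j)
    have h1 := DFunLike.congr_fun (congrArg B.repr hz) i
    have h2 := DFunLike.congr_fun (congrArg B.repr hz) j
    rw [hcoord, hcoord, Finsupp.single_eq_same, Finsupp.single_eq_of_ne hij] at h1
    rw [hcoord, hcoord, Finsupp.single_eq_same, Finsupp.single_eq_of_ne (Ne.symm hij)] at h2
    exact hne.elim (fun h => h h1) (fun h => h h2.symm)
  refine ⟨B i, fun z z' h => ?_, fun x => ⟨B.repr x i, B.repr.injective ?_⟩⟩
  · have h1 := DFunLike.congr_fun (congrArg B.repr h) i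
    rwa [hcoord, hcoord, Finsupp.single_eq_same, Finsupp.single_eq_same] at h1
  · ext j
    change B.repr (B.repr x i • B i) j = _
    rw [hcoord, hsub j, Finsupp.single_eq_same]

theorem isIntegral_of_sq {L : Type*} [Field L] {x : L} {n : ℤ} (h : x ^ 2 = n) :
    IsIntegral ℤ x := by
  refine IsIntegral.of_pow (n := 2) (by norm_num) ?_
  rw [h]
  exact isIntegral_algebraMap (R := ℤ) (x := n)

variable {L : Type*} [Field L] [NumberField L]

/-- The element with coordinates `v₀, v₁, v₂, v₃` in the basis `1, √a, √b, √c`. -/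
def point (sa sb sc : L) (v₀ v₁ v₂ v₃ : ℚ) : L := v₀ + v₁ * sa + v₂ * sb + v₃ * sc

/-- The biquadratic field `L` seen from its subfield `ℚ(√a)`: a basis `1, √a, √b, √c` with
`√a √b = g √c` and `√a √c = g' √b`, and generators `σ`, `τ` of the Galois group for which
`τ` fixes `√a` and `σ` fixes `√b`. The 4-cycle of `subgroupN σ τ` then gives rise to the operator
`√b ↦ g √c`, `√c ↦ -g' √b`. -/
structure Frame (σ τ : Gal(L/ℚ)) (a b c g g' : ℤ) (sa sb sc : L) : Prop where
  klein : IsKleinPair σ τ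
  sq_a : sa ^ 2 = a
  sq_b : sb ^ 2 = b
  sq_c : sc ^ 2 = c
  mul_ab : sa * sb = g * sc
  mul_ac : sa * sc = g' * sb
  sigma_a : σ sa = -sa
  sigma_b : σ sb = sb
  tau_a : τ sa = sa
  tau_b : τ sb = -sb
  g_ne : g ≠ 0
  span : ∀ x : L, ∃ v₀ v₁ v₂ v₃ : ℚ, x = point sa sb sc v₀ v₁ v₂ v₃
  indep : ∀ v₀ v₁ v₂ v₃ : ℚ, point sa sb sc v₀ v₁ v₂ v₃ = 0 → v₀ = 0 ∧ v₁ = 0 ∧ v₂ = 0 ∧ v₃ = 0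

/-- The coordinates `v` belong to a generator of the lattice `Λ` over its order in the algebra of
the operators `v ↦ (p v₀, q v₁, r v₂ - s g' v₃, r v₃ + s g v₂)`: no operator but `0` annihilates
`v`, and an operator that maps `v` into `Λ` maps all of `Λ` into `Λ`. -/
structure IsLatticeGenerator (Λ : ℚ → ℚ → ℚ → ℚ → Prop) (g g' : ℤ) (v₀ v₁ v₂ v₃ : ℚ) : Prop where
  mem : Λ v₀ v₁ v₂ v₃
  ne_zero : v₀ ≠ 0
  ne_one : v₁ ≠ 0
  norm_ne : g * v₂ ^ 2 + g' * v₃ ^ 2 ≠ 0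
  stable : ∀ p q r s : ℚ, Λ (p * v₀) (q * v₁) (r * v₂ - s * g' * v₃) (r * v₃ + s * g * v₂) →
    ∀ w₀ w₁ w₂ w₃, Λ w₀ w₁ w₂ w₃ →
      Λ (p * w₀) (q * w₁) (r * w₂ - s * g' * w₃) (r * w₃ + s * g * w₂)

namespace Frame

variable {σ τ : Gal(L/ℚ)} {a b c g g' : ℤ} {sa sb sc : L}

theorem sigma_c (F : Frame σ τ a b c g g' sa sb sc) : σ sc = -sc := by
  have hg : (g : L) ≠ 0 := Int.cast_ne_zero.2 F.g_ne
  have h := congrArg σ F.mul_ab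
  rw [map_mul, map_mul, F.sigma_a, F.sigma_b, map_intCast, neg_mul, F.mul_ab] at h
  exact mul_left_cancel₀ hg (by rw [← h, mul_neg])

theorem tau_c (F : Frame σ τ a b c g g' sa sb sc) : τ sc = -sc := by
  have hg : (g : L) ≠ 0 := Int.cast_ne_zero.2 F.g_ne
  have h := congrArg τ F.mul_ab
  rw [map_mul, map_mul, F.tau_a, F.tau_b, map_intCast, mul_neg, F.mul_ab] at h
  exact mul_left_cancel₀ hg (by rw [← h, mul_neg])

theorem sigma_point (F : Frame σ τ a b c g g' sa sb sc) (v₀ v₁ v₂ v₃ : ℚ) :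
    σ (point sa sb sc v₀ v₁ v₂ v₃) = point sa sb sc v₀ (-v₁) v₂ (-v₃) := by
  simp only [point, map_add, map_mul, map_ratCast, F.sigma_a, F.sigma_b, F.sigma_c]
  push_cast
  ring

theorem tau_point (F : Frame σ τ a b c g g' sa sb sc) (v₀ v₁ v₂ v₃ : ℚ) :
    τ (point sa sb sc v₀ v₁ v₂ v₃) = point sa sb sc v₀ v₁ (-v₂) (-v₃) := by
  simp only [point, map_add, map_mul, map_ratCast, F.tau_a, F.tau_b, F.tau_c]
  push_cast
  ring

theorem point_inj (F : Frame σ τ a b c g g' sa sb sc) {v₀ v₁ v₂ v₃ w₀ w₁ w₂ w₃ : ℚ}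
    (h : point sa sb sc v₀ v₁ v₂ v₃ = point sa sb sc w₀ w₁ w₂ w₃) :
    v₀ = w₀ ∧ v₁ = w₁ ∧ v₂ = w₂ ∧ v₃ = w₃ := by
  have h1 : point sa sb sc (v₀ - w₀) (v₁ - w₁) (v₂ - w₂) (v₃ - w₃) = 0 := by
    rw [← sub_eq_zero.2 h]
    simp only [point]
    push_cast
    ring
  obtain ⟨h0, h1, h2, h3⟩ := F.indep _ _ _ _ h1
  exact ⟨sub_eq_zero.1 h0, sub_eq_zero.1 h1, sub_eq_zero.1 h2, sub_eq_zero.1 h3⟩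

theorem exists_rat_of_fixed (F : Frame σ τ a b c g g' sa sb sc) {x : L} (hσ : σ x = x)
    (hτ : τ x = x) : ∃ v : ℚ, x = v := by
  obtain ⟨v₀, v₁, v₂, v₃, rfl⟩ := F.span x
  rw [F.sigma_point] at hσ
  rw [F.tau_point] at hτ
  obtain ⟨-, h1, -, h3⟩ := F.point_inj hσ
  obtain ⟨-, -, h2, -⟩ := F.point_inj hτ
  have h1 : v₁ = 0 := by linarith
  have h2 : v₂ = 0 := by linarith
  have h3 : v₃ = 0 := by linarith
  exact ⟨v₀, by simp [point, h1, h2, h3]⟩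

theorem sa_ne (F : Frame σ τ a b c g g' sa sb sc) : sa ≠ 0 := by
  intro h
  have := (F.indep 0 1 0 0 (by simp [point, h])).2.1
  norm_num at this

/-- An element `∑ cⱼ ηʲ` of the Hopf algebra has `c₀, c₂` rational and `c₁, c₃` conjugate in
`ℚ(√a)`, so it acts on the coordinates through the rational parameters `p = c₀ + c₁ + c₂ + c₃`, `q
= c₀ - c₁ + c₂ - c₃`, `r = c₀ - c₂`, `s = (c₁ - c₃) / √a`. -/
theorem exists_params (F : Frame σ τ a b c g g' sa sb sc)
    {z : MonoidAlgebra L (Equiv.Perm Gal(L/ℚ))} (hz : z ∈ hopfAlg (subgroupN σ τ)) :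
    ∃ p q r s : ℚ, ∀ v₀ v₁ v₂ v₃ : ℚ, act z (point sa sb sc v₀ v₁ v₂ v₃) =
      point sa sb sc (p * v₀) (q * v₁) (r * v₂ - s * g' * v₃) (r * v₃ + s * g * v₂) := by
  obtain ⟨u, rfl⟩ := exists_cycElt F.klein hz
  rw [cycElt_mem_hopfAlg_iff] at hz
  have s0 : σ (u 0) = u 0 := hz 1 0
  have s1 : σ (u 1) = u 3 := hz 1 3
  have s2 : σ (u 2) = u 2 := hz 1 2
  have s3 : σ (u 3) = u 1 := hz 1 1
  have t0 : τ (u 0) = u 0 := hz 2 0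
  have t1 : τ (u 1) = u 1 := hz 2 1
  have t2 : τ (u 2) = u 2 := hz 2 2
  have t3 : τ (u 3) = u 3 := hz 2 3
  obtain ⟨p, hp⟩ := F.exists_rat_of_fixed (x := u 0 + u 2 + (u 1 + u 3))
    (by simp only [map_add, s0, s1, s2, s3]; ring) (by simp only [map_add, t0, t1, t2, t3])
  obtain ⟨q, hq⟩ := F.exists_rat_of_fixed (x := u 0 + u 2 - (u 1 + u 3))
    (by simp only [map_add, map_sub, s0, s1, s2, s3]; ring)
    (by simp only [map_add, map_sub, t0, t1, t2, t3])
  obtain ⟨r, hr⟩ := F.exists_rat_of_fixed (x := u 0 - u 2)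
    (by simp only [map_sub, s0, s2]) (by simp only [map_sub, t0, t2])
  have hsa := F.sa_ne
  obtain ⟨s, hs⟩ := F.exists_rat_of_fixed (x := (u 1 - u 3) / sa)
    (by simp only [map_sub, map_div₀, s1, s3, F.sigma_a]; field_simp; ring)
    (by simp only [map_sub, map_div₀, t1, t3, F.tau_a])
  rw [div_eq_iff hsa] at hs
  refine ⟨p, q, r, s, fun v₀ v₁ v₂ v₃ => ?_⟩
  rw [act_cycElt, F.tau_point, F.sigma_point, F.sigma_point]
  simp only [point]
  push_cast
  linear_combination (v₀ : L) * hp + v₁ * sa * hq + (v₂ * sb + v₃ * sc) * hr +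
    (v₂ * sb - v₃ * sc) * hs + s * v₂ * F.mul_ab - s * v₃ * F.mul_ac

/-- Every choice of the parameters `p, q, r, s` comes from an element of the Hopf algebra. -/
theorem exists_act_eq (F : Frame σ τ a b c g g' sa sb sc) (p q r s : ℚ) :
    ∃ z ∈ hopfAlg (subgroupN σ τ), ∀ v₀ v₁ v₂ v₃ : ℚ, act z (point sa sb sc v₀ v₁ v₂ v₃) =
      point sa sb sc (p * v₀) (q * v₁) (r * v₂ - s * g' * v₃) (r * v₃ + s * g * v₂) := by
  have hrat : ∀ (f : Gal(L/ℚ)) (x : ℚ), f (x : L) = x := fun f x => map_ratCast f x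
  -- `c₀ + c₂ = (p + q) / 2`, `c₁ + c₃ = (p - q) / 2`, `c₀ - c₂ = r`, `c₁ - c₃ = s √a`
  let u : Fin 4 → L := ![(((p + q) / 4 + r / 2 : ℚ) : L),
    (((p - q) / 4 : ℚ) : L) + (s / 2 : ℚ) * sa,
    (((p + q) / 4 - r / 2 : ℚ) : L), (((p - q) / 4 : ℚ) : L) - (s / 2 : ℚ) * sa]
  have e0 : u 0 = (((p + q) / 4 + r / 2 : ℚ) : L) := rfl
  have e1 : u 1 = (((p - q) / 4 : ℚ) : L) + (s / 2 : ℚ) * sa := rfl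
  have e2 : u 2 = (((p + q) / 4 - r / 2 : ℚ) : L) := rfl
  have e3 : u 3 = (((p - q) / 4 : ℚ) : L) - (s / 2 : ℚ) * sa := rfl
  clear_value u
  refine ⟨cycElt F.klein u, ?_, fun v₀ v₁ v₂ v₃ => ?_⟩
  · rw [cycElt_mem_hopfAlg_iff]
    have s0 : σ (u 0) = u 0 := by rw [e0, hrat]
    have s1 : σ (u 1) = u 3 := by
      rw [e1, e3, map_add, map_mul, hrat, hrat, F.sigma_a]; ring
    have s2 : σ (u 2) = u 2 := by rw [e2, hrat]
    have s3 : σ (u 3) = u 1 := by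
      rw [e1, e3, map_sub, map_mul, hrat, hrat, F.sigma_a]; ring
    have t0 : τ (u 0) = u 0 := by rw [e0, hrat]
    have t1 : τ (u 1) = u 1 := by rw [e1, map_add, map_mul, hrat, hrat, F.tau_a]
    have t2 : τ (u 2) = u 2 := by rw [e2, hrat]
    have t3 : τ (u 3) = u 3 := by rw [e3, map_sub, map_mul, hrat, hrat, F.tau_a]
    intro i j
    fin_cases i
    · rfl
    · fin_cases j
      exacts [s0, s3, s2, s1]
    · fin_cases j
      exacts [t0, t1, t2, t3]
    · have hst : ∀ x, (F.klein.enum 3) x = σ (τ x) := fun x => rfl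
      fin_cases j
      · exact (hst (u 0)).trans ((congrArg σ t0).trans s0)
      · exact (hst (u 3)).trans ((congrArg σ t3).trans s3)
      · exact (hst (u 2)).trans ((congrArg σ t2).trans s2)
      · exact (hst (u 1)).trans ((congrArg σ t1).trans s1)
  · rw [act_cycElt, F.tau_point, F.sigma_point, F.sigma_point, e0, e1, e2, e3]
    simp only [point]
    push_cast
    linear_combination s * v₂ * F.mul_ab - s * v₃ * F.mul_ac

theorem act_injective (F : Frame σ τ a b c g g' sa sb sc)
    {z z' : MonoidAlgebra L (Equiv.Perm Gal(L/ℚ))} (hz : z ∈ hopfAlg (subgroupN σ τ))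
    (hz' : z' ∈ hopfAlg (subgroupN σ τ)) (h : ∀ x, act z x = act z' x) : z = z' := by
  obtain ⟨u, rfl⟩ := exists_cycElt F.klein hz
  obtain ⟨u', rfl⟩ := exists_cycElt F.klein hz'
  have h1 := h (point sa sb sc 1 0 0 0)
  have h2 := h (point sa sb sc 0 1 0 0)
  have h3 := h (point sa sb sc 0 0 1 0)
  have h4 := h (point sa sb sc 0 0 0 1)
  simp only [act_cycElt, F.tau_point, F.sigma_point] at h1 h2 h3 h4
  have hb : sb ≠ 0 := by
    intro h
    have := (F.indep 0 0 1 0 (by simp [point, h])).2.2.1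
    norm_num at this
  have hc : sc ≠ 0 := by
    intro h
    have := (F.indep 0 0 0 1 (by simp [point, h])).2.2.2
    norm_num at this
  simp only [point, Rat.cast_zero, Rat.cast_one, Rat.cast_neg, neg_zero] at h1 h2 h3 h4
  have k2 := mul_right_cancel₀ F.sa_ne (show (u 0 - u 1 + u 2 - u 3) * sa =
    (u' 0 - u' 1 + u' 2 - u' 3) * sa by linear_combination h2)
  have k3 := mul_right_cancel₀ hb (show (u 0 + u 1 - u 2 - u 3) * sb =
    (u' 0 + u' 1 - u' 2 - u' 3) * sb by linear_combination h3)
  have k4 := mul_right_cancel₀ hc (show (u 0 - u 1 - u 2 + u 3) * sc =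
    (u' 0 - u' 1 - u' 2 + u' 3) * sc by linear_combination h4)
  congr 1
  ext j
  fin_cases j
  · change u 0 = u' 0
    linear_combination (h1 + k2 + k3 + k4) / 4
  · change u 1 = u' 1
    linear_combination (h1 - k2 + k3 - k4) / 4
  · change u 2 = u' 2
    linear_combination (h1 + k2 - k3 - k4) / 4
  · change u 3 = u' 3
    linear_combination (h1 - k2 - k3 + k4) / 4

/-- An operator is determined by its value at an element that none but `0` annihilates. -/
theorem params_unique {v₀ v₁ v₂ v₃ p q r s p' q' r' s' : ℚ} (h0 : v₀ ≠ 0) (h1 : v₁ ≠ 0)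
    (hN : (g : ℚ) * v₂ ^ 2 + g' * v₃ ^ 2 ≠ 0) (hp : p * v₀ = p' * v₀) (hq : q * v₁ = q' * v₁)
    (hr : r * v₂ - s * g' * v₃ = r' * v₂ - s' * g' * v₃)
    (hs : r * v₃ + s * g * v₂ = r' * v₃ + s' * g * v₂) : p = p' ∧ q = q' ∧ r = r' ∧ s = s' := by
  refine ⟨mul_right_cancel₀ h0 hp, mul_right_cancel₀ h1 hq, mul_right_cancel₀ hN ?_,
    mul_right_cancel₀ hN ?_⟩
  · linear_combination g * v₂ * hr + g' * v₃ * hs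
  · linear_combination v₂ * hs - v₃ * hr

/-- Freeness of a generator in terms of coordinates. That `v₀`, `v₁` and the norm of `v` do not
vanish is necessary because `1`, `√a`, `√b`, `√c` are multiples of a generator. -/
theorem isFreeGenerator_iff (F : Frame σ τ a b c g g' sa sb sc) (v₀ v₁ v₂ v₃ : ℚ) :
    IsFreeGenerator (subgroupN σ τ) (point sa sb sc v₀ v₁ v₂ v₃) ↔
      IsLatticeGenerator (fun w₀ w₁ w₂ w₃ => IsIntegral ℤ (point sa sb sc w₀ w₁ w₂ w₃)) g g'
        v₀ v₁ v₂ v₃ := by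
  constructor
  · rintro ⟨β, hβ, -, hsurj⟩
    have key : ∀ w₀ w₁ w₂ w₃, IsIntegral ℤ (point sa sb sc w₀ w₁ w₂ w₃) →
        ∃ p q r s : ℚ, w₀ = p * v₀ ∧ w₁ = q * v₁ ∧ w₂ = r * v₂ - s * g' * v₃ ∧
          w₃ = r * v₃ + s * g * v₂ ∧
          ∀ x₀ x₁ x₂ x₃, IsIntegral ℤ (point sa sb sc x₀ x₁ x₂ x₃) → IsIntegral ℤ
            (point sa sb sc (p * x₀) (q * x₁) (r * x₂ - s * g' * x₃) (r * x₃ + s * g * x₂)) := by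
      intro w₀ w₁ w₂ w₃ hw
      obtain ⟨z, hz⟩ := hsurj ⟨_, hw⟩
      obtain ⟨p, q, r, s, hact⟩ := F.exists_params z.1.2
      have h1 : act z.1.1 (β : L) = point sa sb sc w₀ w₁ w₂ w₃ :=
        congrArg (fun y : 𝓞 L => (y : L)) hz
      rw [hβ, hact] at h1
      obtain ⟨e0, e1, e2, e3⟩ := F.point_inj h1
      refine ⟨p, q, r, s, e0.symm, e1.symm, e2.symm, e3.symm, fun x₀ x₁ x₂ x₃ hx => ?_⟩
      rw [← hact]
      exact z.2 ⟨_, hx⟩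
    have i0 : IsIntegral ℤ (point sa sb sc 1 0 0 0) := by
      simpa [point] using isIntegral_one
    have i1 : IsIntegral ℤ (point sa sb sc 0 1 0 0) := by
      simpa [point] using isIntegral_of_sq F.sq_a
    have i2 : IsIntegral ℤ (point sa sb sc 0 0 1 0) := by
      simpa [point] using isIntegral_of_sq F.sq_b
    have i3 : IsIntegral ℤ (point sa sb sc 0 0 0 1) := by
      simpa [point] using isIntegral_of_sq F.sq_c
    have hv0 : v₀ ≠ 0 := by
      rintro rfl
      obtain ⟨p, q, r, s, h, -⟩ := key _ _ _ _ i0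
      simp at h
    have hv1 : v₁ ≠ 0 := by
      rintro rfl
      obtain ⟨p, q, r, s, -, h, -⟩ := key _ _ _ _ i1
      simp at h
    have hN : (g : ℚ) * v₂ ^ 2 + g' * v₃ ^ 2 ≠ 0 := by
      intro hN
      obtain ⟨p, q, r, s, -, -, h1, h2, -⟩ := key _ _ _ _ i2
      obtain ⟨p', q', r', s', -, -, h1', h2', -⟩ := key _ _ _ _ i3
      have k1 : (g : ℚ) * v₂ = 0 := by
        linear_combination r * hN + g * v₂ * h1 + g' * v₃ * h2
      have k2 : (g' : ℚ) * v₃ = 0 := by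
        linear_combination r' * hN + g * v₂ * h1' + g' * v₃ * h2'
      have hg : (g : ℚ) ≠ 0 := Int.cast_ne_zero.2 F.g_ne
      have k3 : v₂ = 0 := by simpa [hg] using k1
      have k4 : (1 : ℚ) = 0 := by
        linear_combination h1 + r * k3 - s * k2
      norm_num at k4
    refine ⟨by rw [← hβ]; exact β.2, hv0, hv1, hN, ?_⟩
    intro p q r s hmem w₀ w₁ w₂ w₃ hw
    obtain ⟨p', q', r', s', e0, e1, e2, e3, hall⟩ := key _ _ _ _ hmem
    obtain ⟨rfl, rfl, rfl, rfl⟩ := params_unique hv0 hv1 hN e0 e1 e2 e3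
    exact hall _ _ _ _ hw
  · intro hv
    refine ⟨⟨_, hv.mem⟩, rfl, ?_, ?_⟩
    · intro z z' hzz
      have hzz : act z.1.1 (point sa sb sc v₀ v₁ v₂ v₃) =
          act z'.1.1 (point sa sb sc v₀ v₁ v₂ v₃) := congrArg (fun y : 𝓞 L => (y : L)) hzz
      obtain ⟨p, q, r, s, hact⟩ := F.exists_params z.1.2
      obtain ⟨p', q', r', s', hact'⟩ := F.exists_params z'.1.2
      rw [hact, hact'] at hzz
      obtain ⟨e0, e1, e2, e3⟩ := F.point_inj hzz
      obtain ⟨rfl, rfl, rfl, rfl⟩ := params_unique hv.ne_zero hv.ne_one hv.norm_ne e0 e1 e2 e3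
      refine Subtype.ext (Subtype.ext (F.act_injective z.1.2 z'.1.2 fun x => ?_))
      obtain ⟨x₀, x₁, x₂, x₃, rfl⟩ := F.span x
      rw [hact, hact']
    · intro x
      obtain ⟨w₀, w₁, w₂, w₃, hx⟩ := F.span (x : L)
      obtain ⟨N, hNdef⟩ : ∃ N : ℚ, N = g * v₂ ^ 2 + g' * v₃ ^ 2 := ⟨_, rfl⟩
      have hN : N ≠ 0 := hNdef ▸ hv.norm_ne
      have hv0 := hv.ne_zero
      have hv1 := hv.ne_one
      -- division of `x` by the generator, in `ℚ × ℚ × ℚ[J]` with `J² = -a`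
      obtain ⟨z, hz, hact⟩ := F.exists_act_eq (w₀ / v₀) (w₁ / v₁)
        ((g * v₂ * w₂ + g' * v₃ * w₃) / N) ((v₂ * w₃ - v₃ * w₂) / N)
      have e0 : w₀ / v₀ * v₀ = w₀ := by field_simp
      have e1 : w₁ / v₁ * v₁ = w₁ := by field_simp
      have e2 : (g * v₂ * w₂ + g' * v₃ * w₃) / N * v₂ - (v₂ * w₃ - v₃ * w₂) / N * g' * v₃ = w₂ := by
        field_simp
        rw [hNdef]
        ring
      have e3 : (g * v₂ * w₂ + g' * v₃ * w₃) / N * v₃ + (v₂ * w₃ - v₃ * w₂) / N * g * v₂ = w₃ := by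
        field_simp
        rw [hNdef]
        ring
      have hval : act z (point sa sb sc v₀ v₁ v₂ v₃) = x := by
        rw [hact, e0, e1, e2, e3, hx]
      have hmem := hv.stable (w₀ / v₀) (w₁ / v₁) ((g * v₂ * w₂ + g' * v₃ * w₃) / N)
        ((v₂ * w₃ - v₃ * w₂) / N) (by rw [e0, e1, e2, e3, ← hx]; exact x.2)
      refine ⟨⟨⟨z, hz⟩, fun y => ?_⟩, RingOfIntegers.ext hval⟩
      obtain ⟨y₀, y₁, y₂, y₃, hy⟩ := F.span (y : L)
      change IsIntegral ℤ (act z (y : L))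
      rw [hy, hact]
      exact hmem _ _ _ _ (by rw [← hy]; exact y.2)

/-- The trace `L → ℚ`, multiplied by an integral rational, belongs to the associated order. -/
theorem exists_trace_mem (F : Frame σ τ a b c g g' sa sb sc) (t : ℚ) (ht : IsIntegral ℤ (t : L)) :
    ∃ z : associatedOrder (rep (subgroupN σ τ)), ∀ (x : 𝓞 L) (v₀ v₁ v₂ v₃ : ℚ),
      (x : L) = point sa sb sc v₀ v₁ v₂ v₃ → ((z • x : 𝓞 L) : L) = t * (4 * v₀) := by
  obtain ⟨z, hz, hact⟩ := F.exists_act_eq (t * 4) 0 0 0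
  have hz' : ∀ (x : L) (v₀ v₁ v₂ v₃ : ℚ), x = point sa sb sc v₀ v₁ v₂ v₃ →
      act z x = t * (4 * v₀) := by
    rintro x v₀ v₁ v₂ v₃ rfl
    rw [hact]
    simp [point, mul_assoc]
  refine ⟨⟨⟨z, hz⟩, fun y => ?_⟩, fun x v₀ v₁ v₂ v₃ hx => hz' _ _ _ _ _ hx⟩
  obtain ⟨y₀, y₁, y₂, y₃, hy⟩ := F.span (y : L)
  change IsIntegral ℤ (act z (y : L))
  rw [hz' _ _ _ _ _ hy]
  refine ht.mul ?_
  have hsum : (4 : L) * y₀ = y + σ y + τ y + σ (τ y) := by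
    rw [hy, F.tau_point, F.sigma_point, F.sigma_point]
    simp only [point]
    push_cast
    ring
  rw [hsum]
  have hint : ∀ f : Gal(L/ℚ), ∀ x : L, IsIntegral ℤ x → IsIntegral ℤ (f x) := fun f x hx =>
    hx.map ((f : L →+* L).toIntAlgHom)
  have hy' := y.2
  exact ((hy'.add (hint σ _ hy')).add (hint τ _ hy')).add (hint σ _ (hint τ _ hy'))

/-- Any two elements of `𝓞 L` are dependent over the associated order: the trace of `L`, multiplied
by suitable integral rationals, maps them to the same element. -/
theorem exists_smul_eq_smul (F : Frame σ τ a b c g g' sa sb sc) (x y : 𝓞 L) :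
    ∃ z z' : associatedOrder (rep (subgroupN σ τ)), (z ≠ 0 ∨ z' ≠ 0) ∧ z • x = z' • y := by
  obtain ⟨t, ht⟩ := F.exists_trace_mem 1 (by simpa using isIntegral_one)
  have hne : ∀ (z : associatedOrder (rep (subgroupN σ τ))) (u : ℚ), u ≠ 0 →
      ((z • (1 : 𝓞 L) : 𝓞 L) : L) = u * (4 * (1 : ℚ)) → z ≠ 0 := by
    rintro z u hu hz rfl
    rw [zero_smul] at hz
    have hu' : (u : L) ≠ 0 := Rat.cast_ne_zero.2 hu
    simp [hu'] at hz
  have h1 : ((1 : 𝓞 L) : L) = point sa sb sc 1 0 0 0 := by simp [point]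
  have hint : ∀ (x : 𝓞 L) (v₀ v₁ v₂ v₃ : ℚ), (x : L) = point sa sb sc v₀ v₁ v₂ v₃ →
      IsIntegral ℤ ((4 * v₀ : ℚ) : L) := by
    intro x v₀ v₁ v₂ v₃ hx
    have h2 : ((4 * v₀ : ℚ) : L) = ((t • x : 𝓞 L) : L) := by
      rw [ht _ _ _ _ _ hx]
      push_cast
      ring
    rw [h2]
    exact (t • x).2
  obtain ⟨v₀, v₁, v₂, v₃, hx⟩ := F.span (x : L)
  obtain ⟨w₀, w₁, w₂, w₃, hy⟩ := F.span (y : L)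
  by_cases h0 : v₀ = 0 ∧ w₀ = 0
  · refine ⟨t, t, Or.inl (hne t 1 one_ne_zero (ht _ _ _ _ _ h1)), RingOfIntegers.ext ?_⟩
    rw [ht _ _ _ _ _ hx, ht _ _ _ _ _ hy, h0.1, h0.2]
  · obtain ⟨z, hz⟩ := F.exists_trace_mem _ (hint _ _ _ _ _ hy)
    obtain ⟨z', hz'⟩ := F.exists_trace_mem _ (hint _ _ _ _ _ hx)
    refine ⟨z, z', ?_, RingOfIntegers.ext ?_⟩
    · rcases not_and_or.1 h0 with h | h
      · exact Or.inr (hne z' _ (mul_ne_zero four_ne_zero h) (hz' _ _ _ _ _ h1))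
      · exact Or.inl (hne z _ (mul_ne_zero four_ne_zero h) (hz _ _ _ _ _ h1))
    · rw [hz _ _ _ _ _ hx, hz' _ _ _ _ _ hy]
      push_cast
      ring

theorem isFree_iff (F : Frame σ τ a b c g g' sa sb sc) :
    IsFree (subgroupN σ τ) ↔ ∃ x : L, IsFreeGenerator (subgroupN σ τ) x := by
  constructor
  · intro hfree
    have hfree : Module.Free (associatedOrder (rep (subgroupN σ τ))) (𝓞 L) := hfree
    obtain ⟨β, hβ⟩ := exists_bijective_smul_of_free F.exists_smul_eq_smul
    exact ⟨β, β, rfl, hβ⟩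
  · rintro ⟨x, β, -, hβ⟩
    exact Module.Free.of_equiv (LinearEquiv.ofBijective
      (LinearMap.toSpanSingleton (associatedOrder (rep (subgroupN σ τ))) (𝓞 L) β) hβ)

theorem isFree_iff_exists (F : Frame σ τ a b c g g' sa sb sc) :
    IsFree (subgroupN σ τ) ↔ ∃ v₀ v₁ v₂ v₃, IsLatticeGenerator
      (fun w₀ w₁ w₂ w₃ => IsIntegral ℤ (point sa sb sc w₀ w₁ w₂ w₃)) g g' v₀ v₁ v₂ v₃ := by
  rw [F.isFree_iff]
  constructor
  · rintro ⟨x, hx⟩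
    obtain ⟨v₀, v₁, v₂, v₃, rfl⟩ := F.span x
    exact ⟨_, _, _, _, (F.isFreeGenerator_iff _ _ _ _).1 hx⟩
  · rintro ⟨v₀, v₁, v₂, v₃, hv⟩
    exact ⟨_, (F.isFreeGenerator_iff _ _ _ _).2 hv⟩

end Frame

end Frame

/-! ### The ring of integers of a biquadratic field -/

section Integers

/-- A rational `t` such that `a t²` is an integer, with `a` squarefree, is an integer. -/
theorem exists_int_of_squarefree_mul_sq {a : ℤ} (ha : Squarefree a) {t : ℚ} {N : ℤ}
    (h : (a : ℚ) * t ^ 2 = N) : ∃ T : ℤ, t = T := by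
  have hden : (t.den : ℚ) ≠ 0 := by exact_mod_cast t.den_ne_zero
  have h1 : a * t.num ^ 2 = N * (t.den : ℤ) ^ 2 := by
    rw [← Rat.num_div_den t] at h
    field_simp at h
    have h' : (a : ℚ) * t.num ^ 2 = N * (t.den : ℤ) ^ 2 := by
      push_cast
      linarith
    exact_mod_cast h'
  have hcop : IsCoprime ((t.den : ℤ) ^ 2) (t.num ^ 2) := by
    refine IsCoprime.pow ?_
    rw [Int.isCoprime_iff_gcd_eq_one]
    simpa [Int.gcd, Nat.gcd_comm] using Nat.coprime_iff_gcd_eq_one.1 t.reduced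
  have h2 : (t.den : ℤ) * t.den ∣ a := by
    rw [← sq]
    exact hcop.dvd_of_dvd_mul_right (Dvd.intro_left _ h1.symm)
  have h3 : t.den = 1 := by
    have := ha _ h2
    simpa [Int.isUnit_iff_natAbs_eq] using this
  exact ⟨t.num, (Rat.coe_int_num_of_den_eq_one h3).symm⟩

variable {L : Type*} [Field L] [NumberField L]

theorem isIntegral_of_eq {L : Type*} [Field L] {x y : L} (h : IsIntegral ℤ x) (hxy : y = x) :
    IsIntegral ℤ y :=
  hxy ▸ h

theorem isIntegral_half_of_sq {L : Type*} [Field L] [CharZero L] {s : L} {a : ℤ} (hs : s ^ 2 = a)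
    (ha : a % 4 = 1) : IsIntegral ℤ ((1 + s) / 2) := by
  obtain ⟨q, rfl⟩ : ∃ q, a = 4 * q + 1 := ⟨a / 4, by omega⟩
  push_cast at hs
  refine ⟨Polynomial.X ^ 2 - Polynomial.X - Polynomial.C q, by monicity!, ?_⟩
  simp only [Polynomial.eval₂_sub, Polynomial.eval₂_pow, Polynomial.eval₂_X, Polynomial.eval₂_C]
  simp only [algebraMap_int_eq, eq_intCast]
  linear_combination hs / 4

theorem exists_int_of_isIntegral {u : ℚ} (h : IsIntegral ℤ (u : L)) : ∃ U : ℤ, u = U := by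
  have h1 : IsIntegral ℤ u := by
    have hu : (u : L) = algebraMap ℚ L u := (eq_ratCast (algebraMap ℚ L) u).symm
    rw [hu] at h
    exact (isIntegral_algebraMap_iff (algebraMap ℚ L).injective).1 h
  obtain ⟨U, hU⟩ := IsIntegrallyClosed.isIntegral_iff.1 h1
  exact ⟨U, by simpa using hU.symm⟩

/-- If `u + w√a` and its conjugate are integral, then `2u` and `2w` are integers with
`(2u)² ≡ a (2w)²` modulo 4. -/
theorem exists_int_of_isIntegral_quadratic {a : ℤ} (ha : Squarefree a) {s : L} (hs : s ^ 2 = a)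
    {u w : ℚ} (h : IsIntegral ℤ ((u : L) + w * s)) (h' : IsIntegral ℤ ((u : L) - w * s)) :
    ∃ U W : ℤ, u = U / 2 ∧ w = W / 2 ∧ 4 ∣ U ^ 2 - a * W ^ 2 := by
  obtain ⟨U, hU⟩ : ∃ U : ℤ, 2 * u = U := by
    refine exists_int_of_isIntegral (L := L) ?_
    refine isIntegral_of_eq (h.add h') ?_
    push_cast
    ring
  obtain ⟨N, hN⟩ : ∃ N : ℤ, u ^ 2 - a * w ^ 2 = N := by
    refine exists_int_of_isIntegral (L := L) ?_
    refine isIntegral_of_eq (h.mul h') ?_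
    push_cast
    linear_combination (w : L) ^ 2 * hs
  obtain ⟨W, hW⟩ : ∃ W : ℤ, 2 * w = W := by
    refine exists_int_of_squarefree_mul_sq ha (N := U ^ 2 - 4 * N) ?_
    push_cast
    rw [← hU, ← hN]
    ring
  refine ⟨U, W, by linarith, by linarith, N, ?_⟩
  have : (U : ℚ) ^ 2 - a * W ^ 2 = 4 * N := by
    rw [← hU, ← hW, ← hN]
    ring
  exact_mod_cast this

namespace Frame

variable {σ τ : Gal(L/ℚ)} {a b c g g' e : ℤ} {sa sb sc : L}

theorem mul_bc (F : Frame σ τ a b c g g' sa sb sc) (hb : b = g * e) : sb * sc = e * sa := by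
  have hg : (g : L) ≠ 0 := Int.cast_ne_zero.2 F.g_ne
  refine mul_left_cancel₀ hg ?_
  have h1 := F.sq_b
  rw [hb] at h1
  push_cast at h1
  linear_combination -sb * F.mul_ab + sa * h1

/-- The traces of an integer to the three quadratic subfields, and its norms to `ℚ(√a)` and
`ℚ(√b)`, are integers of these fields. -/
theorem exists_int_of_isIntegral_point (F : Frame σ τ a b c g g' sa sb sc) (ha : Squarefree a)
    (hb : Squarefree b) (hc : Squarefree c) (hbe : b = g * e) {v₀ v₁ v₂ v₃ : ℚ}
    (h : IsIntegral ℤ (point sa sb sc v₀ v₁ v₂ v₃)) :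
    ∃ V₀ V₁ V₂ V₃ : ℤ, (v₀ = V₀ / 4 ∧ v₁ = V₁ / 4 ∧ v₂ = V₂ / 4 ∧ v₃ = V₃ / 4) ∧
      (4 ∣ V₀ ^ 2 - a * V₁ ^ 2 ∧ 4 ∣ V₀ ^ 2 - b * V₂ ^ 2 ∧ 4 ∣ V₀ ^ 2 - c * V₃ ^ 2) ∧
      (∃ U W : ℤ, V₀ ^ 2 + a * V₁ ^ 2 - b * V₂ ^ 2 - c * V₃ ^ 2 = 8 * U ∧
        V₀ * V₁ - e * V₂ * V₃ = 4 * W ∧ 4 ∣ U ^ 2 - a * W ^ 2) ∧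
      ∃ U W : ℤ, V₀ ^ 2 + b * V₂ ^ 2 - a * V₁ ^ 2 - c * V₃ ^ 2 = 8 * U ∧
        V₀ * V₂ - g' * V₁ * V₃ = 4 * W ∧ 4 ∣ U ^ 2 - b * W ^ 2 := by
  have hbc := F.mul_bc hbe
  have hint : ∀ f : Gal(L/ℚ), ∀ x : L, IsIntegral ℤ x → IsIntegral ℤ (f x) := fun f x hx =>
    hx.map ((f : L →+* L).toIntAlgHom)
  have hσ := hint σ _ h
  have hτ := hint τ _ h
  have hστ := hint σ _ hτ
  rw [F.sigma_point] at hσ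
  rw [F.tau_point] at hτ
  rw [F.tau_point, F.sigma_point] at hστ
  obtain ⟨V₀, V₁, e0, e1, hV1⟩ := exists_int_of_isIntegral_quadratic ha F.sq_a
    (u := 2 * v₀) (w := 2 * v₁)
    (by refine isIntegral_of_eq (h.add hτ) ?_; simp only [point]; push_cast; ring)
    (by refine isIntegral_of_eq (hσ.add hστ) ?_; simp only [point]; push_cast; ring)
  obtain ⟨V₀', V₂, e0', e2, hV2⟩ := exists_int_of_isIntegral_quadratic hb F.sq_b
    (u := 2 * v₀) (w := 2 * v₂)
    (by refine isIntegral_of_eq (h.add hσ) ?_; simp only [point]; push_cast; ring)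
    (by refine isIntegral_of_eq (hτ.add hστ) ?_; simp only [point]; push_cast; ring)
  obtain ⟨V₀'', V₃, e0'', e3, hV3⟩ := exists_int_of_isIntegral_quadratic hc F.sq_c
    (u := 2 * v₀) (w := 2 * v₃)
    (by refine isIntegral_of_eq (h.add hστ) ?_; simp only [point]; push_cast; ring)
    (by refine isIntegral_of_eq (hσ.add hτ) ?_; simp only [point]; push_cast; ring)
  obtain rfl : V₀' = V₀ := by
    have : (V₀' : ℚ) = V₀ := by linarith
    exact_mod_cast this
  obtain rfl : V₀'' = V₀' := by
    have : (V₀'' : ℚ) = V₀' := by linarith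
    exact_mod_cast this
  have e0 : v₀ = V₀'' / 4 := by linarith
  have e1 : v₁ = V₁ / 4 := by linarith
  have e2 : v₂ = V₂ / 4 := by linarith
  have e3 : v₃ = V₃ / 4 := by linarith
  refine ⟨V₀'', V₁, V₂, V₃, ⟨e0, e1, e2, e3⟩, ⟨hV1, hV2, hV3⟩, ?_, ?_⟩
  · obtain ⟨U, W, hU, hW, hdvd⟩ := exists_int_of_isIntegral_quadratic ha F.sq_a
      (u := v₀ ^ 2 + a * v₁ ^ 2 - b * v₂ ^ 2 - c * v₃ ^ 2) (w := 2 * (v₀ * v₁ - e * v₂ * v₃))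
      (by
        refine isIntegral_of_eq (h.mul hτ) ?_
        simp only [point]
        push_cast
        linear_combination -(v₁ : L) ^ 2 * F.sq_a + (v₂ : L) ^ 2 * F.sq_b +
          (v₃ : L) ^ 2 * F.sq_c + 2 * v₂ * v₃ * hbc)
      (by
        refine isIntegral_of_eq (hσ.mul hστ) ?_
        simp only [point]
        push_cast
        linear_combination -(v₁ : L) ^ 2 * F.sq_a + (v₂ : L) ^ 2 * F.sq_b +
          (v₃ : L) ^ 2 * F.sq_c - 2 * v₂ * v₃ * hbc)
    refine ⟨U, W, ?_, ?_, hdvd⟩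
    · rw [e0, e1, e2, e3] at hU
      field_simp at hU
      have : (V₀'' : ℚ) ^ 2 + a * V₁ ^ 2 - b * V₂ ^ 2 - c * V₃ ^ 2 = 8 * U := by linarith
      exact_mod_cast this
    · rw [e0, e1, e2, e3] at hW
      field_simp at hW
      have : (V₀'' : ℚ) * V₁ - e * V₂ * V₃ = 4 * W := by linarith
      exact_mod_cast this
  · obtain ⟨U, W, hU, hW, hdvd⟩ := exists_int_of_isIntegral_quadratic hb F.sq_b
      (u := v₀ ^ 2 + b * v₂ ^ 2 - a * v₁ ^ 2 - c * v₃ ^ 2) (w := 2 * (v₀ * v₂ - g' * v₁ * v₃))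
      (by
        refine isIntegral_of_eq (h.mul hσ) ?_
        simp only [point]
        push_cast
        linear_combination -(v₂ : L) ^ 2 * F.sq_b + (v₁ : L) ^ 2 * F.sq_a +
          (v₃ : L) ^ 2 * F.sq_c + 2 * v₁ * v₃ * F.mul_ac)
      (by
        refine isIntegral_of_eq (hτ.mul hστ) ?_
        simp only [point]
        push_cast
        linear_combination -(v₂ : L) ^ 2 * F.sq_b + (v₁ : L) ^ 2 * F.sq_a +
          (v₃ : L) ^ 2 * F.sq_c - 2 * v₁ * v₃ * F.mul_ac)
    refine ⟨U, W, ?_, ?_, hdvd⟩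
    · rw [e0, e1, e2, e3] at hU
      field_simp at hU
      have : (V₀'' : ℚ) ^ 2 + b * V₂ ^ 2 - a * V₁ ^ 2 - c * V₃ ^ 2 = 8 * U := by linarith
      exact_mod_cast this
    · rw [e0, e1, e2, e3] at hW
      field_simp at hW
      have : (V₀'' : ℚ) * V₂ - g' * V₁ * V₃ = 4 * W := by linarith
      exact_mod_cast this

end Frame

theorem even_of_four_dvd {a x y : ℤ} (ha : a % 4 = 2 ∨ a % 4 = 3) (h : 4 ∣ x ^ 2 - a * y ^ 2) :
    2 ∣ x ∧ 2 ∣ y := by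
  obtain ⟨z, hz⟩ := h
  obtain ⟨q, hq⟩ : ∃ q, a = 4 * q + 2 ∨ a = 4 * q + 3 := ⟨a / 4, by omega⟩
  obtain ⟨x', rfl | rfl⟩ := Int.even_or_odd' x <;> obtain ⟨y', rfl | rfl⟩ := Int.even_or_odd' y <;>
    rcases hq with rfl | rfl <;> ring_nf at hz <;> omega

theorem two_dvd_sub_of_four_dvd {a x y : ℤ} (ha : a % 4 = 1) (h : 4 ∣ x ^ 2 - a * y ^ 2) :
    2 ∣ x - y := by
  obtain ⟨z, hz⟩ := h
  obtain ⟨q, rfl⟩ : ∃ q, a = 4 * q + 1 := ⟨a / 4, by omega⟩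
  obtain ⟨x', rfl | rfl⟩ := Int.even_or_odd' x <;> obtain ⟨y', rfl | rfl⟩ := Int.even_or_odd' y <;>
    ring_nf at hz <;> omega

/-- Coordinates of the integers in the basis `1, √m, √n, √k` for `m ≡ 3`, `n ≡ 2` modulo 4. -/
def latticeA (v₀ v₁ v₂ v₃ : ℚ) : Prop :=
  ∃ c₀ c₁ c₂ c₃ : ℤ, v₀ = c₀ ∧ v₁ = c₁ ∧ v₂ = c₂ + c₃ / 2 ∧ v₃ = c₃ / 2

/-- Coordinates of the integers in the basis `1, √m, √n, √k` for `m ≡ 1`, `n ≢ 1` modulo 4. -/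
def latticeB (v₀ v₁ v₂ v₃ : ℚ) : Prop :=
  ∃ c₀ c₁ c₂ c₃ : ℤ, v₀ = c₀ + c₁ / 2 ∧ v₁ = c₁ / 2 ∧ v₂ = c₂ + c₃ / 2 ∧ v₃ = c₃ / 2

/-- Coordinates of the integers in the basis `1, √m, √n, √k` for `m ≡ n ≡ 1` modulo 4, where
`δ = ±1` and `gcd(m, n) ≡ δ` modulo 4. The condition is symmetric in the last three coordinates. -/
def latticeC (δ : ℤ) (v₀ v₁ v₂ v₃ : ℚ) : Prop :=
  ∃ V₀ V₁ V₂ V₃ : ℤ, v₀ = V₀ / 4 ∧ v₁ = V₁ / 4 ∧ v₂ = V₂ / 4 ∧ v₃ = V₃ / 4 ∧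
    2 ∣ V₁ - V₃ ∧ 2 ∣ V₂ - V₃ ∧ 4 ∣ V₀ - V₁ - V₂ + δ * V₃

namespace Frame

variable {σ τ : Gal(L/ℚ)} {a b c g g' e : ℤ} {sa sb sc : L}

/-- The square of `(√b + √c) / 2` lies in `ℚ(√a)`, which reduces its integrality to that field. -/
theorem sq_half_add (F : Frame σ τ a b c g g' sa sb sc) (hb : b = g * e)
    (hc : c = g' * e) : ((sb + sc) / 2) ^ 2 = e * (((g : L) + g') + 2 * sa) / 4 := by
  have h1 := F.sq_b
  have h2 := F.sq_c
  rw [hb] at h1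
  rw [hc] at h2
  push_cast at h1 h2
  linear_combination h1 / 4 + h2 / 4 + F.mul_bc hb / 2

theorem isIntegral_point_iff_latticeA (F : Frame σ τ a b c g g' sa sb sc) (ha : Squarefree a)
    (hb : Squarefree b) (hc : Squarefree c) (hag : a = g * g') (hbe : b = g * e)
    (hce : c = g' * e) (ha4 : a % 4 = 3) (hb4 : b % 4 = 2) (v₀ v₁ v₂ v₃ : ℚ) :
    IsIntegral ℤ (point sa sb sc v₀ v₁ v₂ v₃) ↔ latticeA v₀ v₁ v₂ v₃ := by
  have hpar : (∃ p q, g = 4 * p + 1 ∧ g' = 4 * q + 3) ∨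
      (∃ p q, g = 4 * p + 3 ∧ g' = 4 * q + 1) := by
    have h1 : g * g' % 4 = 3 := hag ▸ ha4
    have h2 : g % 4 = 0 ∨ g % 4 = 1 ∨ g % 4 = 2 ∨ g % 4 = 3 := by omega
    have h3 : g' % 4 = 0 ∨ g' % 4 = 1 ∨ g' % 4 = 2 ∨ g' % 4 = 3 := by omega
    have : (g % 4 = 1 ∧ g' % 4 = 3) ∨ (g % 4 = 3 ∧ g' % 4 = 1) := by
      rcases h2 with h2 | h2 | h2 | h2 <;> rcases h3 with h3 | h3 | h3 | h3 <;>
        simp [Int.mul_emod, h2, h3] at h1 ⊢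
    rcases this with h | h
    · exact Or.inl ⟨g / 4, g' / 4, by omega, by omega⟩
    · exact Or.inr ⟨g / 4, g' / 4, by omega, by omega⟩
  have he : ∃ f, e = 4 * f + 2 := by
    have h1 : g * e % 4 = 2 := hbe ▸ hb4
    refine ⟨e / 4, ?_⟩
    have h3 : e % 4 = 0 ∨ e % 4 = 1 ∨ e % 4 = 2 ∨ e % 4 = 3 := by omega
    have h2 : g % 4 = 1 ∨ g % 4 = 3 := by
      rcases hpar with ⟨p, q, h, -⟩ | ⟨p, q, h, -⟩ <;> omega
    rcases h2 with h2 | h2 <;> rcases h3 with h3 | h3 | h3 | h3 <;>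
        simp [Int.mul_emod, h2, h3] at h1 <;> omega
  have hc4 : c % 4 = 2 := by
    obtain ⟨f, rfl⟩ := he
    have h2 : g' % 4 = 1 ∨ g' % 4 = 3 := by
      rcases hpar with ⟨p, q, -, h⟩ | ⟨p, q, -, h⟩ <;> omega
    rcases h2 with h2 | h2 <;> rw [hce, Int.mul_emod, h2] <;> omega
  constructor
  · intro h
    obtain ⟨V₀, V₁, V₂, V₃, ⟨rfl, rfl, rfl, rfl⟩, ⟨h1, h2, h3⟩, ⟨U, W, hU, hW, hd⟩, -⟩ :=
      F.exists_int_of_isIntegral_point ha hb hc hbe h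
    obtain ⟨⟨a₀, rfl⟩, ⟨a₁, rfl⟩⟩ := even_of_four_dvd (Or.inr ha4) h1
    obtain ⟨-, ⟨a₂, rfl⟩⟩ := even_of_four_dvd (Or.inl hb4) h2
    obtain ⟨-, ⟨a₃, rfl⟩⟩ := even_of_four_dvd (Or.inl hc4) h3
    obtain ⟨⟨U', rfl⟩, ⟨W', rfl⟩⟩ := even_of_four_dvd (Or.inr ha4) hd
    obtain ⟨f, rfl⟩ := he
    obtain ⟨a', rfl⟩ : ∃ a', a = 4 * a' + 3 := ⟨a / 4, by omega⟩
    obtain ⟨b', rfl⟩ : ∃ b', b = 4 * b' + 2 := ⟨b / 4, by omega⟩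
    obtain ⟨c', rfl⟩ : ∃ c', c = 4 * c' + 2 := ⟨c / 4, by omega⟩
    -- by parity, from the norm to `ℚ(√a)`
    have hpar : 2 ∣ a₀ ∧ 2 ∣ a₁ ∧ 2 ∣ a₂ - a₃ := by
      clear hpar hag hbe hce h1 h2 h3 hd h F ha hb hc ha4 hb4 hc4
      obtain ⟨x₀, rfl | rfl⟩ := Int.even_or_odd' a₀ <;>
      obtain ⟨x₁, rfl | rfl⟩ := Int.even_or_odd' a₁ <;>
      obtain ⟨x₂, rfl | rfl⟩ := Int.even_or_odd' a₂ <;>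
      obtain ⟨x₃, rfl | rfl⟩ := Int.even_or_odd' a₃ <;>
      ring_nf at hU hW <;> omega
    obtain ⟨⟨x₀, rfl⟩, ⟨x₁, rfl⟩, ⟨x₂, hx⟩⟩ := hpar
    obtain rfl : a₂ = 2 * x₂ + a₃ := by omega
    exact ⟨x₀, x₁, x₂, a₃, by push_cast; ring, by push_cast; ring, by push_cast; ring,
      by push_cast; ring⟩
  · rintro ⟨c₀, c₁, c₂, c₃, rfl, rfl, rfl, rfl⟩
    have hsa := isIntegral_of_sq F.sq_a
    have hsb := isIntegral_of_sq F.sq_b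
    obtain ⟨f, hf⟩ : ∃ f, e * (g + g') = 4 * (2 * f) := by
      obtain ⟨f, rfl⟩ := he
      rcases hpar with ⟨p, q, rfl, rfl⟩ | ⟨p, q, rfl, rfl⟩
      · exact ⟨(2 * f + 1) * (p + q + 1), by ring⟩
      · exact ⟨(2 * f + 1) * (p + q + 1), by ring⟩
    obtain ⟨f', hf'⟩ : ∃ f', e = 2 * f' := by
      obtain ⟨f, rfl⟩ := he
      exact ⟨2 * f + 1, by ring⟩
    have hhalf : IsIntegral ℤ ((sb + sc) / 2) := by
      refine IsIntegral.of_pow (n := 2) (by norm_num) ?_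
      rw [F.sq_half_add hbe hce]
      have h1 : (e : L) * (((g : L) + g') + 2 * sa) / 4 = ((2 * f : ℤ) : L) + (f' : L) * sa := by
        have h2 : (e : L) * (g + g') = 4 * ((2 * f : ℤ) : L) := by exact_mod_cast hf
        have h3 : (e : L) = 2 * f' := by exact_mod_cast hf'
        linear_combination h2 / 4 + sa / 2 * h3
      rw [h1]
      exact (isIntegral_algebraMap (R := ℤ) (x := 2 * f)).add
        ((isIntegral_algebraMap (R := ℤ) (x := f')).mul hsa)
    have h1 : point sa sb sc c₀ c₁ (c₂ + c₃ / 2) (c₃ / 2) =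
        c₀ + c₁ * sa + c₂ * sb + c₃ * ((sb + sc) / 2) := by
      simp only [point]
      push_cast
      ring
    rw [h1]
    have hz : ∀ z : ℤ, IsIntegral ℤ (z : L) := fun z => isIntegral_algebraMap (R := ℤ) (x := z)
    exact (((hz c₀).add ((hz c₁).mul hsa)).add ((hz c₂).mul hsb)).add ((hz c₃).mul hhalf)

theorem isIntegral_point_iff_latticeB (F : Frame σ τ a b c g g' sa sb sc) (ha : Squarefree a)
    (hb : Squarefree b) (hc : Squarefree c) (hag : a = g * g') (hbe : b = g * e)
    (hce : c = g' * e) (ha4 : a % 4 = 1) (hb4 : b % 4 = 2 ∨ b % 4 = 3) (v₀ v₁ v₂ v₃ : ℚ) :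
    IsIntegral ℤ (point sa sb sc v₀ v₁ v₂ v₃) ↔ latticeB v₀ v₁ v₂ v₃ := by
  have hpar : (∃ p q, g = 4 * p + 1 ∧ g' = 4 * q + 1) ∨
      (∃ p q, g = 4 * p + 3 ∧ g' = 4 * q + 3) := by
    have h1 : g * g' % 4 = 1 := hag ▸ ha4
    have h2 : g % 4 = 0 ∨ g % 4 = 1 ∨ g % 4 = 2 ∨ g % 4 = 3 := by omega
    have h3 : g' % 4 = 0 ∨ g' % 4 = 1 ∨ g' % 4 = 2 ∨ g' % 4 = 3 := by omega
    have : (g % 4 = 1 ∧ g' % 4 = 1) ∨ (g % 4 = 3 ∧ g' % 4 = 3) := by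
      rcases h2 with h2 | h2 | h2 | h2 <;> rcases h3 with h3 | h3 | h3 | h3 <;>
        simp [Int.mul_emod, h2, h3] at h1 ⊢
    rcases this with h | h
    · exact Or.inl ⟨g / 4, g' / 4, by omega, by omega⟩
    · exact Or.inr ⟨g / 4, g' / 4, by omega, by omega⟩
  have hcb : c % 4 = b % 4 := by
    rcases hpar with ⟨p, q, rfl, rfl⟩ | ⟨p, q, rfl, rfl⟩ <;> rw [hbe, hce] <;> ring_nf <;> omega
  have hc4 : c % 4 = 2 ∨ c % 4 = 3 := by omega
  constructor
  · intro h
    obtain ⟨V₀, V₁, V₂, V₃, ⟨rfl, rfl, rfl, rfl⟩, ⟨h1, h2, h3⟩, -, ⟨U, W, hU, hW, hd⟩⟩ :=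
      F.exists_int_of_isIntegral_point ha hb hc hbe h
    obtain ⟨⟨a₀, rfl⟩, ⟨a₂, rfl⟩⟩ := even_of_four_dvd hb4 h2
    obtain ⟨-, ⟨a₃, rfl⟩⟩ := even_of_four_dvd hc4 h3
    obtain ⟨a₁, rfl⟩ : 2 ∣ V₁ := by
      have := two_dvd_sub_of_four_dvd ha4 h1
      omega
    obtain ⟨⟨U', rfl⟩, ⟨W', rfl⟩⟩ := even_of_four_dvd hb4 hd
    obtain ⟨a', rfl⟩ : ∃ a', a = 4 * a' + 1 := ⟨a / 4, by omega⟩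
    obtain ⟨r, b', c', hr, rfl, rfl⟩ :
        ∃ r b' c', (r = 2 ∨ r = 3) ∧ b = 4 * b' + r ∧ c = 4 * c' + r :=
      ⟨b % 4, b / 4, c / 4, hb4, by omega, by omega⟩
    obtain ⟨q, hq⟩ : ∃ q, g' = 2 * q + 1 := by
      rcases hpar with ⟨p, q, -, h⟩ | ⟨p, q, -, h⟩
      · exact ⟨2 * q, by omega⟩
      · exact ⟨2 * q + 1, by omega⟩
    -- by parity, from the norm to `ℚ(√b)`
    have hpar : 2 ∣ a₀ - a₁ ∧ 2 ∣ a₂ - a₃ := by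
      clear hpar hag hbe hce h1 h2 h3 hd h F ha hb hc ha4 hb4 hc4 hcb
      subst hq
      rcases hr with rfl | rfl <;>
      obtain ⟨x₀, rfl | rfl⟩ := Int.even_or_odd' a₀ <;>
      obtain ⟨x₁, rfl | rfl⟩ := Int.even_or_odd' a₁ <;>
      obtain ⟨x₂, rfl | rfl⟩ := Int.even_or_odd' a₂ <;>
      obtain ⟨x₃, rfl | rfl⟩ := Int.even_or_odd' a₃ <;>
      ring_nf at hU hW <;> omega
    obtain ⟨⟨x₀, hx₀⟩, ⟨x₂, hx₂⟩⟩ := hpar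
    obtain rfl : a₀ = 2 * x₀ + a₁ := by omega
    obtain rfl : a₂ = 2 * x₂ + a₃ := by omega
    exact ⟨x₀, a₁, x₂, a₃, by push_cast; ring, by push_cast; ring, by push_cast; ring,
      by push_cast; ring⟩
  · rintro ⟨c₀, c₁, c₂, c₃, rfl, rfl, rfl, rfl⟩
    have hsa := isIntegral_half_of_sq F.sq_a ha4
    have hsb := isIntegral_of_sq F.sq_b
    obtain ⟨f, hf⟩ : ∃ f, g + g' = 4 * f + 2 := by
      rcases hpar with ⟨p, q, rfl, rfl⟩ | ⟨p, q, rfl, rfl⟩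
      · exact ⟨p + q, by ring⟩
      · exact ⟨p + q + 1, by ring⟩
    have hz : ∀ z : ℤ, IsIntegral ℤ (z : L) := fun z => isIntegral_algebraMap (R := ℤ) (x := z)
    have hhalf : IsIntegral ℤ ((sb + sc) / 2) := by
      refine IsIntegral.of_pow (n := 2) (by norm_num) ?_
      rw [F.sq_half_add hbe hce]
      have h1 : (e : L) * (((g : L) + g') + 2 * sa) / 4 = e * (f + (1 + sa) / 2) := by
        have h2 : (g : L) + g' = 4 * f + 2 := by exact_mod_cast hf
        linear_combination (e : L) / 4 * h2
      rw [h1]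
      exact (hz e).mul ((hz f).add hsa)
    have h1 : point sa sb sc (c₀ + c₁ / 2) (c₁ / 2) (c₂ + c₃ / 2) (c₃ / 2) =
        c₀ + c₁ * ((1 + sa) / 2) + c₂ * sb + c₃ * ((sb + sc) / 2) := by
      simp only [point]
      push_cast
      ring
    rw [h1]
    exact (((hz c₀).add ((hz c₁).mul hsa)).add ((hz c₂).mul hsb)).add ((hz c₃).mul hhalf)

end Frame

end Integers

section IntegersOdd

variable {L : Type*} [Field L] [NumberField L]

namespace Frame

variable {σ τ : Gal(L/ℚ)} {a b c g g' e : ℤ} {sa sb sc : L}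

theorem isIntegral_point_iff_latticeC (F : Frame σ τ a b c g g' sa sb sc) (ha : Squarefree a)
    (hb : Squarefree b) (hc : Squarefree c) (hbe : b = g * e) {δ : ℤ} (hδ : δ = 1 ∨ δ = -1)
    (hg : 4 ∣ g - δ) (he : 4 ∣ e - δ)
    (ha4 : a % 4 = 1) (hb4 : b % 4 = 1) (hc4 : c % 4 = 1) (v₀ v₁ v₂ v₃ : ℚ) :
    IsIntegral ℤ (point sa sb sc v₀ v₁ v₂ v₃) ↔ latticeC δ v₀ v₁ v₂ v₃ := by
  constructor
  · intro h
    obtain ⟨V₀, V₁, V₂, V₃, ⟨rfl, rfl, rfl, rfl⟩, ⟨h1, h2, h3⟩, ⟨U, W, hU, hW, -⟩, -⟩ :=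
      F.exists_int_of_isIntegral_point ha hb hc hbe h
    have h1 := two_dvd_sub_of_four_dvd ha4 h1
    have h2 := two_dvd_sub_of_four_dvd hb4 h2
    have h3 := two_dvd_sub_of_four_dvd hc4 h3
    refine ⟨V₀, V₁, V₂, V₃, rfl, rfl, rfl, rfl, by omega, by omega, ?_⟩
    obtain ⟨a', rfl⟩ : ∃ a', a = 4 * a' + 1 := ⟨a / 4, by omega⟩
    obtain ⟨b', rfl⟩ : ∃ b', b = 4 * b' + 1 := ⟨b / 4, by omega⟩
    obtain ⟨c', rfl⟩ : ∃ c', c = 4 * c' + 1 := ⟨c / 4, by omega⟩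
    obtain ⟨e', he'⟩ := he
    obtain rfl : e = 4 * e' + δ := by omega
    clear hbe F ha hb hc hg ha4 hb4 hc4 he' h
    -- all four of the `Vᵢ` have the same parity; if it is even, the trace of `v τ(v)` gives the
    -- congruence modulo 4, and if it is odd, the coefficient of `√a` in `v τ(v)` does
    obtain ⟨x₀, rfl | rfl⟩ := Int.even_or_odd' V₀
    · obtain ⟨x₁, rfl⟩ : ∃ x₁, V₁ = 2 * x₁ := ⟨V₁ / 2, by omega⟩
      obtain ⟨x₂, rfl⟩ : ∃ x₂, V₂ = 2 * x₂ := ⟨V₂ / 2, by omega⟩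
      obtain ⟨x₃, rfl⟩ : ∃ x₃, V₃ = 2 * x₃ := ⟨V₃ / 2, by omega⟩
      have hsq : ∀ x : ℤ, 2 ∣ x ^ 2 - x := fun x => by
        obtain ⟨y, rfl | rfl⟩ := Int.even_or_odd' x <;> ring_nf <;> omega
      have k0 := hsq x₀
      have k1 := hsq x₁
      have k2 := hsq x₂
      have k3 := hsq x₃
      ring_nf at hU
      rcases hδ with rfl | rfl <;> omega
    · obtain ⟨x₁, rfl⟩ : ∃ x₁, V₁ = 2 * x₁ + 1 := ⟨V₁ / 2, by omega⟩
      obtain ⟨x₂, rfl⟩ : ∃ x₂, V₂ = 2 * x₂ + 1 := ⟨V₂ / 2, by omega⟩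
      obtain ⟨x₃, rfl⟩ : ∃ x₃, V₃ = 2 * x₃ + 1 := ⟨V₃ / 2, by omega⟩
      rcases hδ with rfl | rfl <;> ring_nf at hW <;> omega
  · rintro ⟨V₀, V₁, V₂, V₃, rfl, rfl, rfl, rfl, ⟨y₁, h1⟩, ⟨y₂, h2⟩, ⟨y₀, h0⟩⟩
    have hz : ∀ z : ℤ, IsIntegral ℤ (z : L) := fun z => isIntegral_algebraMap (R := ℤ) (x := z)
    have hsa := isIntegral_half_of_sq F.sq_a ha4
    have hsb := isIntegral_half_of_sq F.sq_b hb4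
    obtain ⟨q, hq⟩ := hg
    obtain rfl : g = δ + 4 * q := by omega
    have hδ2 : (δ : L) * δ = 1 := by rcases hδ with rfl | rfl <;> norm_num
    -- `(1 + √a)(1 + √b) / 4 = (1 + √a + √b + g √c) / 4`, and `g ≡ δ` modulo 4
    have hsc := isIntegral_of_sq F.sq_c
    have hprod := hsa.mul hsb
    have hV0 : (V₀ : L) = V₁ + V₂ - δ * V₃ + 4 * y₀ := by
      have : V₀ = V₁ + V₂ - δ * V₃ + 4 * y₀ := by omega
      rw [this]
      push_cast
      ring
    obtain ⟨z₁, hz₁⟩ : ∃ z, V₁ - δ * V₃ = 2 * z := by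
      rcases hδ with rfl | rfl
      · exact ⟨y₁, by omega⟩
      · exact ⟨y₁ + V₃, by omega⟩
    obtain ⟨z₂, hz₂⟩ : ∃ z, V₂ - δ * V₃ = 2 * z := by
      rcases hδ with rfl | rfl
      · exact ⟨y₂, by omega⟩
      · exact ⟨y₂ + V₃, by omega⟩
    have hV1 : (V₁ : L) = δ * V₃ + 2 * z₁ := by
      have : V₁ = δ * V₃ + 2 * z₁ := by omega
      rw [this]
      push_cast
      ring
    have hV2 : (V₂ : L) = δ * V₃ + 2 * z₂ := by
      have : V₂ = δ * V₃ + 2 * z₂ := by omega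
      rw [this]
      push_cast
      ring
    refine isIntegral_of_eq ((((hz y₀).add ((hz z₁).mul hsa)).add ((hz z₂).mul hsb)).add
      (((hz (δ * V₃)).mul hprod).sub ((hz (δ * V₃ * q)).mul hsc))) ?_
    have hmul := F.mul_ab
    simp only [point]
    push_cast at hmul ⊢
    rw [hV0, hV1, hV2]
    linear_combination (-(δ : L) * V₃ / 4) * hmul - V₃ / 4 * sc * hδ2

end Frame

end IntegersOdd

/-! ### Generators of the lattices over their orders -/

section Lattices

theorem eq_or_eq_of_mul_eq_one {t : ℚ} {c z : ℤ} (hc : t = c) (h : t * z = 1) :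
    t = 1 ∨ t = -1 := by
  subst hc
  have h1 : c * z = 1 := by exact_mod_cast h
  rcases Int.isUnit_iff.1 (IsUnit.of_mul_eq_one z h1) with rfl | rfl <;> simp

theorem eq_neg_one_or_one_of_mul_eq_one {c z : ℤ} (h : z * c = 1) : c = 1 ∨ c = -1 :=
  Int.isUnit_iff.1 (IsUnit.of_mul_eq_one z (by rwa [mul_comm]))

namespace IsLatticeGenerator

variable {Λ : ℚ → ℚ → ℚ → ℚ → Prop} {g g' : ℤ} {v₀ v₁ v₂ v₃ : ℚ}

/-- The quotient of a lattice vector by a generator, in `ℚ × ℚ × ℚ[J]` with `J² = -g g'`, maps the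
lattice into itself. -/
theorem quotient_stable (G : IsLatticeGenerator Λ g g' v₀ v₁ v₂ v₃) {w₀ w₁ w₂ w₃ : ℚ}
    (hw : Λ w₀ w₁ w₂ w₃) {N : ℚ} (hN : N = g * v₂ ^ 2 + g' * v₃ ^ 2) {x₀ x₁ x₂ x₃ : ℚ}
    (hx : Λ x₀ x₁ x₂ x₃) :
    Λ (w₀ / v₀ * x₀) (w₁ / v₁ * x₁)
      ((g * v₂ * w₂ + g' * v₃ * w₃) / N * x₂ - (v₂ * w₃ - v₃ * w₂) / N * g' * x₃)
      ((g * v₂ * w₂ + g' * v₃ * w₃) / N * x₃ + (v₂ * w₃ - v₃ * w₂) / N * g * x₂) := by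
  have hN0 : N ≠ 0 := hN ▸ G.norm_ne
  have h0 := G.ne_zero
  have h1 := G.ne_one
  refine G.stable _ _ _ _ ?_ _ _ _ _ hx
  have e0 : w₀ / v₀ * v₀ = w₀ := by field_simp
  have e1 : w₁ / v₁ * v₁ = w₁ := by field_simp
  have e2 : (g * v₂ * w₂ + g' * v₃ * w₃) / N * v₂ - (v₂ * w₃ - v₃ * w₂) / N * g' * v₃ = w₂ := by
    field_simp
    rw [hN]
    ring
  have e3 : (g * v₂ * w₂ + g' * v₃ * w₃) / N * v₃ + (v₂ * w₃ - v₃ * w₂) / N * g * v₂ = w₃ := by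
    field_simp
    rw [hN]
    ring
  rw [e0, e1, e2, e3]
  exact hw

theorem div_zero_mem (G : IsLatticeGenerator Λ g g' v₀ v₁ v₂ v₃) (h : Λ 1 0 0 0) {w₀ w₁ w₂ w₃ : ℚ}
    (hw : Λ w₀ w₁ w₂ w₃) : Λ (w₀ / v₀) 0 0 0 := by
  simpa [div_eq_inv_mul] using G.quotient_stable h rfl hw

theorem div_one_mem (G : IsLatticeGenerator Λ g g' v₀ v₁ v₂ v₃) (h : Λ 0 1 0 0) {w₀ w₁ w₂ w₃ : ℚ}
    (hw : Λ w₀ w₁ w₂ w₃) : Λ 0 (w₁ / v₁) 0 0 := by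
  simpa [div_eq_inv_mul] using G.quotient_stable h rfl hw

/-- If every operator `(0, 0, r, s)` in the order has determinant `r² + g g' s²` in `κℤ`, then the
norm `N` of a generator is the inverse of an element of `κℤ`: the quotients of `√b` and of `√c` by
the generator have determinants `g / N` and `g' / N`, and `g`, `g'` are coprime. -/
theorem exists_mul_norm_eq_one (G : IsLatticeGenerator Λ g g' v₀ v₁ v₂ v₃) (hcop : IsCoprime g g')
    (h2 : Λ 0 0 1 0) (h3 : Λ 0 0 0 1) (κ : ℚ)
    (hdet : ∀ r s : ℚ, (∀ w₀ w₁ w₂ w₃, Λ w₀ w₁ w₂ w₃ →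
      Λ 0 0 (r * w₂ - s * g' * w₃) (r * w₃ + s * g * w₂)) →
      ∃ Z : ℤ, r ^ 2 + g * g' * s ^ 2 = κ * Z) :
    ∃ Z : ℤ, κ * Z * (g * v₂ ^ 2 + g' * v₃ ^ 2) = 1 := by
  obtain ⟨N, hN⟩ : ∃ N : ℚ, N = g * v₂ ^ 2 + g' * v₃ ^ 2 := ⟨_, rfl⟩
  have hN0 : N ≠ 0 := hN ▸ G.norm_ne
  obtain ⟨Z, hZ⟩ := hdet _ _ fun w₀ w₁ w₂ w₃ hw => by
    simpa using G.quotient_stable h2 hN hw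
  obtain ⟨Z', hZ'⟩ := hdet _ _ fun w₀ w₁ w₂ w₃ hw => by
    simpa using G.quotient_stable h3 hN hw
  obtain ⟨x, y, hxy⟩ := hcop
  have hxy : (x : ℚ) * g + y * g' = 1 := by exact_mod_cast hxy
  refine ⟨x * Z + y * Z', ?_⟩
  rw [← hN]
  have k1 : κ * Z * N = g := by
    rw [← hZ]
    field_simp
    rw [hN]
  have k2 : κ * Z' * N = g' := by
    rw [← hZ']
    field_simp
    rw [hN]
    ring
  push_cast
  linear_combination x * k1 + y * k2 + hxy

/-- Exchanging `√b` and `√c` exchanges `g` and `g'` and changes the sign of the operator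
`√b ↦ g √c`, `√c ↦ -g' √b`. -/
theorem swap (G : IsLatticeGenerator Λ g g' v₀ v₁ v₂ v₃) :
    IsLatticeGenerator (fun w₀ w₁ w₂ w₃ => Λ w₀ w₁ w₃ w₂) g' g v₀ v₁ v₃ v₂ where
  mem := G.mem
  ne_zero := G.ne_zero
  ne_one := G.ne_one
  norm_ne := by
    rw [add_comm]
    exact G.norm_ne
  stable p q r s h w₀ w₁ w₂ w₃ hw := by
    have := G.stable p q r (-s) (by convert h using 1 <;> ring) w₀ w₁ w₃ w₂ hw
    convert this using 1 <;> ring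

end IsLatticeGenerator

theorem isLatticeGenerator_swap_iff {Λ : ℚ → ℚ → ℚ → ℚ → Prop} {g g' : ℤ} {v₀ v₁ v₂ v₃ : ℚ} :
    IsLatticeGenerator (fun w₀ w₁ w₂ w₃ => Λ w₀ w₁ w₃ w₂) g' g v₀ v₁ v₃ v₂ ↔
      IsLatticeGenerator Λ g g' v₀ v₁ v₂ v₃ :=
  ⟨fun G => G.swap, fun G => G.swap⟩

variable {g g' : ℤ}

/-- The determinant of an operator that preserves `ℤ√b + ℤ(√b + √c)/2` is an integer. -/
theorem exists_det_eq_of_half {r s : ℚ} {a b c d : ℤ} (h1 : r = a + b / 2) (h2 : s * g = b / 2)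
    (h3 : (r - s * g') / 2 = c + d / 2) (h4 : (r + s * g) / 2 = d / 2) :
    ∃ Z : ℤ, r ^ 2 + g * g' * s ^ 2 = 1 * Z := by
  refine ⟨a * d - b * c, ?_⟩
  push_cast
  have hd : (d : ℚ) = r + s * g := by linarith
  have hb : (b : ℚ) = 2 * (s * g) := by linarith
  have ha : (a : ℚ) = r - s * g := by linarith
  have hc : (c : ℚ) = -(s * g' + s * g) / 2 := by linarith
  rw [ha, hb, hc, hd]
  ring

theorem isLatticeGenerator_latticeA_iff (hcop : IsCoprime g g') (hmod : 4 ∣ g + g') (hodd : ¬ 2 ∣ g)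
    {v₀ v₁ v₂ v₃ : ℚ} :
    IsLatticeGenerator latticeA g g' v₀ v₁ v₂ v₃ ↔ (v₀ = 1 ∨ v₀ = -1) ∧ (v₁ = 1 ∨ v₁ = -1) ∧
      ∃ X y : ℤ, v₂ = X / 2 ∧ v₃ = y / 2 ∧
        (g * X ^ 2 + g' * y ^ 2 = 4 ∨ g * X ^ 2 + g' * y ^ 2 = -4) := by
  obtain ⟨f, hf⟩ := hmod
  obtain rfl : g' = 4 * f - g := by omega
  have m0 : latticeA 1 0 0 0 := ⟨1, 0, 0, 0, by norm_num, by norm_num, by norm_num, by norm_num⟩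
  have m1 : latticeA 0 1 0 0 := ⟨0, 1, 0, 0, by norm_num, by norm_num, by norm_num, by norm_num⟩
  have m2 : latticeA 0 0 1 0 := ⟨0, 0, 1, 0, by norm_num, by norm_num, by norm_num, by norm_num⟩
  have m3 : latticeA 0 0 0 1 := ⟨0, 0, -1, 2, by norm_num, by norm_num, by norm_num, by norm_num⟩
  have mh : latticeA 0 0 (1 / 2) (1 / 2) :=
    ⟨0, 0, 0, 1, by norm_num, by norm_num, by norm_num, by norm_num⟩
  constructor
  · intro G
    obtain ⟨c₀, c₁, c₂, c₃, e0, e1, e2, e3⟩ := G.mem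
    have h0 := G.ne_zero
    have h1 := G.ne_one
    refine ⟨?_, ?_, 2 * c₂ + c₃, c₃, by rw [e2]; push_cast; ring, e3, ?_⟩
    · obtain ⟨z, -, -, -, hz, -⟩ := G.div_zero_mem m0 m0
      exact eq_or_eq_of_mul_eq_one e0 (z := z) (by rw [← hz]; field_simp)
    · obtain ⟨-, z, -, -, -, hz, -⟩ := G.div_one_mem m1 m1
      exact eq_or_eq_of_mul_eq_one e1 (z := z) (by rw [← hz]; field_simp)
    · obtain ⟨Z, hZ⟩ := G.exists_mul_norm_eq_one hcop m2 m3 1 (by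
        intro r s h
        obtain ⟨-, -, a, b, -, -, k1, k2⟩ := h _ _ _ _ m2
        obtain ⟨-, -, c, d, -, -, k3, k4⟩ := h _ _ _ _ mh
        exact exists_det_eq_of_half (a := a) (b := b) (c := c) (d := d) (by linarith)
          (by linarith) (by linarith) (by linarith))
      have h2 : Z * (f * c₃ ^ 2 + g * c₂ * (c₃ + c₂)) = 1 := by
        rw [e2, e3] at hZ
        push_cast at hZ
        have : (Z : ℚ) * (f * c₃ ^ 2 + g * c₂ * (c₃ + c₂)) = 1 := by linear_combination hZ
        exact_mod_cast this
      have h3 : g * (2 * c₂ + c₃) ^ 2 + (4 * f - g) * c₃ ^ 2 =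
          4 * (f * c₃ ^ 2 + g * c₂ * (c₃ + c₂)) := by ring
      rw [h3]
      rcases eq_neg_one_or_one_of_mul_eq_one h2 with h | h <;> rw [h] <;> norm_num
  · rintro ⟨hv0, hv1, X, y, rfl, rfl, hN⟩
    obtain ⟨u, hu, hu2⟩ : ∃ u : ℤ, g * X ^ 2 + (4 * f - g) * y ^ 2 = 4 * u ∧ u * u = 1 := by
      rcases hN with h | h
      · exact ⟨1, by omega, by norm_num⟩
      · exact ⟨-1, by omega, by norm_num⟩
    obtain ⟨u₀, rfl, hu0⟩ : ∃ u : ℤ, v₀ = u ∧ u * u = 1 := by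
      rcases hv0 with rfl | rfl
      · exact ⟨1, by norm_num, by norm_num⟩
      · exact ⟨-1, by norm_num, by norm_num⟩
    obtain ⟨u₁, rfl, hu1⟩ : ∃ u : ℤ, v₁ = u ∧ u * u = 1 := by
      rcases hv1 with rfl | rfl
      · exact ⟨1, by norm_num, by norm_num⟩
      · exact ⟨-1, by norm_num, by norm_num⟩
    obtain ⟨z, rfl⟩ : ∃ z, X = y + 2 * z := by
      obtain ⟨g₁, rfl⟩ : ∃ g₁, g = 2 * g₁ + 1 := ⟨g / 2, by omega⟩
      clear hN
      obtain ⟨x', rfl | rfl⟩ := Int.even_or_odd' X <;>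
      obtain ⟨y', rfl | rfl⟩ := Int.even_or_odd' y
      · exact ⟨x' - y', by ring⟩
      · ring_nf at hu
        omega
      · ring_nf at hu
        omega
      · exact ⟨x' - y', by ring⟩
    have hu' : (g : ℚ) * (y + 2 * z) ^ 2 + (4 * f - g) * y ^ 2 = 4 * u := by exact_mod_cast hu
    have hu2' : (u : ℚ) * u = 1 := by exact_mod_cast hu2
    have hu0' : (u₀ : ℚ) * u₀ = 1 := by exact_mod_cast hu0
    have hu1' : (u₁ : ℚ) * u₁ = 1 := by exact_mod_cast hu1
    refine ⟨⟨u₀, u₁, z, y, rfl, rfl, by push_cast; ring, rfl⟩, left_ne_zero_of_mul_eq_one hu0',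
      left_ne_zero_of_mul_eq_one hu1', ?_, ?_⟩
    · have h1 : (u : ℚ) ≠ 0 := left_ne_zero_of_mul_eq_one hu2'
      intro h2
      apply h1
      push_cast at h2
      linear_combination h2 - hu' / 4
    · rintro p q r s ⟨c₀, c₁, c₂, c₃, e0, e1, e2, e3⟩ _ _ _ _ ⟨k₀, k₁, k₂, k₃, rfl, rfl, rfl, rfl⟩
      push_cast at e2 e3
      -- the operator is `(p, q, u T / 2, u S / 2)` with integers `T = g S + 2 t` and `S`
      have hs : s = u * (z * c₃ - y * c₂ : ℤ) / 2 := by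
        push_cast
        linear_combination (-s) * hu2' - s * u / 4 * hu' + (u : ℚ) / 2 * (y + 2 * z) * e3 -
          (u : ℚ) / 2 * y * e2
      have hr : r = u * (g * (z * c₃ - y * c₂) + 2 * (g * c₂ * (y + z) + f * y * c₃) : ℤ) / 2 := by
        push_cast
        linear_combination (-r) * hu2' - r * u / 4 * hu' + (u : ℚ) / 2 * g * (y + 2 * z) * e2 +
          (u : ℚ) / 2 * (4 * f - g) * y * e3
      have hp : p = u₀ * c₀ := by linear_combination u₀ * e0 - p * hu0'
      have hq : q = u₁ * c₁ := by linear_combination u₁ * e1 - q * hu1'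
      generalize hS : z * c₃ - y * c₂ = S at hs hr
      generalize hT : g * c₂ * (y + z) + f * y * c₃ = t at hr
      refine ⟨u₀ * c₀ * k₀, u₁ * c₁ * k₁, u * (t * k₂ - f * S * k₃),
        u * (S * g * k₂ + (g * S + t) * k₃), ?_, ?_, ?_, ?_⟩
      · rw [hp]; push_cast; ring
      · rw [hq]; push_cast; ring
      · rw [hr, hs]; push_cast; ring
      · rw [hr, hs]; push_cast; ring

/-- The coordinates `v₁` and `v₂` of `latticeA` are exchanged here: `a` is the even number among
`m`, `n`, and `c` is even too. -/
theorem isLatticeGenerator_latticeA_swap_iff (hcop : IsCoprime g g') (hmod : 2 ∣ g')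
    {v₀ v₁ v₂ v₃ : ℚ} :
    IsLatticeGenerator (fun w₀ w₁ w₂ w₃ => latticeA w₀ w₂ w₁ w₃) g g' v₀ v₁ v₂ v₃ ↔
      (v₀ = 1 ∨ v₀ = -1) ∧ (2 * v₁ = 1 ∨ 2 * v₁ = -1) ∧
      ∃ x y : ℤ, v₂ = x ∧ v₃ = y / 2 ∧
        (4 * g * x ^ 2 + g' * y ^ 2 = 2 ∨ 4 * g * x ^ 2 + g' * y ^ 2 = -2) := by
  obtain ⟨f, rfl⟩ := hmod
  have m0 : latticeA 1 0 0 0 := ⟨1, 0, 0, 0, by norm_num, by norm_num, by norm_num, by norm_num⟩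
  have m1 : latticeA 0 0 1 0 := ⟨0, 0, 1, 0, by norm_num, by norm_num, by norm_num, by norm_num⟩
  have m2 : latticeA 0 1 0 0 := ⟨0, 1, 0, 0, by norm_num, by norm_num, by norm_num, by norm_num⟩
  have m3 : latticeA 0 0 0 1 := ⟨0, 0, -1, 2, by norm_num, by norm_num, by norm_num, by norm_num⟩
  have mh : latticeA 0 0 (1 / 2) (1 / 2) :=
    ⟨0, 0, 0, 1, by norm_num, by norm_num, by norm_num, by norm_num⟩
  constructor
  · intro G
    obtain ⟨c₀, c₁, c₂, c₃, e0, e2, e1, e3⟩ := G.mem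
    have h0 := G.ne_zero
    have h1 := G.ne_one
    refine ⟨?_, ?_, c₁, c₃, e2, e3, ?_⟩
    · obtain ⟨z, -, -, -, hz, -⟩ := G.div_zero_mem m0 m0
      exact eq_or_eq_of_mul_eq_one e0 (z := z) (by rw [← hz]; field_simp)
    · obtain ⟨-, -, z, z', -, -, hz, hz'⟩ := G.div_one_mem m1 mh
      have h2 : (2 * v₁) * z = 1 := by
        have h3 : (z : ℚ) = 1 / 2 / v₁ := by linarith
        rw [h3]
        field_simp
      exact eq_or_eq_of_mul_eq_one (c := 2 * c₂ + c₃) (by rw [e1]; push_cast; ring) h2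
    · obtain ⟨Z, hZ⟩ := G.exists_mul_norm_eq_one hcop m2 m3 2 (by
        intro r s h
        obtain ⟨-, a, b, b', -, k1, k2, k3⟩ := h _ _ _ _ m2
        obtain ⟨-, c, d, d', -, k4, k5, k6⟩ := h _ _ _ _ mh
        refine ⟨2 * d ^ 2 + b * c, ?_⟩
        have hr : r = -2 * d := by linarith
        have hsg : s * g = -b := by linarith
        have hsg' : s * (2 * f) = -2 * c := by push_cast at k4; linarith
        push_cast
        rw [hr]
        linear_combination s * (2 * f) * hsg - b * hsg')
      have h2 : Z * (2 * g * c₁ ^ 2 + f * c₃ ^ 2) = 1 := by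
        rw [e2, e3] at hZ
        push_cast at hZ
        have : (Z : ℚ) * (2 * g * c₁ ^ 2 + f * c₃ ^ 2) = 1 := by linear_combination hZ
        exact_mod_cast this
      have h3 : 4 * g * c₁ ^ 2 + 2 * f * c₃ ^ 2 = 2 * (2 * g * c₁ ^ 2 + f * c₃ ^ 2) := by ring
      rw [h3]
      rcases eq_neg_one_or_one_of_mul_eq_one h2 with h | h <;> rw [h] <;> norm_num
  · rintro ⟨hv0, hv1, x, y, rfl, rfl, hN⟩
    obtain ⟨u, hu, hu2⟩ : ∃ u : ℤ, 2 * g * x ^ 2 + f * y ^ 2 = u ∧ u * u = 1 := by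
      rcases hN with h | h
      · exact ⟨1, by linarith, by norm_num⟩
      · exact ⟨-1, by linarith, by norm_num⟩
    have huodd : ∃ u', u = 2 * u' + 1 := by
      rcases Int.isUnit_iff.1 (IsUnit.of_mul_eq_one u hu2) with rfl | rfl
      exacts [⟨0, by norm_num⟩, ⟨-1, by norm_num⟩]
    obtain ⟨u₀, rfl, hu0⟩ : ∃ u : ℤ, v₀ = u ∧ u * u = 1 := by
      rcases hv0 with rfl | rfl
      · exact ⟨1, by norm_num, by norm_num⟩
      · exact ⟨-1, by norm_num, by norm_num⟩
    obtain ⟨u₁, hv1', hu1, u₁', hu1odd⟩ :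
        ∃ u : ℤ, v₁ = u / 2 ∧ u * u = 1 ∧ ∃ u', u = 2 * u' + 1 := by
      rcases hv1 with h | h
      · exact ⟨1, by push_cast; linarith, by norm_num, 0, by norm_num⟩
      · exact ⟨-1, by push_cast; linarith, by norm_num, -1, by norm_num⟩
    obtain ⟨y', f', rfl, rfl⟩ : ∃ y' f', y = 2 * y' + 1 ∧ f = 2 * f' + 1 := by
      obtain ⟨u', rfl⟩ := huodd
      clear hN
      obtain ⟨y', rfl | rfl⟩ := Int.even_or_odd' y
      · ring_nf at hu
        omega
      obtain ⟨f', rfl | rfl⟩ := Int.even_or_odd' f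
      · ring_nf at hu
        omega
      · exact ⟨y', f', rfl, rfl⟩
    have hu' : 2 * (g : ℚ) * x ^ 2 + (2 * f' + 1) * (2 * y' + 1) ^ 2 = u := by exact_mod_cast hu
    have hu2' : (u : ℚ) * u = 1 := by exact_mod_cast hu2
    have hu0' : (u₀ : ℚ) * u₀ = 1 := by exact_mod_cast hu0
    have hu1' : (u₁ : ℚ) * u₁ = 1 := by exact_mod_cast hu1
    subst hv1'
    refine ⟨⟨u₀, x, u₁' - y', 2 * y' + 1, rfl, rfl, by rw [hu1odd]; push_cast; ring, rfl⟩,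
      left_ne_zero_of_mul_eq_one hu0',
      div_ne_zero (left_ne_zero_of_mul_eq_one hu1') two_ne_zero, ?_, ?_⟩
    · have h1 : (u : ℚ) ≠ 0 := left_ne_zero_of_mul_eq_one hu2'
      intro h2
      apply h1
      push_cast at h2
      linear_combination 2 * h2 - hu'
    · rintro p q r s ⟨c₀, c₁, c₂, c₃, e0, e2, e1, e3⟩ _ _ _ _ ⟨k₀, k₁, k₂, k₃, rfl, rfl, rfl, rfl⟩
      push_cast at e2 e3
      have hs : s = (u * (x * c₃ - (2 * y' + 1) * c₁) : ℤ) := by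
        push_cast
        linear_combination (-s) * hu2' - s * u * hu' + (u : ℚ) * 2 * x * e3 -
          (u : ℚ) * (2 * y' + 1) * e2
      have hr : r = (u * (2 * g * x * c₁ + (2 * f' + 1) * (2 * y' + 1) * c₃) : ℤ) := by
        push_cast
        linear_combination (-r) * hu2' - r * u * hu' + (u : ℚ) * 2 * g * x * e2 +
          (u : ℚ) * 2 * (2 * f' + 1) * (2 * y' + 1) * e3
      have hp : p = u₀ * c₀ := by linear_combination u₀ * e0 - p * hu0'
      have hq : q = (u₁ * (2 * c₂ + c₃) : ℤ) := by
        push_cast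
        linear_combination 2 * u₁ * e1 - q * hu1'
      obtain ⟨z, hz⟩ : ∃ z, u₁ * (2 * c₂ + c₃) =
          u * (2 * g * x * c₁ + (2 * f' + 1) * (2 * y' + 1) * c₃) + 2 * z := by
        obtain ⟨u', rfl⟩ := huodd
        rw [hu1odd]
        exact ⟨u₁' * (2 * c₂ + c₃) + c₂ - (2 * u' + 1) * g * x * c₁ -
          (u' * (2 * f' + 1) * (2 * y' + 1) + f' * (2 * y' + 1) + y') * c₃, by ring⟩
      rw [hz] at hq
      generalize u * (x * c₃ - (2 * y' + 1) * c₁) = S at hs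
      generalize u * (2 * g * x * c₁ + (2 * f' + 1) * (2 * y' + 1) * c₃) = R at hr hq
      refine ⟨u₀ * c₀ * k₀, R * k₁ - S * (2 * f' + 1) * k₃, (R + 2 * z) * k₂ + z * k₃ - S * g * k₁,
        R * k₃ + 2 * S * g * k₁, ?_, ?_, ?_, ?_⟩
      · rw [hp]; push_cast; ring
      · rw [hr, hs]; push_cast; ring
      · rw [hq]; push_cast; ring
      · rw [hr, hs]; push_cast; ring

end Lattices

section LatticesOdd

variable {g g' : ℤ}

/-- If `g`, `X`, `y` are odd and `g + g' ≡ 2` modulo 4, then `g X² + g' y²` is twice an odd number,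
so it is `±2` if it divides 4. -/
theorem eq_two_or_neg_two_of_dvd_four {f X y Z : ℤ} (hg : ∃ g₁, g = 2 * g₁ + 1)
    (hf : ∃ f₁, f = 2 * f₁ + 1) (hfg : g' = 2 * f - g) (hX : ∃ x₁, X = 2 * x₁ + 1)
    (hy : ∃ y₁, y = 2 * y₁ + 1) (h : Z * (g * X ^ 2 + g' * y ^ 2) = 4) :
    g * X ^ 2 + g' * y ^ 2 = 2 ∨ g * X ^ 2 + g' * y ^ 2 = -2 := by
  obtain ⟨n, hn⟩ : ∃ n, g * X ^ 2 + g' * y ^ 2 = 2 * (2 * n + 1) := by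
    obtain ⟨g₁, rfl⟩ := hg
    obtain ⟨f₁, rfl⟩ := hf
    obtain ⟨x₁, rfl⟩ := hX
    obtain ⟨y₁, rfl⟩ := hy
    rw [hfg]
    exact ⟨(2 * g₁ + 1) * (x₁ ^ 2 + x₁ - y₁ ^ 2 - y₁) + (2 * f₁ + 1) * (2 * y₁ ^ 2 + 2 * y₁) + f₁,
      by ring⟩
  rw [hn] at h ⊢
  obtain ⟨Z', rfl⟩ : 2 ∣ Z := by
    have : Z * (2 * (2 * n + 1)) = 4 * (Z * n) + 2 * Z := by ring
    omega
  have h1 : Z' * (2 * n + 1) = 1 := by linarith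
  rcases eq_neg_one_or_one_of_mul_eq_one h1 with h2 | h2 <;> rw [h2] <;> norm_num

theorem isLatticeGenerator_latticeB_iff (hcop : IsCoprime g g') (hmod : (g + g') % 4 = 2)
    (hodd : ¬ 2 ∣ g) {v₀ v₁ v₂ v₃ : ℚ} :
    IsLatticeGenerator latticeB g g' v₀ v₁ v₂ v₃ ↔
      (2 * v₀ = 1 ∨ 2 * v₀ = -1) ∧ (2 * v₁ = 1 ∨ 2 * v₁ = -1) ∧
      ∃ X y : ℤ, v₂ = X / 2 ∧ v₃ = y / 2 ∧
        (g * X ^ 2 + g' * y ^ 2 = 2 ∨ g * X ^ 2 + g' * y ^ 2 = -2) := by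
  obtain ⟨f, hf⟩ : ∃ f, g + g' = 2 * f := ⟨(g + g') / 2, by omega⟩
  obtain ⟨f₁, hf₁⟩ : ∃ f₁, f = 2 * f₁ + 1 := ⟨f / 2, by omega⟩
  obtain ⟨g₁, hg₁⟩ : ∃ g₁, g = 2 * g₁ + 1 := ⟨g / 2, by omega⟩
  obtain rfl : g' = 2 * f - g := by omega
  have m0 : latticeB 1 0 0 0 := ⟨1, 0, 0, 0, by norm_num, by norm_num, by norm_num, by norm_num⟩
  have m1 : latticeB 0 1 0 0 := ⟨-1, 2, 0, 0, by norm_num, by norm_num, by norm_num, by norm_num⟩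
  have mh' : latticeB (1 / 2) (1 / 2) 0 0 :=
    ⟨0, 1, 0, 0, by norm_num, by norm_num, by norm_num, by norm_num⟩
  have m2 : latticeB 0 0 1 0 := ⟨0, 0, 1, 0, by norm_num, by norm_num, by norm_num, by norm_num⟩
  have m3 : latticeB 0 0 0 1 := ⟨0, 0, -1, 2, by norm_num, by norm_num, by norm_num, by norm_num⟩
  have mh : latticeB 0 0 (1 / 2) (1 / 2) :=
    ⟨0, 0, 0, 1, by norm_num, by norm_num, by norm_num, by norm_num⟩
  constructor
  · intro G
    obtain ⟨c₀, c₁, c₂, c₃, e0, e1, e2, e3⟩ := G.mem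
    have h0 := G.ne_zero
    have h1 := G.ne_one
    refine ⟨?_, ?_, 2 * c₂ + c₃, c₃, by rw [e2]; push_cast; ring, e3, ?_⟩
    · obtain ⟨z, z', -, -, hz, hz', -⟩ := G.div_zero_mem m0 mh'
      have h2 : (2 * v₀) * z = 1 := by
        have h3 : (z : ℚ) = 1 / 2 / v₀ := by linarith
        rw [h3]
        field_simp
      exact eq_or_eq_of_mul_eq_one (c := 2 * c₀ + c₁) (by rw [e0]; push_cast; ring) h2
    · obtain ⟨z, z', -, -, hz, hz', -⟩ := G.div_one_mem m1 mh'
      have h2 : (2 * v₁) * (-z : ℤ) = 1 := by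
        have h3 : ((-z : ℤ) : ℚ) = 1 / 2 / v₁ := by push_cast; linarith
        rw [h3]
        field_simp
      exact eq_or_eq_of_mul_eq_one (c := c₁) (by rw [e1]; ring) h2
    · obtain ⟨Z, hZ⟩ := G.exists_mul_norm_eq_one hcop m2 m3 1 (by
        intro r s h
        obtain ⟨-, -, a, b, -, -, k1, k2⟩ := h _ _ _ _ m2
        obtain ⟨-, -, c, d, -, -, k3, k4⟩ := h _ _ _ _ mh
        exact exists_det_eq_of_half (a := a) (b := b) (c := c) (d := d) (by linarith)
          (by linarith) (by linarith) (by linarith))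
      obtain ⟨y, hy | hy⟩ := Int.even_or_odd' c₃
      · -- the generator would lie in `ℤ√b + ℤ√c`, but the quotient of `(√b + √c) / 2` by it
        -- involves `s = ±(x - y) / 2` with `x - y` odd
        exfalso
        subst hy
        obtain ⟨x, hx⟩ : ∃ x, x = c₂ + y := ⟨_, rfl⟩
        have e2' : v₂ = x := by rw [e2, hx]; push_cast; ring
        have e3' : v₃ = y := by rw [e3]; push_cast; ring
        rw [e2', e3'] at hZ
        have h2 : Z * (g * x ^ 2 + (2 * f - g) * y ^ 2) = 1 := by
          have : (Z : ℚ) * (g * x ^ 2 + (2 * f - g : ℤ) * y ^ 2) = 1 := by linear_combination hZ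
          exact_mod_cast this
        obtain ⟨u, hu, hu1⟩ : ∃ u : ℤ, g * x ^ 2 + (2 * f - g) * y ^ 2 = u ∧ (u = 1 ∨ u = -1) :=
          ⟨_, rfl, eq_neg_one_or_one_of_mul_eq_one h2⟩
        have hxy : ∃ t, x - y = 2 * t + 1 := by
          clear e2' e3' hZ e2 h2
          rw [hg₁, hf₁] at hu
          obtain ⟨x', rfl | rfl⟩ := Int.even_or_odd' x <;>
          obtain ⟨y', rfl | rfl⟩ := Int.even_or_odd' y
          · ring_nf at hu
            omega
          · exact ⟨x' - y' - 1, by ring⟩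
          · exact ⟨x' - y', by ring⟩
          · ring_nf at hu
            omega
        obtain ⟨t, ht⟩ := hxy
        have huN : (u : ℚ) = g * v₂ ^ 2 + (2 * f - g : ℤ) * v₃ ^ 2 := by
          rw [e2', e3', ← hu]
          push_cast
          ring
        obtain ⟨-, -, c, d, -, -, k1, k2⟩ := G.quotient_stable mh huN mh
        have hu2 : ∀ t : ℚ, t / u = t * u := by
          intro t
          rcases hu1 with rfl | rfl <;> push_cast <;> ring
        rw [hu2, hu2, e2', e3'] at k1 k2
        have k3 : (u : ℚ) * (x - y) * f = -2 * c := by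
          push_cast at k1 k2
          linear_combination 2 * k2 - 2 * k1
        have k4 : u * (x - y) * f = -2 * c := by exact_mod_cast k3
        rw [ht, hf₁] at k4
        rcases hu1 with rfl | rfl <;> ring_nf at k4 <;> omega
      · refine eq_two_or_neg_two_of_dvd_four (Z := Z) (f := f) ⟨g₁, hg₁⟩ ⟨f₁, hf₁⟩ rfl
          ⟨c₂ + y, by rw [hy]; ring⟩ ⟨y, hy⟩ ?_
        rw [e2, e3] at hZ
        have : (Z : ℚ) * (g * (2 * c₂ + c₃) ^ 2 + (2 * f - g : ℤ) * c₃ ^ 2) = 4 := by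
          linear_combination 4 * hZ
        exact_mod_cast this
  · rintro ⟨hv0, hv1, X, y, rfl, rfl, hN⟩
    obtain ⟨u, hu, hu2⟩ : ∃ u : ℤ, g * X ^ 2 + (2 * f - g) * y ^ 2 = 2 * u ∧ u * u = 1 := by
      rcases hN with h | h
      · exact ⟨1, by omega, by norm_num⟩
      · exact ⟨-1, by omega, by norm_num⟩
    obtain ⟨u₀, hv0', hu0, a₀, ha₀⟩ :
        ∃ u : ℤ, v₀ = u / 2 ∧ u * u = 1 ∧ ∃ u', u = 2 * u' + 1 := by
      rcases hv0 with h | h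
      · exact ⟨1, by push_cast; linarith, by norm_num, 0, by norm_num⟩
      · exact ⟨-1, by push_cast; linarith, by norm_num, -1, by norm_num⟩
    obtain ⟨u₁, hv1', hu1, a₁, ha₁⟩ :
        ∃ u : ℤ, v₁ = u / 2 ∧ u * u = 1 ∧ ∃ u', u = 2 * u' + 1 := by
      rcases hv1 with h | h
      · exact ⟨1, by push_cast; linarith, by norm_num, 0, by norm_num⟩
      · exact ⟨-1, by push_cast; linarith, by norm_num, -1, by norm_num⟩
    obtain ⟨z, rfl⟩ : ∃ z, X = y + 2 * z := by
      clear hN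
      rw [hg₁] at hu
      obtain ⟨x', rfl | rfl⟩ := Int.even_or_odd' X <;>
      obtain ⟨y', rfl | rfl⟩ := Int.even_or_odd' y
      · exact ⟨x' - y', by ring⟩
      · ring_nf at hu
        omega
      · ring_nf at hu
        omega
      · exact ⟨x' - y', by ring⟩
    have hu' : (g : ℚ) * (y + 2 * z) ^ 2 + (2 * f - g) * y ^ 2 = 2 * u := by exact_mod_cast hu
    have hu2' : (u : ℚ) * u = 1 := by exact_mod_cast hu2
    have hu0' : (u₀ : ℚ) * u₀ = 1 := by exact_mod_cast hu0
    have hu1' : (u₁ : ℚ) * u₁ = 1 := by exact_mod_cast hu1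
    subst hv0' hv1'
    refine ⟨⟨a₀ - a₁, u₁, z, y, ?_, rfl, by push_cast; ring, rfl⟩,
      div_ne_zero (left_ne_zero_of_mul_eq_one hu0') two_ne_zero,
      div_ne_zero (left_ne_zero_of_mul_eq_one hu1') two_ne_zero, ?_, ?_⟩
    · rw [ha₀, ha₁]
      push_cast
      ring
    · have h1 : (u : ℚ) ≠ 0 := left_ne_zero_of_mul_eq_one hu2'
      intro h2
      apply h1
      push_cast at h2
      linear_combination 2 * h2 - hu' / 2
    · rintro p q r s ⟨c₀, c₁, c₂, c₃, e0, e1, e2, e3⟩ _ _ _ _ ⟨k₀, k₁, k₂, k₃, rfl, rfl, rfl, rfl⟩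
      push_cast at e2 e3
      have hs : s = (u * (z * c₃ - y * c₂) : ℤ) := by
        push_cast
        linear_combination (-s) * hu2' - s * u / 2 * hu' + (u : ℚ) * (y + 2 * z) * e3 -
          (u : ℚ) * y * e2
      have hr : r = (u * (g * (y * c₂ + z * c₃ + 2 * z * c₂) + f * y * c₃) : ℤ) := by
        push_cast
        linear_combination (-r) * hu2' - r * u / 2 * hu' + (u : ℚ) * g * (y + 2 * z) * e2 +
          (u : ℚ) * (2 * f - g) * y * e3
      have hq : q = (u₁ * c₁ : ℤ) := by
        push_cast
        linear_combination 2 * u₁ * e1 - q * hu1'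
      have hp : p = (u₁ * c₁ + 2 * (u₀ * c₀ + (a₀ - a₁) * c₁) : ℤ) := by
        have h2 : u₁ * c₁ + 2 * (u₀ * c₀ + (a₀ - a₁) * c₁) = u₀ * (2 * c₀ + c₁) := by
          rw [ha₀, ha₁]
          ring
        rw [h2]
        push_cast
        linear_combination 2 * u₀ * e0 - p * hu0'
      generalize u₁ * c₁ = Q at hq hp
      generalize u₀ * c₀ + (a₀ - a₁) * c₁ = P at hp
      generalize u * (z * c₃ - y * c₂) = S at hs
      generalize u * (g * (y * c₂ + z * c₃ + 2 * z * c₂) + f * y * c₃) = R at hr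
      refine ⟨(Q + 2 * P) * k₀ + P * k₁, Q * k₁, R * k₂ - S * f * k₃ - S * g * k₂,
        R * k₃ + 2 * S * g * k₂ + S * g * k₃, ?_, ?_, ?_, ?_⟩
      · rw [hp]; push_cast; ring
      · rw [hq]; push_cast; ring
      · rw [hr, hs]; push_cast; ring
      · rw [hr, hs]; push_cast; ring

/-- The operators `(0, 0, r, s)` of the order have determinants in `4ℤ`, so a generator would have
norm `±1/4`. The quotient of `(1 + √b) / 2` by it then has an odd parameter `s`; but stability of
the lattice makes `s g` and `s g'` even, which is impossible for coprime `g`, `g'`. -/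
theorem not_isLatticeGenerator_latticeB_swap (hcop : IsCoprime g g') {v₀ v₁ v₂ v₃ : ℚ} :
    ¬ IsLatticeGenerator (fun w₀ w₁ w₂ w₃ => latticeB w₀ w₂ w₁ w₃) g g' v₀ v₁ v₂ v₃ := by
  have m0 : latticeB 1 0 0 0 := ⟨1, 0, 0, 0, by norm_num, by norm_num, by norm_num, by norm_num⟩
  have m1 : latticeB 0 0 1 0 := ⟨0, 0, 1, 0, by norm_num, by norm_num, by norm_num, by norm_num⟩
  have m2 : latticeB 0 1 0 0 := ⟨-1, 2, 0, 0, by norm_num, by norm_num, by norm_num, by norm_num⟩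
  have m3 : latticeB 0 0 0 1 := ⟨0, 0, -1, 2, by norm_num, by norm_num, by norm_num, by norm_num⟩
  have mb : latticeB (1 / 2) (1 / 2) 0 0 :=
    ⟨0, 1, 0, 0, by norm_num, by norm_num, by norm_num, by norm_num⟩
  have mc : latticeB 0 0 (1 / 2) (1 / 2) :=
    ⟨0, 0, 0, 1, by norm_num, by norm_num, by norm_num, by norm_num⟩
  intro G
  obtain ⟨c₀, c₂, c₁, c₃, e0, e2, e1, e3⟩ := G.mem
  have h1 := G.ne_one
  have hc3 : ∃ t, c₃ = 2 * t + 1 := by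
    obtain ⟨-, -, z, z', -, -, hz, hz'⟩ := G.div_one_mem m1 mc
    have h2 : (2 * v₁) * z = 1 := by
      have h3 : (z : ℚ) = 1 / 2 / v₁ := by linarith
      rw [h3]
      field_simp
    rcases eq_or_eq_of_mul_eq_one (c := 2 * c₁ + c₃) (by rw [e1]; push_cast; ring) h2 with h | h
    · have h3 : ((2 * c₁ + c₃ : ℤ) : ℚ) = 1 := by rw [← h, e1]; push_cast; ring
      have h4 : 2 * c₁ + c₃ = 1 := by exact_mod_cast h3
      exact ⟨-c₁, by linarith⟩
    · have h3 : ((2 * c₁ + c₃ : ℤ) : ℚ) = -1 := by rw [← h, e1]; push_cast; ring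
      have h4 : 2 * c₁ + c₃ = -1 := by exact_mod_cast h3
      exact ⟨-c₁ - 1, by linarith⟩
  obtain ⟨Z, hZ⟩ := G.exists_mul_norm_eq_one hcop m2 m3 4 (by
    intro r s h
    obtain ⟨a, a', b, b', k1, k2, k3, k4⟩ := h _ _ _ _ mb
    obtain ⟨c, c', d, d', k5, k6, k7, k8⟩ := h _ _ _ _ mc
    refine ⟨d ^ 2 - b * c, ?_⟩
    have hr : r = -2 * d := by linarith
    have hsg : s * g = -2 * b := by linarith
    have hc : s * g' = 2 * c := by linarith
    push_cast
    rw [hr]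
    linear_combination s * g' * hsg - 2 * b * hc)
  have h2 : Z * (g * c₂ ^ 2 + g' * c₃ ^ 2) = 1 := by
    rw [e2, e3] at hZ
    have : (Z : ℚ) * (g * c₂ ^ 2 + g' * c₃ ^ 2) = 1 := by linear_combination hZ
    exact_mod_cast this
  obtain ⟨u, hu, hu1⟩ : ∃ u : ℤ, g * c₂ ^ 2 + g' * c₃ ^ 2 = u ∧ (u = 1 ∨ u = -1) :=
    ⟨_, rfl, eq_neg_one_or_one_of_mul_eq_one h2⟩
  have huN : (u : ℚ) / 4 = g * v₂ ^ 2 + g' * v₃ ^ 2 := by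
    rw [e2, e3, ← hu]
    push_cast
    ring
  have hu2 : ∀ t : ℚ, t / (u / 4) = t * (4 * u) := by
    intro t
    rcases hu1 with rfl | rfl <;> push_cast <;> ring
  obtain ⟨-, -, b, b', -, -, k1, k2⟩ := G.quotient_stable mb huN mb
  obtain ⟨c, c', -, -, k3, k4, -, -⟩ := G.quotient_stable mb huN mc
  rw [hu2, hu2, e2, e3] at k2 k4
  have hg : g * (c₃ * u) = 2 * b := by
    have : (g : ℚ) * (c₃ * u) = 2 * b := by linarith
    exact_mod_cast this
  have hg' : g' * (c₃ * u) = -2 * c := by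
    have : (g' : ℚ) * (c₃ * u) = -2 * c := by linarith
    exact_mod_cast this
  obtain ⟨x, y, hxy⟩ := hcop
  have h5 : c₃ * u = 2 * (x * b - y * c) := by
    linear_combination x * hg + y * hg' - c₃ * u * hxy
  obtain ⟨t, rfl⟩ := hc3
  rcases hu1 with h | h <;> rw [h] at h5 <;> omega

end LatticesOdd

section LatticeC

variable {g g' : ℤ}

theorem isLatticeGenerator_latticeC_iff (hcop : IsCoprime g g') {δ : ℤ} (hδ : δ = 1 ∨ δ = -1)
    (hg : 4 ∣ g - δ) (hg' : 4 ∣ g' - δ) {v₀ v₁ v₂ v₃ : ℚ} :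
    IsLatticeGenerator (latticeC δ) g g' v₀ v₁ v₂ v₃ ↔ latticeC δ v₀ v₁ v₂ v₃ ∧
      (4 * v₀ = 1 ∨ 4 * v₀ = -1) ∧ (4 * v₁ = 1 ∨ 4 * v₁ = -1) ∧
      ∃ X y : ℤ, v₂ = X / 4 ∧ v₃ = y / 4 ∧
        (g * X ^ 2 + g' * y ^ 2 = 2 ∨ g * X ^ 2 + g' * y ^ 2 = -2) := by
  obtain ⟨i, hi⟩ := hg
  obtain ⟨j, hj⟩ := hg'
  have m0 : latticeC δ 1 0 0 0 := ⟨4, 0, 0, 0, by norm_num, by norm_num, by norm_num, by norm_num,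
    by omega, by omega, by omega⟩
  have m1 : latticeC δ 0 1 0 0 := ⟨0, 4, 0, 0, by norm_num, by norm_num, by norm_num, by norm_num,
    by omega, by omega, by omega⟩
  have m2 : latticeC δ 0 0 1 0 := ⟨0, 0, 4, 0, by norm_num, by norm_num, by norm_num, by norm_num,
    by omega, by omega, by omega⟩
  have m3 : latticeC δ 0 0 0 1 := ⟨0, 0, 0, 4, by norm_num, by norm_num, by norm_num, by norm_num,
    by omega, by omega, by omega⟩
  have mb : latticeC δ (1 / 2) 0 (1 / 2) 0 := ⟨2, 0, 2, 0, by norm_num, by norm_num, by norm_num,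
    by norm_num, by omega, by omega, by omega⟩
  have mc : latticeC δ (1 / 2) 0 0 (1 / 2) := ⟨2, 0, 0, 2, by norm_num, by norm_num, by norm_num,
    by norm_num, by omega, by omega, by omega⟩
  have mq : latticeC δ (1 / 4) (1 / 4) (1 / 4) (δ / 4) := ⟨1, 1, 1, δ, by norm_num, by norm_num,
    by norm_num, rfl, by omega, by omega, by rcases hδ with rfl | rfl <;> norm_num⟩
  obtain ⟨δ', hδ'⟩ : ∃ δ', δ = 2 * δ' + 1 := ⟨δ / 2, by omega⟩
  constructor
  · intro G
    obtain ⟨V₀, V₁, V₂, V₃, e0, e1, e2, e3, d1, d2, -⟩ := G.mem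
    have h0 := G.ne_zero
    have h1 := G.ne_one
    have hzero : ∀ z : ℤ, (0 : ℚ) = z / 4 → z = 0 := by
      intro z hz
      have : (z : ℚ) = 0 := by linarith
      exact_mod_cast this
    have hV1 : 4 * v₁ = 1 ∨ 4 * v₁ = -1 := by
      obtain ⟨z₀, z, z₂, z₃, hz₀, hz, hz₂, hz₃, -, -, hd⟩ := G.div_one_mem m1 mq
      obtain rfl := hzero _ hz₀
      obtain rfl := hzero _ hz₂
      obtain rfl := hzero _ hz₃
      obtain ⟨t, rfl⟩ : 4 ∣ z := by omega
      refine eq_or_eq_of_mul_eq_one (c := V₁) (z := t) (by rw [e1]; ring) ?_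
      have h4 : (t : ℚ) = 1 / 4 / v₁ := by
        push_cast at hz
        linarith
      rw [h4]
      field_simp
    refine ⟨G.mem, ?_, hV1, V₂, V₃, e2, e3, ?_⟩
    · obtain ⟨z, z₁, z₂, z₃, hz, hz₁, hz₂, hz₃, -, -, hd⟩ := G.div_zero_mem m0 mq
      obtain rfl := hzero _ hz₁
      obtain rfl := hzero _ hz₂
      obtain rfl := hzero _ hz₃
      obtain ⟨t, rfl⟩ : 4 ∣ z := by omega
      refine eq_or_eq_of_mul_eq_one (c := V₀) (z := t) (by rw [e0]; ring) ?_
      have h4 : (t : ℚ) = 1 / 4 / v₀ := by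
        push_cast at hz
        linarith
      rw [h4]
      field_simp
    · obtain ⟨Z, hZ⟩ := G.exists_mul_norm_eq_one hcop m2 m3 4 (by
        intro r s h
        obtain ⟨z₀, z₁, a₂, a₃, k0, k1, k2, k3, d1, d2, d3⟩ := h _ _ _ _ mb
        obtain ⟨y₀, y₁, b₂, b₃, l0, l1, l2, l3, f1, f2, f3⟩ := h _ _ _ _ mc
        obtain ⟨x₀, x₁, x₂, x₃, n0, n1, n2, n3, o1, o2, o3⟩ := h _ _ _ _ mq
        obtain rfl := hzero _ k0
        obtain rfl := hzero _ k1
        obtain rfl := hzero _ l0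
        obtain rfl := hzero _ l1
        obtain rfl := hzero _ n0
        obtain rfl := hzero _ n1
        obtain ⟨α, rfl⟩ : ∃ α, a₂ = 2 * α := ⟨a₂ / 2, by omega⟩
        obtain ⟨β, rfl⟩ : ∃ β, a₃ = 2 * β := ⟨a₃ / 2, by omega⟩
        obtain ⟨β', rfl⟩ : ∃ β', b₂ = -2 * β' := ⟨-b₂ / 2, by omega⟩
        have hr : r = α := by push_cast at k2; linarith
        have hsg : s * g = β := by push_cast at k3; linarith
        have hsg' : s * g' = β' := by push_cast at l2; linarith
        have hx2 : x₂ = α - δ * β' := by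
          have : (x₂ : ℚ) = α - δ * β' := by rw [← hr, ← hsg']; linarith
          exact_mod_cast this
        have hx3 : x₃ = δ * α + β := by
          have : (x₃ : ℚ) = δ * α + β := by rw [← hr, ← hsg]; linarith
          exact_mod_cast this
        subst hx2 hx3
        -- these two congruences make the determinant `α² + β β'` divisible by 4
        have hββ : 4 ∣ β + β' := by
          rcases hδ with rfl | rfl <;> omega
        have hαβ : 2 ∣ α - β := by
          rcases hδ with rfl | rfl <;> omega
        obtain ⟨z, hz⟩ : 4 ∣ α ^ 2 + β * β' := by
          obtain ⟨t, ht⟩ := hββ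
          obtain ⟨t', ht'⟩ := hαβ
          obtain rfl : β' = 4 * t - β := by omega
          obtain rfl : α = β + 2 * t' := by omega
          exact ⟨β * t' + t' ^ 2 + β * t, by ring⟩
        refine ⟨z, ?_⟩
        have hz' : (α : ℚ) ^ 2 + β * β' = 4 * z := by exact_mod_cast hz
        rw [← hz', hr, ← hsg, ← hsg']
        ring)
      have hV1' : V₁ = 1 ∨ V₁ = -1 := by
        rw [e1] at hV1
        rcases hV1 with h | h
        · left
          have : (V₁ : ℚ) = 1 := by linarith
          exact_mod_cast this
        · right
          have : (V₁ : ℚ) = -1 := by linarith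
          exact_mod_cast this
      refine eq_two_or_neg_two_of_dvd_four (Z := Z) (f := δ + 2 * (i + j))
        ⟨δ' + 2 * i, by omega⟩ ⟨δ' + i + j, by omega⟩ (by omega) ⟨V₂ / 2, by omega⟩
        ⟨V₃ / 2, by omega⟩ ?_
      rw [e2, e3] at hZ
      have : (Z : ℚ) * (g * V₂ ^ 2 + g' * V₃ ^ 2) = 4 := by linear_combination 4 * hZ
      exact_mod_cast this
  · rintro ⟨hmem, hv0, hv1, X, y, rfl, rfl, hN⟩
    have hmem' := hmem
    obtain ⟨V₀, V₁, X', y', e0, e1, e2, e3, d1, d2, d3⟩ := hmem'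
    obtain rfl : X = X' := by
      have : (X : ℚ) = X' := by linarith
      exact_mod_cast this
    obtain rfl : y = y' := by
      have : (y : ℚ) = y' := by linarith
      exact_mod_cast this
    clear e2 e3
    obtain ⟨u, hu, hu2, u', hu'⟩ : ∃ u : ℤ, g * X ^ 2 + g' * y ^ 2 = 2 * u ∧ u * u = 1 ∧
        ∃ u', u = 2 * u' + 1 := by
      rcases hN with h | h
      · exact ⟨1, by omega, by norm_num, 0, by norm_num⟩
      · exact ⟨-1, by omega, by norm_num, -1, by norm_num⟩
    have hunit : ∀ (v : ℚ) (V : ℤ), v = V / 4 → (4 * v = 1 ∨ 4 * v = -1) →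
        V * V = 1 ∧ ∃ V', V = 2 * V' + 1 := by
      rintro v V rfl (h | h)
      · have : V = 1 := by
          have : (V : ℚ) = 1 := by linarith
          exact_mod_cast this
        exact ⟨by rw [this]; norm_num, 0, by rw [this]; norm_num⟩
      · have : V = -1 := by
          have : (V : ℚ) = -1 := by linarith
          exact_mod_cast this
        exact ⟨by rw [this]; norm_num, -1, by rw [this]; norm_num⟩
    obtain ⟨hV0, a₀, ha₀⟩ := hunit _ _ e0 hv0
    obtain ⟨hV1, a₁, ha₁⟩ := hunit _ _ e1 hv1
    obtain ⟨z, rfl⟩ : ∃ z, X = y + 2 * z := by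
      obtain ⟨t, ht⟩ := d2
      exact ⟨t, by omega⟩
    subst e0 e1
    have hu1 : (g : ℚ) * (y + 2 * z) ^ 2 + g' * y ^ 2 = 2 * u := by exact_mod_cast hu
    have hu2' : (u : ℚ) * u = 1 := by exact_mod_cast hu2
    have hV0' : (V₀ : ℚ) * V₀ = 1 := by exact_mod_cast hV0
    have hV1' : (V₁ : ℚ) * V₁ = 1 := by exact_mod_cast hV1
    refine ⟨hmem, div_ne_zero (left_ne_zero_of_mul_eq_one hV0') four_ne_zero,
      div_ne_zero (left_ne_zero_of_mul_eq_one hV1') four_ne_zero, ?_, ?_⟩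
    · have h1 : (u : ℚ) ≠ 0 := left_ne_zero_of_mul_eq_one hu2'
      intro h2
      apply h1
      push_cast at h2
      linear_combination 8 * h2 - hu1 / 2
    · rintro p q r s ⟨W₀, W₁, W₂, W₃, e0, e1, e2, e3, f1, f2, f3⟩ _ _ _ _
        ⟨K₀, K₁, K₂, K₃, rfl, rfl, rfl, rfl, k1, k2, k3⟩
      obtain ⟨t, ht⟩ := f2
      obtain rfl : W₂ = W₃ + 2 * t := by omega
      push_cast at e2 e3
      obtain ⟨f, hf⟩ : ∃ f, f = δ + 2 * (i + j) := ⟨_, rfl⟩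
      have hgf : g' = 2 * f - g := by omega
      have hgf' : (g' : ℚ) = 2 * f - g := by exact_mod_cast hgf
      rw [hgf'] at e2 hu1
      have hs : s = (u * (z * W₃ - y * t) : ℤ) := by
        push_cast
        linear_combination (-s) * hu2' - s * u / 2 * hu1 + (u : ℚ) * 2 * (y + 2 * z) * e3 -
          (u : ℚ) * 2 * y * e2
      have hr : r = (u * (g * (y * t + z * W₃ + 2 * z * t) + f * y * W₃) : ℤ) := by
        push_cast
        linear_combination (-r) * hu2' - r * u / 2 * hu1 + (u : ℚ) * 2 * g * (y + 2 * z) * e2 +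
          (u : ℚ) * 2 * (2 * f - g) * y * e3
      have hp : p = (V₀ * W₀ : ℤ) := by
        push_cast
        linear_combination 4 * V₀ * e0 - p * hV0'
      have hq : q = (V₁ * W₁ : ℤ) := by
        push_cast
        linear_combination 4 * V₁ * e1 - q * hV1'
      -- the congruences that describe the order
      obtain ⟨y₁, hy₁⟩ : ∃ y₁, y = 2 * y₁ + 1 := ⟨y / 2, by omega⟩
      obtain ⟨b₁, hb₁⟩ : ∃ b₁, W₁ = W₃ + 2 * b₁ := ⟨(W₁ - W₃) / 2, by omega⟩
      have hPQ : 4 ∣ V₀ * W₀ - V₁ * W₁ - 2 * (u * (z * W₃ - y * t)) := by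
        obtain ⟨c, hc⟩ := d3
        obtain ⟨c', hc'⟩ := f3
        have h1 : V₁ = V₀ - (y + 2 * z) + δ * y - 4 * c := by linarith
        have h2 : W₀ = W₁ + (W₃ + 2 * t) - δ * W₃ + 4 * c' := by linarith
        rw [h1, h2, ha₀, hb₁, hy₁, hu', hδ']
        rcases hδ with h | h
        · obtain rfl : δ' = 0 := by omega
          ring_nf
          omega
        · obtain rfl : δ' = -1 := by omega
          ring_nf
          omega
      have hPR : 2 ∣ V₀ * W₀ - u * (g * (y * t + z * W₃ + 2 * z * t) + f * y * W₃) -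
          u * (z * W₃ - y * t) := by
        obtain ⟨c', hc'⟩ := f3
        have h2 : W₀ = W₁ + (W₃ + 2 * t) - δ * W₃ + 4 * c' := by linarith
        have h3 : g = 2 * (δ' + 2 * i) + 1 := by omega
        have h4 : f = 2 * (δ' + i + j) + 1 := by omega
        rw [h2, h3, h4, ha₀, hb₁, hy₁, hu', hδ']
        ring_nf
        omega
      generalize V₀ * W₀ = P at hp hPQ hPR
      generalize V₁ * W₁ = Q at hq hPQ
      generalize u * (z * W₃ - y * t) = S at hs hPQ hPR
      generalize u * (g * (y * t + z * W₃ + 2 * z * t) + f * y * W₃) = R at hr hPR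
      refine ⟨P * K₀, Q * K₁, R * K₂ - S * g' * K₃, R * K₃ + S * g * K₂, ?_, ?_, ?_, ?_, ?_⟩
      · rw [hp]; push_cast; ring
      · rw [hq]; push_cast; ring
      · rw [hr, hs]; push_cast; ring
      · rw [hr, hs]; push_cast; ring
      · obtain ⟨α, hα⟩ := hPQ
        obtain ⟨β, hβ⟩ := hPR
        obtain ⟨x₁, hx₁⟩ := k1
        obtain ⟨x₂, hx₂⟩ := k2
        obtain ⟨x₃, hx₃⟩ := k3
        obtain rfl : Q = P - 2 * S - 4 * α := by omega
        obtain rfl : R = P - S - 2 * β := by omega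
        obtain rfl : K₁ = K₃ + 2 * x₁ := by omega
        obtain rfl : K₂ = K₃ + 2 * x₂ := by omega
        have h0 : K₀ = K₃ + 2 * x₁ + (K₃ + 2 * x₂) - δ * K₃ + 4 * x₃ := by linarith
        have h1 : g = δ + 4 * i := by omega
        have h2 : g' = δ + 4 * j := by omega
        rw [h0, h1, h2]
        rcases hδ with rfl | rfl
        · refine ⟨?_, ?_, ?_⟩ <;> ring_nf <;> omega
        · refine ⟨?_, ?_, ?_⟩ <;> ring_nf <;> omega

end LatticeC

/-! ### Freeness over the associated orders -/

section Diophantine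

/-- As `g` is square-free and divides `x²`, it divides `x`. -/
theorem sq_add_mul_sq_eq_iff {g g' a : ℤ} (hg : Squarefree g) (ha : a = g * g') (c x y : ℤ) :
    x ^ 2 + a * y ^ 2 = c * g ↔ ∃ X, x = g * X ∧ g * X ^ 2 + g' * y ^ 2 = c := by
  constructor
  · intro h
    have h1 : g ∣ x ^ 2 := ⟨c - g' * y ^ 2, by rw [ha] at h; linarith⟩
    obtain ⟨X, rfl⟩ := (hg.dvd_pow_iff_dvd two_ne_zero).1 h1
    refine ⟨X, rfl, mul_left_cancel₀ hg.ne_zero ?_⟩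
    rw [ha] at h
    linarith
  · rintro ⟨X, rfl, h⟩
    rw [ha, ← h]
    ring

theorem sq_add_mul_sq_eq_or_iff {g g' a : ℤ} (hg : Squarefree g) (ha : a = g * g') (c x y : ℤ) :
    (x ^ 2 + a * y ^ 2 = c * g ∨ x ^ 2 + a * y ^ 2 = -(c * g)) ↔
      ∃ X, x = g * X ∧ (g * X ^ 2 + g' * y ^ 2 = c ∨ g * X ^ 2 + g' * y ^ 2 = -c) := by
  rw [← neg_mul, sq_add_mul_sq_eq_iff hg ha, sq_add_mul_sq_eq_iff hg ha, ← exists_or]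
  simp only [and_or_left]

end Diophantine

section Free

variable {L : Type*} [Field L] [NumberField L] {σ τ : Gal(L/ℚ)} {a b c g g' : ℤ} {sa sb sc : L}

theorem latticeA_swap {v₀ v₁ v₂ v₃ : ℚ} : latticeA v₀ v₁ v₃ v₂ ↔ latticeA v₀ v₁ v₂ v₃ := by
  constructor <;> rintro ⟨c₀, c₁, c₂, c₃, rfl, rfl, rfl, rfl⟩ <;>
    exact ⟨c₀, c₁, -c₂, 2 * c₂ + c₃, rfl, rfl, by push_cast; ring, by push_cast; ring⟩

theorem latticeB_swap {v₀ v₁ v₂ v₃ : ℚ} : latticeB v₀ v₁ v₃ v₂ ↔ latticeB v₀ v₁ v₂ v₃ := by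
  constructor <;> rintro ⟨c₀, c₁, c₂, c₃, rfl, rfl, rfl, rfl⟩ <;>
    exact ⟨c₀, c₁, -c₂, 2 * c₂ + c₃, rfl, rfl, by push_cast; ring, by push_cast; ring⟩

theorem latticeC_swap {δ : ℤ} {v₀ v₁ v₂ v₃ : ℚ} :
    latticeC δ v₀ v₂ v₁ v₃ ↔ latticeC δ v₀ v₁ v₂ v₃ := by
  constructor <;> rintro ⟨V₀, V₁, V₂, V₃, e0, e1, e2, e3, h1, h2, h3⟩ <;>
    exact ⟨V₀, V₂, V₁, V₃, e0, e2, e1, e3, h2, h1, by omega⟩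

theorem latticeC_reverse {δ : ℤ} (hδ : δ = 1 ∨ δ = -1) {v₀ v₁ v₂ v₃ : ℚ} :
    latticeC δ v₀ v₃ v₂ v₁ ↔ latticeC δ v₀ v₁ v₂ v₃ := by
  constructor <;> rintro ⟨V₀, V₁, V₂, V₃, e0, e1, e2, e3, h1, h2, h3⟩ <;>
    exact ⟨V₀, V₃, V₂, V₁, e0, e3, e2, e1, by omega, by omega,
      by rcases hδ with rfl | rfl <;> omega⟩

theorem lattice_ext {Λ Λ' : ℚ → ℚ → ℚ → ℚ → Prop}
    (h : ∀ v₀ v₁ v₂ v₃, Λ v₀ v₁ v₂ v₃ ↔ Λ' v₀ v₁ v₂ v₃) : Λ = Λ' := by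
  ext v₀ v₁ v₂ v₃
  exact h v₀ v₁ v₂ v₃

namespace Frame

theorem isFree_latticeA (F : Frame σ τ a b c g g' sa sb sc)
    (hΛ : ∀ v₀ v₁ v₂ v₃, IsIntegral ℤ (point sa sb sc v₀ v₁ v₂ v₃) ↔ latticeA v₀ v₁ v₂ v₃)
    (hg : Squarefree g) (ha : a = g * g') (hcop : IsCoprime g g') (hmod : 4 ∣ g + g')
    (hodd : ¬ 2 ∣ g) :
    (IsFree (subgroupN σ τ) ↔ ∃ x y : ℤ, x ^ 2 + a * y ^ 2 = 4 * g ∨ x ^ 2 + a * y ^ 2 = -(4 * g)) ∧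
      ∀ x y : ℤ, (x ^ 2 + a * y ^ 2 = 4 * g ∨ x ^ 2 + a * y ^ 2 = -(4 * g)) →
        IsFreeGenerator (subgroupN σ τ) (point sa sb sc 1 1 (x / (2 * g)) (y / 2)) := by
  have hg0 : (g : ℚ) ≠ 0 := Int.cast_ne_zero.2 hg.ne_zero
  simp only [sq_add_mul_sq_eq_or_iff hg ha]
  have hgen : ∀ x y : ℤ, (∃ X, x = g * X ∧ (g * X ^ 2 + g' * y ^ 2 = 4 ∨
      g * X ^ 2 + g' * y ^ 2 = -4)) →
        IsFreeGenerator (subgroupN σ τ) (point sa sb sc 1 1 (x / (2 * g)) (y / 2)) := by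
    rintro x y ⟨X, rfl, hX⟩
    rw [F.isFreeGenerator_iff, lattice_ext hΛ,
      isLatticeGenerator_latticeA_iff hcop hmod hodd]
    exact ⟨Or.inl rfl, Or.inl rfl, X, y, by push_cast; field_simp, rfl, hX⟩
  refine ⟨⟨fun h => ?_, fun ⟨x, y, h⟩ => F.isFree_iff.2 ⟨_, hgen x y h⟩⟩, hgen⟩
  obtain ⟨v₀, v₁, v₂, v₃, G⟩ := F.isFree_iff_exists.1 h
  rw [lattice_ext hΛ, isLatticeGenerator_latticeA_iff hcop hmod hodd] at G
  obtain ⟨-, -, X, y, -, -, hX⟩ := G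
  exact ⟨g * X, y, X, rfl, hX⟩

theorem even_of_mul_sq_add {g f X y : ℤ} (hodd : ¬ 2 ∣ g)
    (h : g * X ^ 2 + 2 * f * y ^ 2 = 2 ∨ g * X ^ 2 + 2 * f * y ^ 2 = -2) : ∃ x, X = 2 * x := by
  obtain ⟨x, rfl | rfl⟩ := Int.even_or_odd' X
  · exact ⟨x, rfl⟩
  · obtain ⟨g₁, rfl⟩ : ∃ g₁, g = 2 * g₁ + 1 := ⟨g / 2, by omega⟩
    rcases h with h | h <;> ring_nf at h <;> omega

theorem isFree_latticeA_swap (F : Frame σ τ a b c g g' sa sb sc)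
    (hΛ : ∀ v₀ v₁ v₂ v₃, IsIntegral ℤ (point sa sb sc v₀ v₁ v₂ v₃) ↔ latticeA v₀ v₂ v₁ v₃)
    (hg : Squarefree g) (ha : a = g * g') (hcop : IsCoprime g g') (hmod : 2 ∣ g')
    (hodd : ¬ 2 ∣ g) :
    (IsFree (subgroupN σ τ) ↔ ∃ x y : ℤ, x ^ 2 + a * y ^ 2 = 2 * g ∨ x ^ 2 + a * y ^ 2 = -(2 * g)) ∧
      ∀ x y : ℤ, (x ^ 2 + a * y ^ 2 = 2 * g ∨ x ^ 2 + a * y ^ 2 = -(2 * g)) →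
        IsFreeGenerator (subgroupN σ τ) (point sa sb sc 1 (1 / 2) (x / (2 * g)) (y / 2)) := by
  have hg0 : (g : ℚ) ≠ 0 := Int.cast_ne_zero.2 hg.ne_zero
  simp only [sq_add_mul_sq_eq_or_iff hg ha]
  have hgen : ∀ x y : ℤ, (∃ X, x = g * X ∧ (g * X ^ 2 + g' * y ^ 2 = 2 ∨
      g * X ^ 2 + g' * y ^ 2 = -2)) →
        IsFreeGenerator (subgroupN σ τ) (point sa sb sc 1 (1 / 2) (x / (2 * g)) (y / 2)) := by
    rintro x y ⟨X, rfl, hX⟩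
    obtain ⟨x, rfl⟩ : ∃ x, X = 2 * x := by
      obtain ⟨f, rfl⟩ := hmod
      exact even_of_mul_sq_add hodd hX
    rw [F.isFreeGenerator_iff, lattice_ext hΛ,
      isLatticeGenerator_latticeA_swap_iff hcop hmod]
    refine ⟨Or.inl rfl, Or.inl (by norm_num), x, y, by push_cast; field_simp, rfl, ?_⟩
    rw [show 4 * g * x ^ 2 = g * (2 * x) ^ 2 by ring]
    exact hX
  refine ⟨⟨fun h => ?_, fun ⟨x, y, h⟩ => F.isFree_iff.2 ⟨_, hgen x y h⟩⟩, hgen⟩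
  obtain ⟨v₀, v₁, v₂, v₃, G⟩ := F.isFree_iff_exists.1 h
  rw [lattice_ext hΛ, isLatticeGenerator_latticeA_swap_iff hcop hmod] at G
  obtain ⟨-, -, X, y, -, -, hX⟩ := G
  refine ⟨g * (2 * X), y, 2 * X, rfl, ?_⟩
  rwa [show g * (2 * X) ^ 2 = 4 * g * X ^ 2 by ring]

theorem isFree_latticeA_reverse (F : Frame σ τ a b c g g' sa sb sc)
    (hΛ : ∀ v₀ v₁ v₂ v₃, IsIntegral ℤ (point sa sb sc v₀ v₁ v₂ v₃) ↔ latticeA v₀ v₃ v₂ v₁)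
    (hg : Squarefree g) (ha : a = g * g') (hcop : IsCoprime g g') (hmod : 2 ∣ g)
    (hodd : ¬ 2 ∣ g') :
    (IsFree (subgroupN σ τ) ↔ ∃ x y : ℤ, x ^ 2 + a * y ^ 2 = 2 * g ∨ x ^ 2 + a * y ^ 2 = -(2 * g)) ∧
      ∀ x y : ℤ, (x ^ 2 + a * y ^ 2 = 2 * g ∨ x ^ 2 + a * y ^ 2 = -(2 * g)) →
        IsFreeGenerator (subgroupN σ τ) (point sa sb sc 1 (1 / 2) (x / (2 * g)) (y / 2)) := by
  have hg0 : (g : ℚ) ≠ 0 := Int.cast_ne_zero.2 hg.ne_zero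
  simp only [sq_add_mul_sq_eq_or_iff hg ha]
  have hiff : ∀ v₀ v₁ v₂ v₃, IsLatticeGenerator
      (fun w₀ w₁ w₂ w₃ => IsIntegral ℤ (point sa sb sc w₀ w₁ w₂ w₃)) g g' v₀ v₁ v₂ v₃ ↔
      IsLatticeGenerator (fun w₀ w₁ w₂ w₃ => latticeA w₀ w₂ w₁ w₃) g' g v₀ v₁ v₃ v₂ := by
    intro v₀ v₁ v₂ v₃
    rw [lattice_ext hΛ, ← isLatticeGenerator_swap_iff,
      lattice_ext fun w₀ w₁ w₂ w₃ => latticeA_swap (v₀ := w₀) (v₁ := w₂) (v₂ := w₁)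
        (v₃ := w₃)]
  have hgen : ∀ x y : ℤ, (∃ X, x = g * X ∧ (g * X ^ 2 + g' * y ^ 2 = 2 ∨
      g * X ^ 2 + g' * y ^ 2 = -2)) →
        IsFreeGenerator (subgroupN σ τ) (point sa sb sc 1 (1 / 2) (x / (2 * g)) (y / 2)) := by
    rintro x y ⟨X, rfl, hX⟩
    rw [add_comm] at hX
    obtain ⟨y, rfl⟩ : ∃ x, y = 2 * x := by
      obtain ⟨f, rfl⟩ := hmod
      exact even_of_mul_sq_add hodd hX
    rw [F.isFreeGenerator_iff, hiff, isLatticeGenerator_latticeA_swap_iff hcop.symm hmod]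
    refine ⟨Or.inl rfl, Or.inl (by norm_num), y, X, by push_cast; ring,
      by push_cast; field_simp, ?_⟩
    rw [show 4 * g' * y ^ 2 = g' * (2 * y) ^ 2 by ring]
    exact hX
  refine ⟨⟨fun h => ?_, fun ⟨x, y, h⟩ => F.isFree_iff.2 ⟨_, hgen x y h⟩⟩, hgen⟩
  obtain ⟨v₀, v₁, v₂, v₃, G⟩ := F.isFree_iff_exists.1 h
  rw [hiff, isLatticeGenerator_latticeA_swap_iff hcop.symm hmod] at G
  obtain ⟨-, -, y, X, -, -, hX⟩ := G
  refine ⟨g * X, 2 * y, X, rfl, ?_⟩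
  rwa [show g' * (2 * y) ^ 2 = 4 * g' * y ^ 2 by ring, add_comm]

theorem isFree_latticeB (F : Frame σ τ a b c g g' sa sb sc)
    (hΛ : ∀ v₀ v₁ v₂ v₃, IsIntegral ℤ (point sa sb sc v₀ v₁ v₂ v₃) ↔ latticeB v₀ v₁ v₂ v₃)
    (hg : Squarefree g) (ha : a = g * g') (hcop : IsCoprime g g') (hmod : (g + g') % 4 = 2)
    (hodd : ¬ 2 ∣ g) :
    (IsFree (subgroupN σ τ) ↔ ∃ x y : ℤ, x ^ 2 + a * y ^ 2 = 2 * g ∨ x ^ 2 + a * y ^ 2 = -(2 * g)) ∧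
      ∀ x y : ℤ, (x ^ 2 + a * y ^ 2 = 2 * g ∨ x ^ 2 + a * y ^ 2 = -(2 * g)) →
        IsFreeGenerator (subgroupN σ τ)
          (point sa sb sc (1 / 2) (-1 / 2) (x / (2 * g)) (y / 2)) := by
  have hg0 : (g : ℚ) ≠ 0 := Int.cast_ne_zero.2 hg.ne_zero
  simp only [sq_add_mul_sq_eq_or_iff hg ha]
  have hgen : ∀ x y : ℤ, (∃ X, x = g * X ∧ (g * X ^ 2 + g' * y ^ 2 = 2 ∨
      g * X ^ 2 + g' * y ^ 2 = -2)) → IsFreeGenerator (subgroupN σ τ)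
          (point sa sb sc (1 / 2) (-1 / 2) (x / (2 * g)) (y / 2)) := by
    rintro x y ⟨X, rfl, hX⟩
    rw [F.isFreeGenerator_iff, lattice_ext hΛ,
      isLatticeGenerator_latticeB_iff hcop hmod hodd]
    exact ⟨Or.inl (by norm_num), Or.inr (by norm_num), X, y, by push_cast; field_simp, rfl, hX⟩
  refine ⟨⟨fun h => ?_, fun ⟨x, y, h⟩ => F.isFree_iff.2 ⟨_, hgen x y h⟩⟩, hgen⟩
  obtain ⟨v₀, v₁, v₂, v₃, G⟩ := F.isFree_iff_exists.1 h
  rw [lattice_ext hΛ, isLatticeGenerator_latticeB_iff hcop hmod hodd] at G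
  obtain ⟨-, -, X, y, -, -, hX⟩ := G
  exact ⟨g * X, y, X, rfl, hX⟩

theorem not_isFree_latticeB_swap (F : Frame σ τ a b c g g' sa sb sc)
    (hΛ : ∀ v₀ v₁ v₂ v₃, IsIntegral ℤ (point sa sb sc v₀ v₁ v₂ v₃) ↔ latticeB v₀ v₂ v₁ v₃)
    (hcop : IsCoprime g g') : ¬ IsFree (subgroupN σ τ) := by
  intro h
  obtain ⟨v₀, v₁, v₂, v₃, G⟩ := F.isFree_iff_exists.1 h
  rw [lattice_ext hΛ] at G
  exact not_isLatticeGenerator_latticeB_swap hcop G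

theorem not_isFree_latticeB_reverse (F : Frame σ τ a b c g g' sa sb sc)
    (hΛ : ∀ v₀ v₁ v₂ v₃, IsIntegral ℤ (point sa sb sc v₀ v₁ v₂ v₃) ↔ latticeB v₀ v₃ v₂ v₁)
    (hcop : IsCoprime g g') : ¬ IsFree (subgroupN σ τ) := by
  intro h
  obtain ⟨v₀, v₁, v₂, v₃, G⟩ := F.isFree_iff_exists.1 h
  rw [lattice_ext hΛ, ← isLatticeGenerator_swap_iff,
    lattice_ext fun w₀ w₁ w₂ w₃ => latticeB_swap (v₀ := w₀) (v₁ := w₂) (v₂ := w₁)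
      (v₃ := w₃)] at G
  exact not_isLatticeGenerator_latticeB_swap hcop.symm G

theorem odd_of_mul_sq_add {δ X y : ℤ} (hδ : δ = 1 ∨ δ = -1) (hg : 4 ∣ g - δ) (hg' : 4 ∣ g' - δ)
    (h : g * X ^ 2 + g' * y ^ 2 = 2 ∨ g * X ^ 2 + g' * y ^ 2 = -2) :
    (∃ x, X = 2 * x + 1) ∧ ∃ z, y = 2 * z + 1 := by
  obtain ⟨i, hi⟩ := hg
  obtain ⟨j, hj⟩ := hg'
  obtain rfl : g = δ + 4 * i := by omega
  obtain rfl : g' = δ + 4 * j := by omega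
  obtain ⟨x, rfl | rfl⟩ := Int.even_or_odd' X <;> obtain ⟨z, rfl | rfl⟩ := Int.even_or_odd' y
  · rcases hδ with rfl | rfl <;> rcases h with h | h <;> ring_nf at h <;> omega
  · rcases hδ with rfl | rfl <;> rcases h with h | h <;> ring_nf at h <;> omega
  · rcases hδ with rfl | rfl <;> rcases h with h | h <;> ring_nf at h <;> omega
  · exact ⟨⟨x, rfl⟩, z, rfl⟩

/-- The coordinates `v₁, v₂, v₃` of a generator are given by `x` and `y`, and `V₀ = 4 v₀` is that
one of `1`, `-1` for which the generator is an integer. -/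
theorem isFree_latticeC (F : Frame σ τ a b c g g' sa sb sc) {δ : ℤ} (hδ : δ = 1 ∨ δ = -1)
    (hΛ : ∀ v₀ v₁ v₂ v₃, IsIntegral ℤ (point sa sb sc v₀ v₁ v₂ v₃) ↔ latticeC δ v₀ v₁ v₂ v₃)
    (hg : Squarefree g) (ha : a = g * g') (hcop : IsCoprime g g') (hg4 : 4 ∣ g - δ)
    (hg4' : 4 ∣ g' - δ) :
    (IsFree (subgroupN σ τ) ↔ ∃ x y : ℤ, x ^ 2 + a * y ^ 2 = 2 * g ∨ x ^ 2 + a * y ^ 2 = -(2 * g)) ∧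
      ∀ x y : ℤ, (x ^ 2 + a * y ^ 2 = 2 * g ∨ x ^ 2 + a * y ^ 2 = -(2 * g)) →
        ∃ X x₁ y₁, x = g * X ∧ X = 2 * x₁ + 1 ∧ y = 2 * y₁ + 1 ∧
          ∀ V₀ : ℤ, (V₀ = 1 ∨ V₀ = -1) → 4 ∣ V₀ - 1 - X + δ * y →
            IsFreeGenerator (subgroupN σ τ)
              (point sa sb sc (V₀ / 4) (1 / 4) (x / (4 * g)) (y / 4)) := by
  have hg0 : (g : ℚ) ≠ 0 := Int.cast_ne_zero.2 hg.ne_zero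
  simp only [sq_add_mul_sq_eq_or_iff hg ha]
  have hgen : ∀ x y : ℤ, (∃ X, x = g * X ∧ (g * X ^ 2 + g' * y ^ 2 = 2 ∨
      g * X ^ 2 + g' * y ^ 2 = -2)) →
        ∃ X x₁ y₁, x = g * X ∧ X = 2 * x₁ + 1 ∧ y = 2 * y₁ + 1 ∧
          ∀ V₀ : ℤ, (V₀ = 1 ∨ V₀ = -1) → 4 ∣ V₀ - 1 - X + δ * y →
            IsFreeGenerator (subgroupN σ τ)
              (point sa sb sc (V₀ / 4) (1 / 4) (x / (4 * g)) (y / 4)) := by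
    rintro x y ⟨X, rfl, hX⟩
    obtain ⟨⟨x₁, hx₁⟩, y₁, hy₁⟩ := odd_of_mul_sq_add hδ hg4 hg4' hX
    refine ⟨X, x₁, y₁, rfl, hx₁, hy₁, fun V₀ hV₀ hdvd => ?_⟩
    have hv₂ : ((g * X : ℤ) : ℚ) / (4 * g) = X / 4 := by push_cast; field_simp
    rw [F.isFreeGenerator_iff, lattice_ext hΛ,
      isLatticeGenerator_latticeC_iff hcop hδ hg4 hg4', hv₂]
    refine ⟨⟨V₀, 1, X, y, rfl, by norm_num, rfl, rfl, by omega, by omega, hdvd⟩, ?_,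
      Or.inl (by norm_num), X, y, rfl, rfl, hX⟩
    rcases hV₀ with rfl | rfl
    · exact Or.inl (by norm_num)
    · exact Or.inr (by norm_num)
  refine ⟨⟨fun h => ?_, fun ⟨x, y, h⟩ => ?_⟩, hgen⟩
  · obtain ⟨v₀, v₁, v₂, v₃, G⟩ := F.isFree_iff_exists.1 h
    rw [lattice_ext hΛ, isLatticeGenerator_latticeC_iff hcop hδ hg4 hg4'] at G
    obtain ⟨-, -, -, X, y, -, -, hX⟩ := G
    exact ⟨g * X, y, X, rfl, hX⟩
  · obtain ⟨X, x₁, y₁, -, rfl, rfl, hgen'⟩ := hgen x y h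
    by_cases h4 : 4 ∣ (1 : ℤ) - 1 - (2 * x₁ + 1) + δ * (2 * y₁ + 1)
    · exact F.isFree_iff.2 ⟨_, hgen' 1 (Or.inl rfl) h4⟩
    · refine F.isFree_iff.2 ⟨_, hgen' (-1) (Or.inr rfl) ?_⟩
      rcases hδ with rfl | rfl <;> omega

end Frame

end Free

/-! ### The three frames of a biquadratic field -/

section Biquadratic

theorem point_swap {L : Type*} [Field L] (sa sb sc : L) (v₀ v₁ v₂ v₃ : ℚ) :
    point sb sa sc v₀ v₁ v₂ v₃ = point sa sb sc v₀ v₂ v₁ v₃ := by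
  simp only [point]; ring

theorem point_reverse {L : Type*} [Field L] (sa sb sc : L) (v₀ v₁ v₂ v₃ : ℚ) :
    point sc sb sa v₀ v₁ v₂ v₃ = point sa sb sc v₀ v₃ v₂ v₁ := by
  simp only [point]; ring

variable {L : Type*} [Field L] [NumberField L] {σ τ : Gal(L/ℚ)} {m n k d m' n' : ℤ} {sm sn sk : L}

theorem comb_basisA (b : Fin 4 → ℚ) : comb (basisA sm sn sk) b =
    point sm sn sk (b 0) (b 1) (b 2 + b 3 / 2) (b 3 / 2) := by
  simp only [comb, basisA, point, Fin.sum_univ_four, Algebra.smul_def, eq_ratCast,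
    Matrix.cons_val]
  push_cast
  ring

theorem comb_basisB (b : Fin 4 → ℚ) : comb (basisB sm sn sk) b =
    point sm sn sk (b 0 + b 1 / 2) (b 1 / 2) (b 2 + b 3 / 2) (b 3 / 2) := by
  simp only [comb, basisB, point, Fin.sum_univ_four, Algebra.smul_def, eq_ratCast,
    Matrix.cons_val]
  push_cast
  ring

theorem comb_basisC (h : sm * sk = m' * sn) (b : Fin 4 → ℚ) : comb (basisC sm sn sk) b =
    point sm sn sk (b 0 + b 1 / 2 + b 2 / 2 + b 3 / 4) (b 1 / 2 + b 3 / 4)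
      (b 2 / 2 + m' * b 3 / 4) (b 3 / 4) := by
  simp only [comb, basisC, point, Fin.sum_univ_four, Algebra.smul_def, eq_ratCast,
    Matrix.cons_val]
  push_cast
  linear_combination (b 3 / 4 : L) * h

/-- Independence of `1, √m, √n, √k`, by the orthogonality of the characters of the Galois group. -/
theorem point_eq_zero (hm : sm ≠ 0) (hn : sn ≠ 0) (hk : sk ≠ 0) (hσm : σ sm = -sm)
    (hσn : σ sn = sn) (hσk : σ sk = -sk) (hτm : τ sm = sm) (hτn : τ sn = -sn) (hτk : τ sk = -sk)
    (v₀ v₁ v₂ v₃ : ℚ) (h : point sm sn sk v₀ v₁ v₂ v₃ = 0) :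
    v₀ = 0 ∧ v₁ = 0 ∧ v₂ = 0 ∧ v₃ = 0 := by
  have h1 := congrArg σ h
  have h2 := congrArg τ h
  have h3 := congrArg σ h2
  simp only [point, map_add, map_mul, map_ratCast, map_neg, map_zero, hσm, hσn, hσk, hτm, hτn, hτk]
    at h h1 h2 h3
  have e (x : ℚ) {y : L} (hy : y ≠ 0) (h : 4 * ((x : L) * y) = 0) : x = 0 := by
    simpa [hy] using h
  refine ⟨e v₀ one_ne_zero ?_, e v₁ hm ?_, e v₂ hn ?_, e v₃ hk ?_⟩
  · linear_combination h + h1 + h2 + h3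
  · linear_combination h - h1 + h2 - h3
  · linear_combination h + h1 - h2 - h3
  · linear_combination h - h1 - h2 + h3

theorem exists_eq_point (hdeg : Module.finrank ℚ L = 4)
    (h : ∀ v₀ v₁ v₂ v₃ : ℚ, point sm sn sk v₀ v₁ v₂ v₃ = 0 → v₀ = 0 ∧ v₁ = 0 ∧ v₂ = 0 ∧ v₃ = 0)
    (x : L) : ∃ v₀ v₁ v₂ v₃ : ℚ, x = point sm sn sk v₀ v₁ v₂ v₃ := by
  have e (v : Fin 4 → ℚ) :
      ∑ i, v i • ![1, sm, sn, sk] i = point sm sn sk (v 0) (v 1) (v 2) (v 3) := by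
    simp [point, Fin.sum_univ_four, Algebra.smul_def]
  have hli : LinearIndependent ℚ ![1, sm, sn, sk] := by
    refine Fintype.linearIndependent_iff.2 fun v hv i => ?_
    rw [e] at hv
    obtain ⟨h0, h1, h2, h3⟩ := h _ _ _ _ hv
    fin_cases i <;> assumption
  have hspan := hli.span_eq_top_of_card_eq_finrank (by simp [hdeg])
  obtain ⟨v, hv⟩ := (Submodule.mem_span_range_iff_exists_fun ℚ).1
    (hspan ▸ Submodule.mem_top : x ∈ Submodule.span ℚ (Set.range ![1, sm, sn, sk]))
  exact ⟨_, _, _, _, hv.symm.trans (e v)⟩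

/-- The field seen from `ℚ(√m)`; the relations `√m √n = d √k` and `√m √k = (m / d) √n` give `g = d`
and `g' = m / d`. -/
theorem frame_of_biquadratic (hd0 : d ≠ 0) (hm0 : m ≠ 0) (hn0 : n ≠ 0) (hm' : m = d * m')
    (hn' : n = d * n') (hk : k = m' * n')
    (hsm : sm ^ 2 = m) (hsn : sn ^ 2 = n) (hsk : sm * sn = d * sk)
    (hdeg : Module.finrank ℚ L = 4)
    (hσm : σ sm = -sm) (hσn : σ sn = sn) (hτm : τ sm = sm) (hτn : τ sn = -sn) :
    Frame σ τ m n k d m' sm sn sk := by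
  have hd : (d : L) ≠ 0 := by exact_mod_cast hd0
  have hm : sm ≠ 0 := by
    rintro rfl
    exact hm0 (by exact_mod_cast (by simpa using hsm.symm : (m : L) = 0))
  have hn : sn ≠ 0 := by
    rintro rfl
    exact hn0 (by exact_mod_cast (by simpa using hsn.symm : (n : L) = 0))
  have hk0 : sk ≠ 0 := by
    rintro rfl
    simp [hm, hn] at hsk
  have hdk (g : Gal(L/ℚ)) : d * g sk = g sm * g sn := by
    rw [← map_mul, hsk, map_mul, map_intCast]
  have hσk : σ sk = -sk := mul_left_cancel₀ hd (by
    rw [hdk, hσm, hσn]; linear_combination -hsk)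
  have hτk : τ sk = -sk := mul_left_cancel₀ hd (by
    rw [hdk, hτm, hτn]; linear_combination -hsk)
  have hmL : (m : L) = d * m' := by exact_mod_cast congrArg (Int.cast (R := L)) hm'
  have hnL : (n : L) = d * n' := by exact_mod_cast congrArg (Int.cast (R := L)) hn'
  have hkL : (k : L) = m' * n' := by exact_mod_cast congrArg (Int.cast (R := L)) hk
  have indep := point_eq_zero hm hn hk0 hσm hσn hσk hτm hτn hτk
  have span := exists_eq_point hdeg indep
  -- an automorphism is determined by its values at `sm` and `sn`
  have hext (g g' : Gal(L/ℚ)) (h1 : g sm = g' sm) (h2 : g sn = g' sn) : g = g' := by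
    have h3 : g sk = g' sk := mul_left_cancel₀ hd (by rw [hdk, hdk, h1, h2])
    ext x
    obtain ⟨v₀, v₁, v₂, v₃, rfl⟩ := span x
    simp [point, h1, h2, h3]
  have hneg {s : L} {g : Gal(L/ℚ)} {a : ℤ} (h : s ^ 2 = a) : g s = s ∨ g s = -s := by
    rw [← sq_eq_sq_iff_eq_or_eq_neg, ← map_pow, h, map_intCast]
  have hm2 : -sm ≠ sm := by simpa [neg_eq_iff_add_eq_zero, ← two_mul] using hm
  have hn2 : -sn ≠ sn := by simpa [neg_eq_iff_add_eq_zero, ← two_mul] using hn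
  refine ⟨⟨?_, ?_, ?_, ?_, ?_, fun g => ?_⟩, hsm, hsn, ?_, hsk, ?_, hσm, hσn, hτm, hτn, hd0, span,
    indep⟩
  · exact hext _ _ (by simp [hσm]) (by simp [hσn])
  · exact hext _ _ (by simp [hτm]) (by simp [hτn])
  · rintro rfl
    exact hm2 (by simpa using hσm.symm)
  · rintro rfl
    exact hn2 (by simpa using hτn.symm)
  · rintro rfl
    exact hm2 (hσm.symm.trans hτm)
  · rcases hneg (g := g) hsm with h1 | h1 <;> rcases hneg (g := g) hsn with h2 | h2
    · exact .inl (hext _ _ (by simp [h1]) (by simp [h2]))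
    · exact .inr (.inr (.inl (hext _ _ (by rw [h1, hτm]) (by rw [h2, hτn]))))
    · exact .inr (.inl (hext _ _ (by rw [h1, hσm]) (by rw [h2, hσn])))
    · exact .inr (.inr (.inr (hext _ _ (by simp [h1, hσm, hτm]) (by simp [h2, hσn, hτn]))))
  · refine mul_left_cancel₀ (mul_ne_zero hd hd) ?_
    calc (d * d * sk ^ 2 : L) = (sm * sn) ^ 2 := by rw [hsk]; ring
      _ = d * d * k := by rw [mul_pow, hsm, hsn, hmL, hnL, hkL]; ring
  · refine mul_left_cancel₀ hd ?_
    calc (d * (sm * sk) : L) = sm ^ 2 * sn := by linear_combination -sm * hsk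
      _ = d * (m' * sn) := by rw [hsm, hmL]; ring

namespace Frame

/-- The field seen from `ℚ(√n)`: the roles of `√m` and `√n`, and of `σ` and `τ`, are exchanged. -/
theorem swap (F : Frame σ τ m n k d m' sm sn sk) (hn : n = d * n') :
    Frame τ σ n m k d n' sn sm sk where
  klein := F.klein.swap
  sq_a := F.sq_b
  sq_b := F.sq_a
  sq_c := F.sq_c
  mul_ab := by rw [mul_comm, F.mul_ab]
  mul_ac := F.mul_bc hn
  sigma_a := F.tau_b
  sigma_b := F.tau_a
  tau_a := F.sigma_b
  tau_b := F.sigma_a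
  g_ne := F.g_ne
  span x := by
    obtain ⟨v₀, v₁, v₂, v₃, h⟩ := F.span x
    exact ⟨v₀, v₂, v₁, v₃, by rw [point_swap, h]⟩
  indep v₀ v₁ v₂ v₃ h := by
    rw [point_swap] at h
    obtain ⟨h0, h1, h2, h3⟩ := F.indep _ _ _ _ h
    exact ⟨h0, h2, h1, h3⟩

/-- The field seen from `ℚ(√k)`, which `στ` fixes: the roles of `√m` and `√k` are exchanged. -/
theorem reverse (F : Frame σ τ m n k d m' sm sn sk) (hn : n = d * n') (hn0 : n' ≠ 0) :
    Frame σ (σ * τ) k n m n' m' sk sn sm where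
  klein := F.klein.mul_right
  sq_a := F.sq_c
  sq_b := F.sq_b
  sq_c := F.sq_a
  mul_ab := by rw [mul_comm, F.mul_bc hn]
  mul_ac := by rw [mul_comm, F.mul_ac]
  sigma_a := F.sigma_c
  sigma_b := F.sigma_b
  tau_a := by simp [F.tau_c, F.sigma_c]
  tau_b := by simp [F.tau_b, F.sigma_b]
  g_ne := hn0
  span x := by
    obtain ⟨v₀, v₁, v₂, v₃, h⟩ := F.span x
    exact ⟨v₀, v₃, v₂, v₁, by rw [point_reverse, h]⟩
  indep v₀ v₁ v₂ v₃ h := by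
    rw [point_reverse] at h
    obtain ⟨h0, h1, h2, h3⟩ := F.indep _ _ _ _ h
    exact ⟨h0, h3, h2, h1⟩

end Frame

/-- For square-free `m` and `n` with greatest common divisor `d`, the integers `d`, `m / d`, `n / d`
are pairwise coprime and square-free. -/
theorem exists_coprime_factors (hm : Squarefree m) (hn : Squarefree n) (hd : d = Int.gcd m n)
    (hk : k = m * n / d ^ 2) : ∃ m' n' : ℤ, m = d * m' ∧ n = d * n' ∧ k = m' * n' ∧ n / d = n' ∧
      Squarefree d ∧ Squarefree n' ∧ Squarefree k ∧
      IsCoprime d m' ∧ IsCoprime d n' ∧ IsCoprime n' m' := by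
  have hd0 : d ≠ 0 := by
    rw [hd]
    exact_mod_cast fun h => hm.ne_zero (Int.gcd_eq_zero_iff.1 h).1
  obtain ⟨m', hm'⟩ : d ∣ m := hd ▸ Int.gcd_dvd_left ..
  obtain ⟨n', hn'⟩ : d ∣ n := hd ▸ Int.gcd_dvd_right ..
  have hcop : IsCoprime m' n' := by
    refine ⟨m.gcdA n, m.gcdB n, mul_left_cancel₀ hd0 ?_⟩
    have h := Int.gcd_eq_gcd_ab m n
    rw [← hd] at h
    rw [hm', hn'] at h ⊢
    linarith
  have hm2 := squarefree_mul_iff.1 (hm' ▸ hm)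
  have hn2 := squarefree_mul_iff.1 (hn' ▸ hn)
  have hk' : k = m' * n' := by
    rw [hk, hm', hn', show d * m' * (d * n') = d ^ 2 * (m' * n') by ring]
    exact Int.mul_ediv_cancel_left _ (pow_ne_zero 2 hd0)
  refine ⟨m', n', hm', hn', hk', ?_, hm2.2.1, hn2.2.2, ?_, hm2.1.isCoprime, hn2.1.isCoprime,
    hcop.symm⟩
  · rw [hn']
    exact Int.mul_ediv_cancel_left _ hd0
  · rw [hk']
    exact squarefree_mul_iff.2 ⟨hcop.isRelPrime, hm2.2.2, hn2.2.2⟩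

end Biquadratic

/-- If `g f ≡ 1` modulo 4, then `g` and `f` are both congruent to `1` or both to `-1`. -/
theorem exists_sign_of_mul_emod {g f : ℤ} (h : g * f % 4 = 1) :
    ∃ δ : ℤ, (δ = 1 ∨ δ = -1) ∧ 4 ∣ g - δ ∧ 4 ∣ f - δ := by
  rw [Int.mul_emod] at h
  have h1 : g % 4 = 0 ∨ g % 4 = 1 ∨ g % 4 = 2 ∨ g % 4 = 3 := by omega
  rcases h1 with h1 | h1 | h1 | h1 <;> rw [h1] at h
  · omega
  · exact ⟨1, .inl rfl, by omega, by omega⟩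
  · omega
  · exact ⟨-1, .inr rfl, by omega, by omega⟩

theorem four_dvd_add_of_mul_emod {g f : ℤ} (h : g * f % 4 = 3) :
    ¬ 2 ∣ g ∧ ¬ 2 ∣ f ∧ 4 ∣ g + f := by
  obtain ⟨δ, hδ, h1, h2⟩ := exists_sign_of_mul_emod (g := g) (f := -f) (by rw [mul_neg]; omega)
  omega

end HopfGalois

end

theorem mainTheorem2 {L : Type*} [Field L] [NumberField L] (m n d k : ℤ)
    (hm : Squarefree m) (hn : Squarefree n) (hd : d = Int.gcd m n) (hk : k = m * n / d ^ 2)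
    (sm sn sk : L) (hsm : sm ^ 2 = m) (hsn : sn ^ 2 = n) (hsk : sm * sn = d * sk)
    (hL : IntermediateField.adjoin ℚ {sm, sn} = ⊤) (hdeg : Module.finrank ℚ L = 4)
    (σ τ : Gal(L/ℚ)) (hσm : σ sm = -sm) (hσn : σ sn = sn) (hτm : τ sm = sm) (hτn : τ sn = -sn)
    (N₁ N₂ N₃ : Subgroup (Equiv.Perm Gal(L/ℚ)))
    (hN₁ : N₁ = HopfGalois.subgroupN σ τ)
    (hN₂ : N₂ = HopfGalois.subgroupN τ σ)
    (hN₃ : N₃ = HopfGalois.subgroupN σ (σ * τ)) :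
    -- the non-classical Hopf-Galois structures are the three given by `N₁`, `N₂`, `N₃`, of type `C₄`
    ({N | HopfGalois.IsGreitherPareigis N ∧ N ≠ (HopfGalois.leftReg ℚ L).range} = {N₁, N₂, N₃} ∧
      N₁ ≠ N₂ ∧ N₁ ≠ N₃ ∧ N₂ ≠ N₃ ∧
      ∀ N ∈ ({N₁, N₂, N₃} : Set (Subgroup (Equiv.Perm Gal(L/ℚ)))), IsCyclic N ∧ Nat.card N = 4) ∧
    -- first case
    (m % 4 = 3 → n % 4 = 2 →
      ((HopfGalois.IsFree N₁ ↔
          ∃ x y : ℤ, x ^ 2 + m * y ^ 2 = 4 * d ∨ x ^ 2 + m * y ^ 2 = -(4 * d)) ∧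
        ∀ x y : ℤ, (x ^ 2 + m * y ^ 2 = 4 * d ∨ x ^ 2 + m * y ^ 2 = -(4 * d)) →
          HopfGalois.IsFreeGenerator N₁ (HopfGalois.comb (HopfGalois.basisA sm sn sk)
            ![1, 1, (x - d * y) / (2 * d), y])) ∧
      ((HopfGalois.IsFree N₂ ↔
          ∃ x y : ℤ, x ^ 2 + n * y ^ 2 = 2 * d ∨ x ^ 2 + n * y ^ 2 = -(2 * d)) ∧
        ∀ x y : ℤ, (x ^ 2 + n * y ^ 2 = 2 * d ∨ x ^ 2 + n * y ^ 2 = -(2 * d)) →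
          HopfGalois.IsFreeGenerator N₂ (HopfGalois.comb (HopfGalois.basisA sm sn sk)
            ![1, x / (2 * d), (1 - y) / 2, y])) ∧
      ((HopfGalois.IsFree N₃ ↔
          ∃ x y : ℤ, x ^ 2 + k * y ^ 2 = 2 * (n / d) ∨ x ^ 2 + k * y ^ 2 = -(2 * (n / d))) ∧
        ∀ x y : ℤ, (x ^ 2 + k * y ^ 2 = 2 * (n / d) ∨ x ^ 2 + k * y ^ 2 = -(2 * (n / d))) →
          HopfGalois.IsFreeGenerator N₃ (HopfGalois.comb (HopfGalois.basisA sm sn sk)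
            ![1, y / 2, (x * d - n) / (2 * n), 1]))) ∧
    -- second case
    (m % 4 = 1 → n % 4 ≠ 1 →
      ((HopfGalois.IsFree N₁ ↔
          ∃ x y : ℤ, x ^ 2 + m * y ^ 2 = 2 * d ∨ x ^ 2 + m * y ^ 2 = -(2 * d)) ∧
        ∀ x y : ℤ, (x ^ 2 + m * y ^ 2 = 2 * d ∨ x ^ 2 + m * y ^ 2 = -(2 * d)) →
          HopfGalois.IsFreeGenerator N₁ (HopfGalois.comb (HopfGalois.basisB sm sn sk)
            ![1, -1, (x - d * y) / (2 * d), y])) ∧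
      ¬ HopfGalois.IsFree N₂ ∧
      ¬ HopfGalois.IsFree N₃) ∧
    -- third case; the integer divisions in the parities are exact
    (m % 4 = 1 → n % 4 = 1 →
      ((HopfGalois.IsFree N₁ ↔
          ∃ x y : ℤ, x ^ 2 + m * y ^ 2 = 2 * d ∨ x ^ 2 + m * y ^ 2 = -(2 * d)) ∧
        ∀ x y ε : ℤ, (x ^ 2 + m * y ^ 2 = 2 * d ∨ x ^ 2 + m * y ^ 2 = -(2 * d)) →
          ε = (x - m * y) / (2 * d) % 2 →
          HopfGalois.IsFreeGenerator N₁ (HopfGalois.comb (HopfGalois.basisC sm sn sk)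
            ![((m * y - x) / (2 * d) - ε) / 2, (1 - y) / 2, (x - m * y) / (2 * d), y])) ∧
      ((HopfGalois.IsFree N₂ ↔
          ∃ x y : ℤ, x ^ 2 + n * y ^ 2 = 2 * d ∨ x ^ 2 + n * y ^ 2 = -(2 * d)) ∧
        ∀ x y ε : ℤ, (x ^ 2 + n * y ^ 2 = 2 * d ∨ x ^ 2 + n * y ^ 2 = -(2 * d)) →
          ε = (m * y - x) / d % 4 →
          HopfGalois.IsFreeGenerator N₂ (HopfGalois.comb (HopfGalois.basisC sm sn sk)
            ![((m * y - x) / d - ε) / 4, (x - y * d) / (2 * d), (d - m * y) / (2 * d), y])) ∧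
      ((HopfGalois.IsFree N₃ ↔
          ∃ x y : ℤ, x ^ 2 + k * y ^ 2 = 2 * (n / d) ∨ x ^ 2 + k * y ^ 2 = -(2 * (n / d))) ∧
        ∀ x y ε : ℤ, (x ^ 2 + k * y ^ 2 = 2 * (n / d) ∨ x ^ 2 + k * y ^ 2 = -(2 * (n / d))) →
          ε = ((k - x) / (n / d) - y) % 4 - 2 →
          HopfGalois.IsFreeGenerator N₃ (HopfGalois.comb (HopfGalois.basisC sm sn sk)
            ![((k - x) / (n / d) - y + ε) / 4, (y - 1) / 2, (x - k) / (2 * (n / d)), 1]))) := by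
  subst hN₁ hN₂ hN₃
  obtain ⟨m', n', hm', hn', hk', hnd, hd2, hn'2, hk2, hdm, hdn, hnm⟩ :=
    HopfGalois.exists_coprime_factors hm hn hd hk
  have F := HopfGalois.frame_of_biquadratic hd2.ne_zero hm.ne_zero hn.ne_zero hm' hn' hk' hsm
    hsn hsk hdeg hσm hσn hτm hτn
  have F₂ := F.swap hn'
  have F₃ := F.reverse hn' hn'2.ne_zero
  have hkn : k = n' * m' := hk'.trans (mul_comm _ _)
  have hd0 : (d : ℚ) ≠ 0 := by exact_mod_cast hd2.ne_zero
  have hn0 : (n' : ℚ) ≠ 0 := by exact_mod_cast hn'2.ne_zero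
  have hmQ : (m : ℚ) = d * m' := by exact_mod_cast hm'
  have hnQ : (n : ℚ) = d * n' := by exact_mod_cast hn'
  have hkQ : (k : ℚ) = n' * m' := by exact_mod_cast hkn
  have hndQ : (n : ℚ) / d = n' := by rw [hnQ]; field_simp
  rw [hnd]
  refine ⟨HopfGalois.nonclassical_isGreitherPareigis F.klein, fun hm4 hn4 => ?_,
    fun hm4 hn4 => ?_, fun hm4 hn4 => ?_⟩
  · have hΛ := F.isIntegral_point_iff_latticeA hm hn hk2 hm' hn' hk' hm4 hn4
    obtain ⟨hodd, hodd', h4⟩ := HopfGalois.four_dvd_add_of_mul_emod (hm' ▸ hm4)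
    have heven : 2 ∣ n' := by
      refine (Int.prime_two.dvd_mul.1 (?_ : 2 ∣ d * n')).resolve_left hodd
      rw [← hn']
      omega
    obtain ⟨h1, h1'⟩ := F.isFree_latticeA hΛ hd2 hm' hdm h4 hodd
    obtain ⟨h2, h2'⟩ := F₂.isFree_latticeA_swap
      (fun v₀ v₁ v₂ v₃ => by rw [HopfGalois.point_swap]; exact hΛ v₀ v₂ v₁ v₃) hd2 hn' hdn heven
      hodd
    obtain ⟨h3, h3'⟩ := F₃.isFree_latticeA_reverse
      (fun v₀ v₁ v₂ v₃ => by rw [HopfGalois.point_reverse]; exact hΛ v₀ v₃ v₂ v₁) hn'2 hkn hnm heven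
      hodd'
    refine ⟨⟨h1, fun x y h => ?_⟩, ⟨h2, fun x y h => ?_⟩, ⟨h3, fun x y h => ?_⟩⟩
    · convert h1' x y h using 1
      simp only [HopfGalois.comb_basisA, Matrix.cons_val]
      congr 1
      field_simp
      ring
    · convert h2' x y h using 1
      simp only [HopfGalois.comb_basisA, HopfGalois.point_swap sm sn, Matrix.cons_val]
      congr 1
      ring
    · convert h3' x y h using 1
      simp only [HopfGalois.comb_basisA, HopfGalois.point_reverse sm sn, Matrix.cons_val]
      congr 1
      rw [hnQ]
      field_simp
      ring
  · have hn4' : n % 4 = 2 ∨ n % 4 = 3 := by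
      have : ¬ (2 * 2 : ℤ) ∣ n := fun h => Int.prime_two.not_isUnit (hn 2 h)
      omega
    have hΛ := F.isIntegral_point_iff_latticeB hm hn hk2 hm' hn' hk' hm4 hn4'
    obtain ⟨δ, hδ, h1, h2⟩ := HopfGalois.exists_sign_of_mul_emod (hm' ▸ hm4)
    obtain ⟨h1, h1'⟩ := F.isFree_latticeB hΛ hd2 hm' hdm (by omega) (by omega)
    refine ⟨⟨h1, fun x y h => ?_⟩,
      F₂.not_isFree_latticeB_swap
        (fun v₀ v₁ v₂ v₃ => by rw [HopfGalois.point_swap]; exact hΛ v₀ v₂ v₁ v₃) hdn,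
      F₃.not_isFree_latticeB_reverse
        (fun v₀ v₁ v₂ v₃ => by rw [HopfGalois.point_reverse]; exact hΛ v₀ v₃ v₂ v₁) hnm⟩
    convert h1' x y h using 1
    simp only [HopfGalois.comb_basisB, Matrix.cons_val]
    congr 1
    · norm_num
    · field_simp
      ring
  · obtain ⟨δ, hδ, hdδ, hmδ⟩ := HopfGalois.exists_sign_of_mul_emod (hm' ▸ hm4)
    obtain ⟨δ', hδ', hdδ', hnδ⟩ := HopfGalois.exists_sign_of_mul_emod (hn' ▸ hn4)
    -- both signs are determined by `d`
    obtain rfl : δ = δ' := by omega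
    obtain ⟨j, hj⟩ := hmδ
    obtain ⟨i, hi⟩ := hnδ
    obtain rfl : m' = δ + 4 * j := by omega
    have hk4 : k % 4 = 1 := by
      rw [hk', Int.mul_emod]
      rcases hδ with rfl | rfl
      · rw [show (1 + 4 * j) % 4 = 1 by omega, show n' % 4 = 1 by omega]; rfl
      · rw [show (-1 + 4 * j) % 4 = 3 by omega, show n' % 4 = 3 by omega]; rfl
    have hΛ := F.isIntegral_point_iff_latticeC hm hn hk2 hn' hδ hdδ ⟨i, hi⟩ hm4 hn4 hk4
    obtain ⟨h1, h1'⟩ := F.isFree_latticeC hδ hΛ hd2 hm' hdm hdδ ⟨j, hj⟩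
    obtain ⟨h2, h2'⟩ := F₂.isFree_latticeC hδ
      (fun v₀ v₁ v₂ v₃ => by
        rw [HopfGalois.point_swap, ← HopfGalois.latticeC_swap]; exact hΛ v₀ v₂ v₁ v₃)
      hd2 hn' hdn hdδ ⟨i, hi⟩
    obtain ⟨h3, h3'⟩ := F₃.isFree_latticeC hδ
      (fun v₀ v₁ v₂ v₃ => by
        rw [HopfGalois.point_reverse, ← HopfGalois.latticeC_reverse hδ]; exact hΛ v₀ v₃ v₂ v₁)
      hn'2 hkn hnm ⟨i, hi⟩ ⟨j, hj⟩
    refine ⟨⟨h1, fun x y ε h hε => ?_⟩, ⟨h2, fun x y ε h hε => ?_⟩, ⟨h3, fun x y ε h hε => ?_⟩⟩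
    · obtain ⟨X, x₁, y₁, rfl, hX, hy, hgen⟩ := h1' x y h
      -- the integer division is exact, since `X` and `y` are odd
      obtain ⟨t, ht⟩ : ∃ t, X - (δ + 4 * j) * y = 2 * t := by
        rw [add_mul, mul_assoc]
        generalize j * y = z
        exact ⟨(X - δ * y - 4 * z) / 2, by rcases hδ with rfl | rfl <;> omega⟩
      have hε' : (d * X - m * y) / (2 * d) = t := by
        rw [hm', show d * X - d * (δ + 4 * j) * y = 2 * d * t by linear_combination d * ht]
        exact Int.mul_ediv_cancel_left _ (mul_ne_zero two_ne_zero hd2.ne_zero)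
      rw [hε'] at hε
      have htQ : (X : ℚ) = (δ + 4 * j) * y + 2 * t := by
        exact_mod_cast (by linarith : X = (δ + 4 * j) * y + 2 * t)
      -- the rational coordinate of the generator is `(1 - 2 ε) / 4`
      convert hgen (1 - 2 * ε) (by omega) ?_ using 1
      · simp only [HopfGalois.comb_basisC F.mul_ac, Matrix.cons_val]
        push_cast at hmQ ⊢
        rw [hmQ, htQ]
        congr 1 <;> field_simp <;> ring
      · rw [add_mul, mul_assoc] at ht
        generalize j * y = z at ht
        rcases hδ with rfl | rfl <;> omega
    · obtain ⟨X, x₁, y₁, rfl, hX, hy, hgen⟩ := h2' x y h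
      have hε' : (m * y - d * X) / d = (δ + 4 * j) * y - X := by
        rw [hm', show d * (δ + 4 * j) * y - d * X = d * ((δ + 4 * j) * y - X) by ring]
        exact Int.mul_ediv_cancel_left _ hd2.ne_zero
      rw [hε', add_mul, mul_assoc] at hε
      generalize hz : j * y = z at hε
      -- here `ε` is even, and the rational coordinate of the generator is `(1 - ε) / 4`
      convert hgen (1 - ε) (by rcases hδ with rfl | rfl <;> omega)
        (by rcases hδ with rfl | rfl <;> omega) using 1
      simp only [HopfGalois.comb_basisC F.mul_ac, HopfGalois.point_swap sm sn, Matrix.cons_val]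
      push_cast at hmQ ⊢
      rw [hmQ]
      congr 1 <;> field_simp <;> ring
    · obtain ⟨X, x₁, y₁, rfl, hX, hy, hgen⟩ := h3' x y h
      have hε' : (k - n' * X) / n' = δ + 4 * j - X := by
        rw [hkn, ← mul_sub]
        exact Int.mul_ediv_cancel_left _ hn'2.ne_zero
      rw [hε'] at hε
      -- here `ε` is odd, and the rational coordinate of the generator is `ε / 4`
      convert hgen ε (by rcases hδ with rfl | rfl <;> omega)
        (by rcases hδ with rfl | rfl <;> omega) using 1
      simp only [HopfGalois.comb_basisC F.mul_ac, HopfGalois.point_reverse sm sn, Matrix.cons_val]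
      push_cast at hkQ ⊢
      rw [hndQ, hkQ]
      congr 1 <;> field_simp <;> ring
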